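/- **Setting.** Let $\lambda:[0,\infty)\to(0,\infty)$ (depth of the order book) be $C^2$ and $\rho:[0,\infty)\to(0,\infty)$ (resilience) be $C^1$, and set $\eta_t=\lambda'(t)/\lambda(t)$. Let $(S^0_t)_{t\ge0}$ be a right-continuous martingale on a filtered probability space $(\Omega,\mathcal F,(\mathcal F_t)_{t\ge 0},\mathbb P)$. The limit order book is block-shaped: at time $t$ the number of limit orders available between the prices $S^0_t+y$ and $S^0_t+y+dy$ is $\lambda(t)\,dy$ (shape function $f\equiv1$). For $T>0$ and $x\in\mathbb R$, an admissible strategy $X$ for $x$ on $[0,T]$ is an $(\mathcal F_t)$-adapted left-continuous process $(X_t)_{t\in[0,T+]}$ with $X_0=x$, $X_{T+}=0$, whose paths have finite total variation on $[0,T+]$, bounded by a constant almost surely. Write $\Delta X_t=X_{t+}-X_t$. In model $V$ (volume impact reversion) the volume impact $E$ of $X$ is the solution of $$dE_t=dX_t-\rho_tE_t\,dt,\qquad E_0=0,$$ the price impact is $D_t=E_t/\lambda(t)$, and the expected cost of $X$ is $$\mathcal C(X)=\mathbb E\left[\int_{[0,T]}\left(S^0_t+\frac{E_t}{\lambda(t)}\right)dX_t+\sum_{0\le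 t\le T}\frac{(\Delta X_t)^2}{2\lambda(t)}\right].$$ The model admits transaction-triggered price manipulation (TTPM) on $[0,T]$ if for some $x\in\mathbb R$ there is an admissible strategy $X$ for $x$ with $$\mathcal C(X)<\inf\{\mathcal C(\tilde X):\ \tilde X\text{ admissible for }x\text{ and nonincreasing or nondecreasing}\}.$$ **Statement.** In a block-shaped limit order book, model $V$ does not admit TTPM (on $[0,T]$, for any $T>0$) if and only if, for all $t\ge0$, $$\eta_t+\rho_t\ge0\qquad\text{and}\qquad\left(\frac{\rho_t}{2\rho_t+\eta_t}\right)'+\rho_t\,\frac{\rho_t+\eta_t}{2\rho_t+\eta_t}\ge0 .$$ Moreover the same equivalence holds for each fixed horizon: for every $T>0$, model $V$ does not admit TTPM on $[0,T]$ if and only if both inequalities hold for all $t\in[0,T]$. -/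

import Mathlib

open MeasureTheory Set
open scoped NNReal

noncomputable section

namespace LimitOrderBook

/-! ### The shape of the book -/

/-- `F(y) = ∫_0^y f(x) dx`, the antiderivative of the shape function `f`. -/
def cumulativeShape (f : ℝ → ℝ) (y : ℝ) : ℝ := ∫ x in (0 : ℝ)..y, f x

/-- `F⁻¹`, the inverse of `F`; it is the two-sided inverse whenever `F : ℝ → ℝ` is bijective, which
is the case when `f` is positive and continuous and `F` tends to `±∞` at `±∞`. -/
def cumulativeShapeInv (f : ℝ → ℝ) : ℝ → ℝ := Function.invFun (cumulativeShape f)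

/-- `F̃(y) = ∫_0^y x f(x) dx`. -/
def shapeMoment (f : ℝ → ℝ) (y : ℝ) : ℝ := ∫ x in (0 : ℝ)..y, x * f x

/-- `G = F̃ ∘ F⁻¹`. -/
def tradeCost (f : ℝ → ℝ) (v : ℝ) : ℝ := shapeMoment f (cumulativeShapeInv f v)

/-- The block shape `f ≡ 1`. -/
def blockShape : ℝ → ℝ := fun _ => 1

/-- `η_t = λ'(t) / λ(t)`, the logarithmic derivative of the depth `λ : [0, ∞) → (0, ∞)`. -/
def depthGrowth (lam : ℝ → ℝ) (t : ℝ) : ℝ := derivWithin lam (Ici 0) t / lam t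

/-! ### Strategies -/

open Classical in
/-- The signed Stieltjes measure `dg` of a function `g` of bounded variation on `ℝ`: for
left-continuous `g` it gives mass `g b - g a` to `[a, b)` and `g (t+) - g t` to `{t}`. -/
def stieltjes (g : ℝ → ℝ) : SignedMeasure ℝ :=
  if h : BoundedVariationOn g univ then h.vectorMeasure else 0

variable {Ω : Type*} [mΩ : MeasurableSpace Ω]

/-- `X` is an admissible strategy that liquidates `x` shares on `[0, T]`. A path on `[0, T+]` is
encoded as a function on `ℝ`, by the value `x = X_0` before time `0` and by the value `0 = X_{T+}`
after time `T`, so that the variation over `ℝ` is the variation over `[0, T+]`. -/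
structure IsAdmissible (ℱ : Filtration ℝ≥0 mΩ) (P : Measure Ω) (T x : ℝ) (X : ℝ → Ω → ℝ) :
    Prop where
  initial : ∀ t ≤ 0, ∀ ω, X t ω = x
  terminal : ∀ t, T < t → ∀ ω, X t ω = 0
  adapted : ∀ t : ℝ≥0, Measurable[ℱ t] (X t)
  left_continuous : ∀ ω t, ContinuousWithinAt (fun s => X s ω) (Iic t) t
  finite_variation : ∀ ω, BoundedVariationOn (fun s => X s ω) univ
  bounded_variation : ∃ M : ℝ≥0, ∀ᵐ ω ∂P, eVariationOn (fun s => X s ω) univ ≤ M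

/-- The jump `ΔX_t = X_{t+} - X_t` of a left-continuous path. -/
def jump (g : ℝ → ℝ) (t : ℝ) : ℝ := Function.rightLim g t - g t

/-! ### Model with volume impact reversion -/

/-- `E` is the volume impact process of the strategy `X` on `[0, T]`:
`dE_t = dX_t - ρ_t E_t dt`, `E_0 = 0`. -/
structure IsVolumeImpact (rho : ℝ → ℝ) (T : ℝ) (X E : ℝ → Ω → ℝ) : Prop where
  integrable : ∀ ω, IntegrableOn (fun s => rho s * E s ω) (Icc 0 T) volume
  dynamics : ∀ ω, ∀ t ∈ Icc (0 : ℝ) T,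
    E t ω = X t ω - X 0 ω - ∫ s in (0 : ℝ)..t, rho s * E s ω

/-- The price impact `D_t = F⁻¹(E_t / λ(t))`. -/
def priceImpact (f lam : ℝ → ℝ) (E : ℝ → Ω → ℝ) (t : ℝ) (ω : Ω) : ℝ :=
  cumulativeShapeInv f (E t ω / lam t)

/-- The cost of the strategy `X` along the path `ω`, where `E` is its volume impact and `S` the
unaffected price:
`∫_{[0,T]} (S_t + D_t) dX_t
  + ∑_{t ≤ T} (λ(t) [G((E_t + ΔX_t) / λ(t)) - G(E_t / λ(t))] - D_t ΔX_t)`,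
with `D_t = F⁻¹(E_t / λ(t))`. -/
def pathCost (S : ℝ≥0 → Ω → ℝ) (f lam : ℝ → ℝ) (T : ℝ) (X E : ℝ → Ω → ℝ) (ω : Ω) : ℝ :=
  ((stieltjes fun s => X s ω).restrict (Icc 0 T)).integral
      (fun t => S t.toNNReal ω + priceImpact f lam E t ω) (ContinuousLinearMap.lsmul ℝ ℝ)
    + ∑' t : Icc (0 : ℝ) T,
        (lam t * (tradeCost f ((E t ω + jump (fun s => X s ω) t) / lam t)
            - tradeCost f (E t ω / lam t))
          - priceImpact f lam E t ω * jump (fun s => X s ω) t)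

/-- The expected cost `C(X)`. -/
def expectedCost (P : Measure Ω) (S : ℝ≥0 → Ω → ℝ) (f lam : ℝ → ℝ) (T : ℝ) (X E : ℝ → Ω → ℝ) : ℝ :=
  ∫ ω, pathCost S f lam T X E ω ∂P

/-- The model with volume impact reversion (shape `f`, depth `lam`, resilience `rho`, unaffected
price `S`) admits transaction-triggered price manipulations over the period `[0, T]`: for some
`x`, some admissible strategy for `x` has an expected cost smaller than the infimum of the expected
costs of the admissible strategies for `x` that are nonincreasing or nondecreasing. The infimum is
taken in the extended reals. -/
def AdmitsTTPM (ℱ : Filtration ℝ≥0 mΩ) (P : Measure Ω) (S : ℝ≥0 → Ω → ℝ)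
    (f lam rho : ℝ → ℝ) (T : ℝ) : Prop :=
  ∃ (x : ℝ) (X E : ℝ → Ω → ℝ), IsAdmissible ℱ P T x X ∧ IsVolumeImpact rho T X E ∧
    (expectedCost P S f lam T X E : EReal) <
      ⨅ (Y : ℝ → Ω → ℝ) (EY : ℝ → Ω → ℝ) (_ : IsAdmissible ℱ P T x Y)
        (_ : IsVolumeImpact rho T Y EY)
        (_ : (∀ ω, Antitone fun t => Y t ω) ∨ (∀ ω, Monotone fun t => Y t ω)),
        (expectedCost P S f lam T Y EY : EReal)

end LimitOrderBook

end

/-! Trading at the unaffected price costs `-x E[S_T]` whatever the strategy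
(`IsAdmissible.integral_price`). Indeed the Riemann sum of `S_{t_{i+1}} (X_{t_{i+1}} - X_{t_i})` has
the expectation of `S_T (X_T - x)`, since `S` is a martingale and each increment is known at
`t_{i+1}`; uniform integrability carries this to the limit. The rest of the cost is pathwise.
Summation by parts for `e² / (2λ)` turns it, jumps included, into the quadratic functional
`impactCost`, namely `(x + ∫ρe)² / (2λ_T) + ∫ (2ρ+η)/(2λ) e²`, where `x + ∫ρe` is minus the impact
left after the last trade (`cost_eq_add_impactCost`). Only deterministic paths then matter: a
deterministic minimizer beats any random strategy for every `ω`.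

Suppose `2ρ + η > 0` on `[0, T]` and put `r = ρ/(2ρ+η)`. Completing the square
(`IsImpactPath.impactCost_eq`) shows that the minimizer is `e = -κ λ r` with `κ (λ_T + ∫ρλr) = x`.
For `x > 0` the strategy behind it sells `κ λ_0 r_0` at time `0`, then trades at rate `κ λ (r' +
ρ(ρ+η)/(2ρ+η))`, and finally sells `κ λ_T (ρ_T+η_T)/(2ρ_T+η_T)`. The two conditions make all three
nonnegative, so the optimum is monotone and there is no manipulation.

For the converse the minimizer must beat the infimum over monotone strategies strictly, so a uniform
gap is needed. Along a nonincreasing path `exp(∫ρ) e` is nonincreasing. If the second expression is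
negative somewhere, the optimal `exp(∫ρ) e` is strictly increasing on an interval, and every
nonincreasing path stays away from it on part of that interval. If only the first condition fails,
then, `exp(-∫ρ)(1-r)` being nonincreasing, it fails at `T`, where the optimum ends with a purchase.
Finally, `2ρ+η` must be positive for there to be no manipulation: where it is negative, a short
round trip makes money; where it touches zero, `1/(2ρ+η)` is not integrable and liquidation becomes
arbitrarily cheap, whereas monotone liquidation has a positive minimal cost. -/

noncomputable section

namespace LimitOrderBook

open Filter Topology

/-! ### Uniform grids -/

/-- The `i`-th point of the grid that cuts `[0, T]` into `n` equal pieces. -/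
def grid (T : ℝ) (n i : ℕ) : ℝ := T * i / n

/-- The index of the cell of the grid that contains `t`. -/
def gridIndex (T : ℝ) (n : ℕ) (t : ℝ) : ℕ := ⌊t / T * n⌋₊

section Grid

variable {T t : ℝ} {n : ℕ}

@[simp] lemma grid_zero : grid T n 0 = 0 := by simp [grid]

lemma grid_self (hn : n ≠ 0) : grid T n n = T := by
  have : (n : ℝ) ≠ 0 := by exact_mod_cast hn
  simp [grid, this]

lemma monotone_grid (hT : 0 < T) : Monotone (grid T n) := by
  intro i j hij
  have : (i : ℝ) ≤ j := by exact_mod_cast hij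
  unfold grid
  gcongr

lemma grid_nonneg (hT : 0 < T) (i : ℕ) : 0 ≤ grid T n i := by
  unfold grid; positivity

lemma grid_le (hT : 0 < T) {i : ℕ} (hi : i ≤ n) : grid T n i ≤ T := by
  rcases Nat.eq_zero_or_pos n with rfl | hn
  · simp [grid, hT.le]
  · exact (monotone_grid hT hi).trans (grid_self hn.ne').le

lemma mem_cell_iff (hT : 0 < T) (hn : 0 < n) (ht : 0 ≤ t) (i : ℕ) :
    t ∈ Ico (grid T n i) (grid T n (i + 1)) ↔ gridIndex T n t = i := by
  have hn' : (0 : ℝ) < n := by exact_mod_cast hn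
  rw [gridIndex, Nat.floor_eq_iff (by positivity), mem_Ico]
  unfold grid
  rw [div_le_iff₀ hn', lt_div_iff₀ hn', div_mul_eq_mul_div, le_div_iff₀ hT, div_lt_iff₀ hT]
  push_cast
  rw [mul_comm T, mul_comm T]

lemma gridIndex_lt (hT : 0 < T) (hn : 0 < n) (ht : t ∈ Ico 0 T) : gridIndex T n t < n := by
  have hn' : (0 : ℝ) < n := by exact_mod_cast hn
  rw [gridIndex, Nat.floor_lt (by have := ht.1; positivity)]
  have : t / T < 1 := (div_lt_one hT).2 ht.2
  nlinarith

lemma grid_gridIndex_le (hT : 0 < T) (hn : 0 < n) (ht : 0 ≤ t) :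
    grid T n (gridIndex T n t) ≤ t :=
  ((mem_cell_iff hT hn ht _).2 rfl).1

lemma lt_grid_gridIndex (hT : 0 < T) (hn : 0 < n) (ht : 0 ≤ t) :
    t < grid T n (gridIndex T n t + 1) :=
  ((mem_cell_iff hT hn ht _).2 rfl).2

lemma grid_succ (i : ℕ) : grid T n (i + 1) = grid T n i + T / n := by
  unfold grid; push_cast; ring

/-- Cells are closed on the left and open on the right: left ends approach `t` from `(-∞, t]` and
right ends strictly from above. Along them a left-continuous function tends to its value and to its
right limit respectively, which is how Riemann sums detect jumps. -/
lemma tendsto_grid_left (hT : 0 < T) (ht : 0 ≤ t) :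
    Tendsto (fun n => grid T n (gridIndex T n t)) atTop (𝓝[≤] t) := by
  refine tendsto_nhdsWithin_iff.2 ⟨?_, ?_⟩
  · have h0 : Tendsto (fun n : ℕ => t - T / n) atTop (𝓝 (t - 0)) :=
      tendsto_const_nhds.sub (tendsto_const_div_atTop_nhds_zero_nat T)
    rw [sub_zero] at h0
    refine tendsto_of_tendsto_of_tendsto_of_le_of_le' h0 tendsto_const_nhds ?_ ?_
    · filter_upwards [eventually_gt_atTop 0] with n hn
      have := lt_grid_gridIndex hT hn ht
      rw [grid_succ] at this
      linarith
    · filter_upwards [eventually_gt_atTop 0] with n hn using grid_gridIndex_le hT hn ht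
  · filter_upwards [eventually_gt_atTop 0] with n hn using grid_gridIndex_le hT hn ht

lemma tendsto_grid_right (hT : 0 < T) (ht : 0 ≤ t) :
    Tendsto (fun n => grid T n (gridIndex T n t + 1)) atTop (𝓝[>] t) := by
  refine tendsto_nhdsWithin_iff.2 ⟨?_, ?_⟩
  · have h0 : Tendsto (fun n : ℕ => grid T n (gridIndex T n t) + T / n) atTop (𝓝 (t + 0)) :=
      (tendsto_grid_left hT ht).mono_right inf_le_left |>.add
        (tendsto_const_div_atTop_nhds_zero_nat T)
    rw [add_zero] at h0
    exact h0.congr fun n => (grid_succ _).symm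
  · filter_upwards [eventually_gt_atTop 0] with n hn using lt_grid_gridIndex hT hn ht

/-- The step function with value `c i` on the `i`-th cell of the grid. -/
def gridStep (T : ℝ) (n : ℕ) (c : ℕ → ℝ) (t : ℝ) : ℝ :=
  ∑ i ∈ Finset.range n, (Ico (grid T n i) (grid T n (i + 1))).indicator (fun _ => c i) t

lemma gridStep_eq (hT : 0 < T) (hn : 0 < n) (ht : t ∈ Ico 0 T) (c : ℕ → ℝ) :
    gridStep T n c t = c (gridIndex T n t) := by
  unfold gridStep
  rw [Finset.sum_eq_single (gridIndex T n t)]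
  · rw [indicator_of_mem ((mem_cell_iff hT hn ht.1 _).2 rfl)]
  · intro i _ hi
    rw [indicator_of_notMem]
    rw [mem_cell_iff hT hn ht.1]
    exact fun h => hi h.symm
  · intro h
    exact absurd (Finset.mem_range.2 (gridIndex_lt hT hn ht)) h

lemma measurable_gridStep (c : ℕ → ℝ) : Measurable (gridStep T n c) := by
  unfold gridStep
  exact Finset.measurable_fun_sum _ fun i _ => measurable_const.indicator measurableSet_Ico

end Grid

/-! ### Integration against a signed measure -/

instance isFiniteMeasure_variation (μ : SignedMeasure ℝ) : IsFiniteMeasure μ.variation := by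
  rw [← SignedMeasure.totalVariation_eq_variation]
  infer_instance

lemma integral_gridStep {T : ℝ} (hT : 0 < T) (μ : SignedMeasure ℝ) (n : ℕ) (c : ℕ → ℝ) :
    (μ.restrict (Ico 0 T)).integral (gridStep T n c) (ContinuousLinearMap.lsmul ℝ ℝ)
      = ∑ i ∈ Finset.range n, c i * μ (Ico (grid T n i) (grid T n (i + 1))) := by
  unfold gridStep
  rw [VectorMeasure.integral_finsetSum]
  · refine Finset.sum_congr rfl fun i hi => ?_
    have hi : i + 1 ≤ n := Finset.mem_range.1 hi
    rw [VectorMeasure.integral_indicator_const _ measurableSet_Ico,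
      VectorMeasure.restrict_apply _ measurableSet_Ico measurableSet_Ico,
      inter_eq_left.2 (Ico_subset_Ico (grid_nonneg hT i) (grid_le hT hi))]
    simp
  · intro i _
    exact (integrable_const (c i)).indicator measurableSet_Ico

/-- The sum is the integral of the step function with values `c n i`, so this is dominated
convergence against the finite measure `μ.variation`. Convergence is needed at every point, as `μ`
may have atoms. -/
theorem tendsto_sum_grid_signedMeasure {T : ℝ} (hT : 0 < T) (μ : SignedMeasure ℝ)
    (c : ℕ → ℕ → ℝ) (C : ℝ) (hC : ∀ n, ∀ i < n, |c n i| ≤ C) (f : ℝ → ℝ)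
    (hf : ∀ t ∈ Ico 0 T, Tendsto (fun n => c n (gridIndex T n t)) atTop (𝓝 (f t))) :
    Tendsto (fun n => ∑ i ∈ Finset.range n, c n i * μ (Ico (grid T n i) (grid T n (i + 1))))
      atTop (𝓝 ((μ.restrict (Ico 0 T)).integral f (ContinuousLinearMap.lsmul ℝ ℝ))) := by
  simp_rw [← integral_gridStep hT μ]
  have hmem : ∀ᵐ t ∂(μ.restrict (Ico 0 T)).variation, t ∈ Ico 0 T := by
    rw [VectorMeasure.variation_restrict measurableSet_Ico]
    exact ae_restrict_mem measurableSet_Ico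
  refine VectorMeasure.tendsto_integral_filter_of_norm_le_const
    (Eventually.of_forall fun n => (measurable_gridStep _).aestronglyMeasurable) ⟨C, ?_⟩ ?_
  · filter_upwards [eventually_gt_atTop 0] with n hn
    filter_upwards [hmem] with t ht
    rw [gridStep_eq hT hn ht]
    exact hC n _ (gridIndex_lt hT hn ht)
  · filter_upwards [hmem] with t ht
    refine (hf t ht).congr' ?_
    filter_upwards [eventually_gt_atTop 0] with n hn
    rw [gridStep_eq hT hn ht]

/-- The analogue for the density `h`; here convergence almost everywhere suffices, and `C |h|`
dominates. -/
theorem tendsto_sum_grid_intervalIntegral {T : ℝ} (hT : 0 < T) (h : ℝ → ℝ)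
    (hh : IntegrableOn h (Icc 0 T))
    (c : ℕ → ℕ → ℝ) (C : ℝ) (hC : ∀ n, ∀ i < n, |c n i| ≤ C) (f : ℝ → ℝ)
    (hf : ∀ᵐ t, t ∈ Ico 0 T → Tendsto (fun n => c n (gridIndex T n t)) atTop (𝓝 (f t))) :
    Tendsto (fun n => ∑ i ∈ Finset.range n, c n i * ∫ s in (grid T n i)..(grid T n (i + 1)), h s)
      atTop (𝓝 (∫ s in (0 : ℝ)..T, f s * h s)) := by
  have key : ∀ n, ∑ i ∈ Finset.range n, c n i * ∫ s in (grid T n i)..(grid T n (i + 1)), h s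
      = ∫ s in Ico 0 T, gridStep T n (c n) s * h s := by
    intro n
    unfold gridStep
    simp_rw [Finset.sum_mul]
    have hind : ∀ (i : ℕ) (s : ℝ), (Ico (grid T n i) (grid T n (i + 1))).indicator
        (fun _ => c n i) s * h s =
        (Ico (grid T n i) (grid T n (i + 1))).indicator (fun s => c n i * h s) s := by
      intro i s
      by_cases hs : s ∈ Ico (grid T n i) (grid T n (i + 1)) <;> simp [hs]
    simp_rw [hind]
    rw [integral_finsetSum]
    · refine Finset.sum_congr rfl fun i hi => ?_
      have hi : i + 1 ≤ n := Finset.mem_range.1 hi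
      rw [integral_indicator measurableSet_Ico, Measure.restrict_restrict measurableSet_Ico,
        inter_eq_left.2 (Ico_subset_Ico (grid_nonneg hT i) (grid_le hT hi)),
        intervalIntegral.integral_of_le (monotone_grid hT (Nat.le_succ i)),
        integral_const_mul, integral_Ico_eq_integral_Ioc]
    · intro i _
      exact ((hh.mono_set Ico_subset_Icc_self).const_mul (c n i)).indicator measurableSet_Ico
  simp_rw [key]
  rw [intervalIntegral.integral_of_le hT.le, ← integral_Ico_eq_integral_Ioc]
  refine tendsto_integral_filter_of_dominated_convergence (fun s => C * |h s|)
    (Eventually.of_forall fun n => ?_) ?_ ?_ ?_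
  · exact ((measurable_gridStep _).aestronglyMeasurable).mul
      (hh.mono_set Ico_subset_Icc_self).aestronglyMeasurable
  · filter_upwards [eventually_gt_atTop 0] with n hn
    filter_upwards [ae_restrict_mem measurableSet_Ico] with t ht
    rw [gridStep_eq hT hn ht, norm_mul]
    exact mul_le_mul_of_nonneg_right (hC n _ (gridIndex_lt hT hn ht)) (norm_nonneg _)
  · exact ((hh.mono_set Ico_subset_Icc_self).abs).const_mul C
  · filter_upwards [ae_restrict_mem measurableSet_Ico, ae_restrict_of_ae hf] with t ht hft
    refine ((hft ht).congr' ?_).mul_const _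
    filter_upwards [eventually_gt_atTop 0] with n hn
    rw [gridStep_eq hT hn ht]

/-! ### Left-continuous paths of bounded variation and their jumps -/

section Stieltjes

variable {g : ℝ → ℝ}

lemma leftLim_eq_of_continuousWithinAt {t : ℝ} (hl : ContinuousWithinAt g (Iic t) t) :
    Function.leftLim g t = g t :=
  leftLim_eq_of_tendsto (hl.tendsto.mono_left (nhdsWithin_mono _ Iio_subset_Iic_self))

lemma stieltjes_Ico (hg : BoundedVariationOn g univ)
    (hl : ∀ t, ContinuousWithinAt g (Iic t) t) {a b : ℝ} (hab : a ≤ b) :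
    stieltjes g (Ico a b) = g b - g a := by
  rw [stieltjes, dif_pos hg, hg.vectorMeasure_Ico hab, leftLim_eq_of_continuousWithinAt (hl a),
    leftLim_eq_of_continuousWithinAt (hl b)]

lemma stieltjes_singleton (hg : BoundedVariationOn g univ)
    (hl : ∀ t, ContinuousWithinAt g (Iic t) t) (t : ℝ) :
    stieltjes g {t} = jump g t := by
  rw [stieltjes, dif_pos hg, hg.vectorMeasure_singleton, leftLim_eq_of_continuousWithinAt (hl t),
    jump]

/-- The jump times are the atoms of the Stieltjes measure, and a finite measure charges only
countably many disjoint singletons. -/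
lemma countable_jump_ne_zero (hg : BoundedVariationOn g univ)
    (hl : ∀ t, ContinuousWithinAt g (Iic t) t) : {t | jump g t ≠ 0}.Countable := by
  refine (Measure.countable_meas_pos_of_disjoint_iUnion (μ := (stieltjes g).variation)
    (As := fun t : ℝ => {t}) (fun t => measurableSet_singleton t) ?_).mono ?_
  · intro s t hst
    simpa [Function.onFun] using hst
  · intro t ht
    have h := VectorMeasure.enorm_measure_le_variation (stieltjes g) {t}
    rw [stieltjes_singleton hg hl] at h
    exact lt_of_lt_of_le (by simpa [pos_iff_ne_zero] using ht) h

lemma tendsto_jump (hg : BoundedVariationOn g univ) (t : ℝ) :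
    Tendsto g (𝓝[>] t) (𝓝 (g t + jump g t)) := by
  have := hg.tendsto_rightLim t
  simpa [jump] using this

lemma exists_abs_le_of_boundedVariationOn (hg : BoundedVariationOn g univ) :
    ∃ C, ∀ t, |g t| ≤ C := by
  refine ⟨|g 0| + (eVariationOn g univ).toReal, fun t => ?_⟩
  have := hg.dist_le (mem_univ t) (mem_univ 0)
  rw [Real.dist_eq] at this
  have h2 := abs_sub_abs_le_abs_sub (g t) (g 0)
  linarith

lemma continuousAt_of_jump_eq_zero (hg : BoundedVariationOn g univ) {t : ℝ}
    (hl : ContinuousWithinAt g (Iic t) t) (h0 : jump g t = 0) : ContinuousAt g t := by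
  have h1 := tendsto_jump hg t
  rw [h0, add_zero] at h1
  exact continuousAt_iff_continuous_left'_right'.2 ⟨hl.mono Iio_subset_Iic_self, h1⟩

lemma measurable_of_boundedVariationOn (hg : BoundedVariationOn g univ)
    (hl : ∀ t, ContinuousWithinAt g (Iic t) t) : Measurable g :=
  measurable_of_countable_not_continuousAt <| (countable_jump_ne_zero hg hl).mono fun t ht h0 =>
    ht (continuousAt_of_jump_eq_zero hg (hl t) h0)

/-- An integrand that vanishes at the continuity points of `g` is integrated by summing over the jumps. -/
lemma integral_stieltjes_eq_tsum (hg : BoundedVariationOn g univ)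
    (hl : ∀ t, ContinuousWithinAt g (Iic t) t) {s : Set ℝ} (hs : MeasurableSet s) (f : ℝ → ℝ)
    (hf : ∀ t ∈ s, jump g t = 0 → f t = 0) (C : ℝ) (hC : ∀ t ∈ s, |f t| ≤ C) :
    ((stieltjes g).restrict s).integral f (ContinuousLinearMap.lsmul ℝ ℝ)
      = ∑' t : s, f t * jump g t := by
  set D : Set ℝ := {t | t ∈ s ∧ jump g t ≠ 0} with hD
  have hDc : D.Countable := (countable_jump_ne_zero hg hl).mono fun t ht => ht.2
  have hDs : D ⊆ s := fun t ht => ht.1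
  -- Off the countable set `D` of jump times the integrand vanishes; on `D` the integral is a sum
  -- over atoms, and no measurability of `f` is required.
  rw [VectorMeasure.setIntegral_eq_of_subset_of_forall_sdiff_eq_zero hDc.measurableSet hs hDs]
  · have hU : (⋃ i : D, {(i : ℝ)}) = D := by simp
    have : Countable D := hDc.to_subtype
    have hint : (stieltjes g).IntegrableOn f (⋃ i : D, {(i : ℝ)}) := by
      rw [hU, VectorMeasure.IntegrableOn, VectorMeasure.Integrable,
        VectorMeasure.variation_restrict hDc.measurableSet]
      refine (integrable_const C).mono' ?_ ?_
      · rw [← hU]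
        refine (aestronglyMeasurable_iUnion_iff).2 fun i => ?_
        rw [Measure.restrict_singleton]
        exact (aestronglyMeasurable_dirac).smul_measure _
      · filter_upwards [ae_restrict_mem hDc.measurableSet] with t ht using hC t (hDs ht)
    have h := VectorMeasure.integral_iUnion (B := ContinuousLinearMap.lsmul ℝ ℝ)
      (fun i : D => measurableSet_singleton (i : ℝ)) (fun i j hij => by
        simpa [Function.onFun, Subtype.ext_iff] using hij) hint
    rw [hU] at h
    rw [h]
    simp_rw [VectorMeasure.integral_singleton, stieltjes_singleton hg hl]
    simp only [ContinuousLinearMap.lsmul_apply, smul_eq_mul]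
    rw [← tsum_subtype_eq_of_support_subset (f := fun t : s => f t * jump g t)
      (s := {t : s | jump g t ≠ 0})]
    · let e : D ≃ {t : s | jump g t ≠ 0} :=
        ⟨fun t => ⟨⟨t, t.2.1⟩, t.2.2⟩, fun t => ⟨t, t.1.2, t.2⟩, fun _ => rfl, fun _ => rfl⟩
      exact Equiv.tsum_eq e (fun t : {t : s | jump g t ≠ 0} => f t * jump g t)
    · intro t ht h0
      exact ht (by simp [h0])
  · intro t ht
    exact hf t ht.1 (by by_contra h; exact ht.2 ⟨ht.1, h⟩)

end Stieltjes

end LimitOrderBook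

end

noncomputable section

namespace LimitOrderBook

open Filter Topology

/-! ### The block shape -/

lemma cumulativeShape_blockShape (y : ℝ) : cumulativeShape blockShape y = y := by
  simp [cumulativeShape, blockShape]

lemma cumulativeShapeInv_blockShape (y : ℝ) : cumulativeShapeInv blockShape y = y := by
  have h : cumulativeShape blockShape = id := funext cumulativeShape_blockShape
  have := Function.leftInverse_invFun (f := (id : ℝ → ℝ)) Function.injective_id y
  rw [cumulativeShapeInv, h]
  exact this

lemma tradeCost_blockShape (v : ℝ) : tradeCost blockShape v = v ^ 2 / 2 := by
  simp [tradeCost, cumulativeShapeInv_blockShape, shapeMoment, blockShape]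

lemma pathCost_blockShape {Ω : Type*} (S : ℝ≥0 → Ω → ℝ) {lam : ℝ → ℝ} {T : ℝ} (X E : ℝ → Ω → ℝ)
    (ω : Ω) (hlam : ∀ t, 0 ≤ t → 0 < lam t) :
    pathCost S blockShape lam T X E ω =
      ((stieltjes fun s => X s ω).restrict (Icc 0 T)).integral
        (fun t => S t.toNNReal ω + E t ω / lam t) (ContinuousLinearMap.lsmul ℝ ℝ)
      + ∑' t : Icc (0 : ℝ) T,
        (2 * lam t)⁻¹ * jump (fun s => X s ω) t * jump (fun s => X s ω) t := by
  unfold pathCost priceImpact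
  simp only [cumulativeShapeInv_blockShape, tradeCost_blockShape]
  congr 1
  refine tsum_congr fun t => ?_
  have := (hlam t t.2.1).ne'
  field_simp
  ring

/-! ### The depth of the book -/

section Depth

variable {lam : ℝ → ℝ}

lemma hasDerivAt_of_contDiffOn_Ici {f : ℝ → ℝ} {n : WithTop ℕ∞} (hn : 1 ≤ n)
    (hf : ContDiffOn ℝ n f (Ici 0)) {t : ℝ} (ht : 0 < t) :
    HasDerivAt f (derivWithin f (Ici 0) t) t :=
  ((hf.differentiableOn (by intro h; simp [h] at hn) t ht.le).hasDerivWithinAt).hasDerivAt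
    (Ici_mem_nhds ht)

/-- Since `(1/λ)' = -η/λ`; this is where `η` enters the cost. -/
lemma inv_sub_inv_eq_integral (hpos : ∀ t, 0 ≤ t → 0 < lam t) (hlam : ContDiffOn ℝ 2 lam (Ici 0))
    {a b : ℝ} (ha : 0 ≤ a) (hab : a ≤ b) :
    ∫ s in a..b, -(depthGrowth lam s / lam s) = (lam b)⁻¹ - (lam a)⁻¹ := by
  have hc : ContinuousOn lam (Ici 0) := hlam.continuousOn
  have hc' : ContinuousOn (derivWithin lam (Ici 0)) (Ici 0) :=
    hlam.continuousOn_derivWithin (uniqueDiffOn_Ici 0) (by norm_num)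
  have hsub : Icc a b ⊆ Ici 0 := fun t ht => ha.trans ht.1
  refine intervalIntegral.integral_eq_sub_of_hasDerivAt_of_le hab
    ((hc.mono hsub).inv₀ fun t ht => (hpos t (hsub ht)).ne') (fun t ht => ?_) ?_
  · have h0 : 0 < t := ha.trans_lt ht.1
    have h := (hasDerivAt_of_contDiffOn_Ici (by norm_num) hlam h0).inv (hpos t h0.le).ne'
    refine h.congr_deriv ?_
    have := (hpos t h0.le).ne'
    rw [depthGrowth]
    field_simp
  · refine ContinuousOn.intervalIntegrable_of_Icc hab ?_
    unfold depthGrowth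
    exact (((hc'.mono hsub).div (hc.mono hsub) fun t ht => (hpos t (hsub ht)).ne').div
      (hc.mono hsub) fun t ht => (hpos t (hsub ht)).ne').neg

lemma continuousOn_depthGrowth (hpos : ∀ t, 0 ≤ t → 0 < lam t)
    (hlam : ContDiffOn ℝ 2 lam (Ici 0)) : ContinuousOn (depthGrowth lam) (Ici 0) :=
  (hlam.continuousOn_derivWithin (uniqueDiffOn_Ici 0) (by norm_num)).div hlam.continuousOn
    fun t ht => (hpos t ht).ne'

end Depth

/-! ### The cost along a path -/

/-- The running cost rate `(2 ρ + η) / (2 λ)`. -/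
def runningRate (lam rho : ℝ → ℝ) (t : ℝ) : ℝ := (2 * rho t + depthGrowth lam t) / (2 * lam t)

/-- The cost, beyond that of the unaffected price, of liquidating `x` shares along a path with
volume impact `e`. -/
def impactCost (lam rho : ℝ → ℝ) (T x : ℝ) (e : ℝ → ℝ) : ℝ :=
  (x + ∫ s in (0 : ℝ)..T, rho s * e s) ^ 2 / (2 * lam T)
    + ∫ s in (0 : ℝ)..T, runningRate lam rho s * e s ^ 2

section Path

variable {lam rho : ℝ → ℝ} {T x : ℝ} {g e : ℝ → ℝ}

/-- The volume impact on `[0, T]` of a left-continuous path `g` of bounded variation extends to a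
bounded left-continuous function with the jumps of `g`. -/
lemma exists_extension_volumeImpact (hT : 0 < T) (hg : BoundedVariationOn g univ)
    (hl : ∀ t, ContinuousWithinAt g (Iic t) t)
    (hint : IntegrableOn (fun s => rho s * e s) (Icc 0 T))
    (he : ∀ t ∈ Icc 0 T, e t = g t - g 0 - ∫ s in (0 : ℝ)..t, rho s * e s) :
    ∃ ee : ℝ → ℝ, (∀ t ∈ Icc 0 T, e t = ee t) ∧ (∃ C, ∀ t, |ee t| ≤ C) ∧
      (∀ t, ContinuousWithinAt ee (Iic t) t) ∧ Measurable ee ∧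
      ∀ t, Tendsto ee (𝓝[>] t) (𝓝 (ee t + jump g t)) := by
  have hP : ContinuousOn (fun t => ∫ s in (0 : ℝ)..t, rho s * e s) (Icc 0 T) := by
    have := intervalIntegral.continuousOn_primitive_interval (f := fun s => rho s * e s)
      (μ := volume) (a := 0) (b := T) (by rwa [uIcc_of_le hT.le])
    rwa [uIcc_of_le hT.le] at this
  -- The primitive is frozen outside `[0, T]`, so it stays continuous and bounded, and all jumps
  -- come from `g`.
  set Q : ℝ → ℝ := IccExtend hT.le ((Icc 0 T).domRestrict fun t => ∫ s in (0 : ℝ)..t, rho s * e s)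
  have hQ : Continuous Q := (continuousOn_iff_continuous_domRestrict.1 hP).Icc_extend'
  obtain ⟨C₁, hC₁⟩ := exists_abs_le_of_boundedVariationOn hg
  obtain ⟨C₂, hC₂⟩ := isCompact_Icc.exists_bound_of_continuousOn hP
  have hC₂' : ∀ t, |Q t| ≤ C₂ := fun t => hC₂ _ (projIcc 0 T hT.le t).2
  refine ⟨fun t => g t - g 0 - Q t, fun t ht => ?_, ⟨C₁ + C₁ + C₂, fun t => ?_⟩, fun t => ?_, ?_,
    fun t => ?_⟩
  · rw [he t ht]
    congr 1
    simp [Q, IccExtend_of_mem hT.le _ ht, Set.domRestrict_apply]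
  · exact (abs_sub _ _).trans (add_le_add ((abs_sub _ _).trans (add_le_add (hC₁ t) (hC₁ 0)))
      (hC₂' t))
  · exact ((hl t).sub continuousWithinAt_const).sub hQ.continuousWithinAt
  · exact ((measurable_of_boundedVariationOn hg hl).sub measurable_const).sub hQ.measurable
  · have := ((tendsto_jump hg t).sub_const (g 0)).sub
      ((hQ.tendsto t).mono_left nhdsWithin_le_nhds)
    convert this using 2
    ring

/-- Summation by parts for `e² / (2λ)`. The integrand is the mean of `e_t` and `e_{t+}` divided by
`λ`, that is, the impact together with the block cost `Δ²/(2λ)` of each jump. Grid increments of `e²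
/ (2λ)` split exactly into a depth term, a trading term and a resilience term, and each sum
converges to its integral. -/
theorem integral_stieltjes_Ico_impact (hT : 0 < T) (hpos : ∀ t, 0 ≤ t → 0 < lam t)
    (hlam : ContDiffOn ℝ 2 lam (Ici 0)) (hg : BoundedVariationOn g univ)
    (hl : ∀ t, ContinuousWithinAt g (Iic t) t)
    (hint : IntegrableOn (fun s => rho s * e s) (Icc 0 T))
    (he : ∀ t ∈ Icc 0 T, e t = g t - g 0 - ∫ s in (0 : ℝ)..t, rho s * e s)
    (hrint : IntegrableOn (fun s => rho s) (Icc 0 T)) :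
    ((stieltjes g).restrict (Ico 0 T)).integral
        (fun t => (2 * lam t)⁻¹ * (2 * e t + jump g t)) (ContinuousLinearMap.lsmul ℝ ℝ)
      = e T ^ 2 / (2 * lam T) + ∫ s in (0 : ℝ)..T, runningRate lam rho s * e s ^ 2 := by
  obtain ⟨ee, hee, ⟨C, hC⟩, hleft, hmeas, hright⟩ := exists_extension_volumeImpact hT hg hl hint he
  have hlc : ContinuousOn lam (Icc 0 T) := hlam.continuousOn.mono Icc_subset_Ici_self
  have hθ : ContinuousOn (fun t => (2 * lam t)⁻¹) (Icc 0 T) :=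
    (continuousOn_const.mul hlc).inv₀ fun t ht => (mul_pos two_pos (hpos t ht.1)).ne'
  obtain ⟨K, hK⟩ := isCompact_Icc.exists_bound_of_continuousOn hθ
  have hK0 : 0 ≤ K := (norm_nonneg _).trans (hK 0 ⟨le_rfl, hT.le⟩)
  have hC0 : 0 ≤ C := (abs_nonneg _).trans (hC 0)
  have hgrid : ∀ {n i : ℕ}, i ≤ n → grid T n i ∈ Icc 0 T := fun hi =>
    ⟨grid_nonneg hT _, grid_le hT hi⟩
  have hdc : ContinuousOn (fun s => -(depthGrowth lam s / lam s)) (Icc 0 T) :=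
    (((continuousOn_depthGrowth hpos hlam).mono Icc_subset_Ici_self).div hlc
      fun t ht => (hpos t ht.1).ne').neg
  have hT' : T ∈ Icc 0 T := ⟨hT.le, le_rfl⟩
  have tl : ∀ t ∈ Ico 0 T, Tendsto (fun n => ee (grid T n (gridIndex T n t))) atTop (𝓝 (ee t)) :=
    fun t ht => (hleft t).tendsto.comp (tendsto_grid_left hT ht.1)
  have tr : ∀ t ∈ Ico 0 T, Tendsto (fun n => ee (grid T n (gridIndex T n t + 1))) atTop
      (𝓝 (ee t + jump g t)) := fun t ht => (hright t).comp (tendsto_grid_right hT ht.1)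
  have tθ : ∀ t ∈ Ico 0 T, Tendsto (fun n => (2 * lam (grid T n (gridIndex T n t + 1)))⁻¹) atTop
      (𝓝 ((2 * lam t)⁻¹)) := by
    intro t ht
    refine (hθ t (Ico_subset_Icc_self ht)).tendsto.comp (tendsto_nhdsWithin_iff.2
      ⟨(tendsto_grid_right hT ht.1).mono_right inf_le_left, ?_⟩)
    filter_upwards [eventually_gt_atTop 0] with n hn
    exact hgrid (gridIndex_lt hT hn ht)
  -- the three Riemann sums
  have A := tendsto_sum_grid_intervalIntegral hT (fun s => -(depthGrowth lam s / lam s))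
    hdc.integrableOn_Icc (fun n i => ee (grid T n i) ^ 2 / 2) (C ^ 2 / 2)
    (fun n i hi => by
      rw [abs_of_nonneg (by positivity)]
      have := hC (grid T n i)
      have := sq_le_sq' (abs_le.1 this).1 (abs_le.1 this).2
      linarith)
    (fun t => ee t ^ 2 / 2) (ae_of_all _ fun t ht => ((tl t ht).pow 2).div_const 2)
  have hcb : ∀ n, ∀ i < n, |(2 * lam (grid T n (i + 1)))⁻¹ *
      (ee (grid T n i) + ee (grid T n (i + 1)))| ≤ K * (C + C) := by
    intro n i hi
    rw [abs_mul]
    exact mul_le_mul (hK _ (hgrid hi)) ((abs_add_le _ _).trans (add_le_add (hC _) (hC _)))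
      (abs_nonneg _) hK0
  have hclim : ∀ t ∈ Ico 0 T, Tendsto (fun n => (2 * lam (grid T n (gridIndex T n t + 1)))⁻¹ *
      (ee (grid T n (gridIndex T n t)) + ee (grid T n (gridIndex T n t + 1)))) atTop
      (𝓝 ((2 * lam t)⁻¹ * (ee t + (ee t + jump g t)))) := fun t ht =>
    (tθ t ht).mul ((tl t ht).add (tr t ht))
  have B := tendsto_sum_grid_signedMeasure hT (stieltjes g)
    (fun n i => (2 * lam (grid T n (i + 1)))⁻¹ * (ee (grid T n i) + ee (grid T n (i + 1))))
    (K * (C + C)) hcb _ hclim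
  have D := tendsto_sum_grid_intervalIntegral hT (fun s => rho s * e s) hint
    (fun n i => (2 * lam (grid T n (i + 1)))⁻¹ * (ee (grid T n i) + ee (grid T n (i + 1))))
    (K * (C + C)) hcb _ (ae_of_all _ hclim)
  -- On a cell, `Δg - ∫ρe = Δe` and `(e_i + e_{i+1}) Δe = e_{i+1}² - e_i²`. With `1/λ` taken at the
  -- right end and `e²` at the left end in the depth term, no error remains and the sum telescopes.
  have htel : ∀ᶠ n : ℕ in atTop,
      ∑ i ∈ Finset.range n, ee (grid T n i) ^ 2 / 2 *
          (∫ s in (grid T n i)..(grid T n (i + 1)), -(depthGrowth lam s / lam s))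
        + ∑ i ∈ Finset.range n, (2 * lam (grid T n (i + 1)))⁻¹ *
          (ee (grid T n i) + ee (grid T n (i + 1))) *
            stieltjes g (Ico (grid T n i) (grid T n (i + 1)))
        - ∑ i ∈ Finset.range n, (2 * lam (grid T n (i + 1)))⁻¹ *
          (ee (grid T n i) + ee (grid T n (i + 1))) *
            (∫ s in (grid T n i)..(grid T n (i + 1)), rho s * e s)
      = e T ^ 2 / (2 * lam T) := by
    filter_upwards [eventually_gt_atTop 0] with n hn
    have hstep : ∀ i ∈ Finset.range n,
        ee (grid T n i) ^ 2 / 2 *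
          (∫ s in (grid T n i)..(grid T n (i + 1)), -(depthGrowth lam s / lam s))
        + (2 * lam (grid T n (i + 1)))⁻¹ *
          (ee (grid T n i) + ee (grid T n (i + 1))) *
            stieltjes g (Ico (grid T n i) (grid T n (i + 1)))
        - (2 * lam (grid T n (i + 1)))⁻¹ *
          (ee (grid T n i) + ee (grid T n (i + 1))) *
            (∫ s in (grid T n i)..(grid T n (i + 1)), rho s * e s)
        = (2 * lam (grid T n (i + 1)))⁻¹ * ee (grid T n (i + 1)) ^ 2
          - (2 * lam (grid T n i))⁻¹ * ee (grid T n i) ^ 2 := by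
      intro i hi
      have hi : i + 1 ≤ n := Finset.mem_range.1 hi
      have hle : grid T n i ≤ grid T n (i + 1) := monotone_grid hT (Nat.le_succ i)
      have h0 := hgrid (i.le_succ.trans hi)
      have h1 := hgrid hi
      have hsplit : (∫ s in (grid T n i)..(grid T n (i + 1)), rho s * e s)
          = (∫ s in (0 : ℝ)..(grid T n (i + 1)), rho s * e s)
            - ∫ s in (0 : ℝ)..(grid T n i), rho s * e s := by
        rw [eq_comm]
        refine intervalIntegral.integral_interval_sub_left ?_ ?_
        · exact (intervalIntegrable_iff_integrableOn_Icc_of_le h1.1).2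
            (hint.mono_set (Icc_subset_Icc_right h1.2))
        · exact (intervalIntegrable_iff_integrableOn_Icc_of_le h0.1).2
            (hint.mono_set (Icc_subset_Icc_right h0.2))
      rw [inv_sub_inv_eq_integral hpos hlam h0.1 hle, stieltjes_Ico hg hl hle, hsplit,
        mul_inv, mul_inv]
      have e0 := he _ h0
      have e1 := he _ h1
      rw [hee _ h0] at e0
      rw [hee _ h1] at e1
      have hd : g (grid T n (i + 1)) - g (grid T n i) = ee (grid T n (i + 1)) - ee (grid T n i)
          + ((∫ s in (0 : ℝ)..(grid T n (i + 1)), rho s * e s)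
            - ∫ s in (0 : ℝ)..(grid T n i), rho s * e s) := by
        rw [e0, e1]; ring
      rw [hd]
      ring
    rw [← Finset.sum_add_distrib, ← Finset.sum_sub_distrib, Finset.sum_congr rfl hstep,
      Finset.sum_range_sub fun i => (2 * lam (grid T n i))⁻¹ * ee (grid T n i) ^ 2]
    rw [grid_self hn.ne', grid_zero, ← hee T hT', ← hee 0 ⟨le_rfl, hT.le⟩,
      he 0 ⟨le_rfl, hT.le⟩]
    simp
    ring
  have hlim := tendsto_nhds_unique (((A.add B).sub D).congr' htel) tendsto_const_nhds
  have hcongr : ((stieltjes g).restrict (Ico 0 T)).integral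
        (fun t => (2 * lam t)⁻¹ * (2 * e t + jump g t)) (ContinuousLinearMap.lsmul ℝ ℝ)
      = ((stieltjes g).restrict (Ico 0 T)).integral
        (fun t => (2 * lam t)⁻¹ * (ee t + (ee t + jump g t)))
          (ContinuousLinearMap.lsmul ℝ ℝ) := by
    refine VectorMeasure.setIntegral_congr_fun fun t ht => ?_
    simp only [hee t (Ico_subset_Icc_self ht)]
    ring
  -- Jumps are invisible to Lebesgue measure, so the resilience term has no jump contribution.
  have hjump0 : ∀ᵐ t, jump g t = 0 := (countable_jump_ne_zero hg hl).ae_notMem volume |>.mono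
    fun t ht => by simpa using ht
  have hD : (∫ s in (0 : ℝ)..T, (2 * lam s)⁻¹ * (ee s + (ee s + jump g s)) * (rho s * e s))
      = ∫ s in (0 : ℝ)..T, (lam s)⁻¹ * rho s * e s ^ 2 := by
    refine intervalIntegral.integral_congr_ae ?_
    filter_upwards [hjump0] with t ht hmem
    rw [uIoc_of_le hT.le] at hmem
    have h := hpos t hmem.1.le
    rw [ht, ← hee t ⟨hmem.1.le, hmem.2⟩]
    field_simp
    ring
  have hA : (∫ s in (0 : ℝ)..T, ee s ^ 2 / 2 * -(depthGrowth lam s / lam s))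
      = ∫ s in (0 : ℝ)..T, e s ^ 2 / 2 * -(depthGrowth lam s / lam s) := by
    refine intervalIntegral.integral_congr fun t ht => ?_
    rw [uIcc_of_le hT.le] at ht
    simp only [hee t ht]
  have hi1 : IntervalIntegrable (fun s => (lam s)⁻¹ * rho s * e s ^ 2) volume 0 T := by
    rw [intervalIntegrable_iff_integrableOn_Icc_of_le hT.le]
    have h1 : IntegrableOn (fun s => ((lam s)⁻¹ * ee s ^ 2) * rho s) (Icc 0 T) := by
      have hli : ContinuousOn (fun s => (lam s)⁻¹) (Icc 0 T) :=
        hlc.inv₀ fun t ht => (hpos t ht.1).ne'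
      obtain ⟨L, hL⟩ := isCompact_Icc.exists_bound_of_continuousOn hli
      refine Integrable.bdd_mul (c := L * C ^ 2) hrint
        ((hli.aestronglyMeasurable measurableSet_Icc).mul
          (hmeas.pow_const 2).aestronglyMeasurable) ?_
      filter_upwards [ae_restrict_mem measurableSet_Icc] with t ht
      rw [norm_mul, norm_pow]
      exact mul_le_mul (hL t ht) (pow_le_pow_left₀ (norm_nonneg _) (hC t) 2) (by positivity)
        ((norm_nonneg _).trans (hL t ht))
    refine h1.congr_fun (fun t ht => ?_) measurableSet_Icc
    simp only [hee t ht]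
    ring
  have hi2 : IntervalIntegrable (fun s => e s ^ 2 / 2 * -(depthGrowth lam s / lam s))
      volume 0 T := by
    rw [intervalIntegrable_iff_integrableOn_Icc_of_le hT.le]
    have h1 : IntegrableOn (fun s => ee s ^ 2 / 2 * -(depthGrowth lam s / lam s)) (Icc 0 T) := by
      refine Integrable.bdd_mul (c := C ^ 2 / 2) hdc.integrableOn_Icc
        ((hmeas.pow_const 2).div_const 2).aestronglyMeasurable (ae_of_all _ fun t => ?_)
      rw [Real.norm_of_nonneg (by positivity)]
      have := sq_le_sq' (abs_le.1 (hC t)).1 (abs_le.1 (hC t)).2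
      linarith
    refine h1.congr_fun (fun t ht => ?_) measurableSet_Icc
    simp only [hee t ht]
  have hfin : (∫ s in (0 : ℝ)..T, runningRate lam rho s * e s ^ 2)
      = (∫ s in (0 : ℝ)..T, (lam s)⁻¹ * rho s * e s ^ 2)
        - ∫ s in (0 : ℝ)..T, e s ^ 2 / 2 * -(depthGrowth lam s / lam s) := by
    rw [← intervalIntegral.integral_sub hi1 hi2]
    refine intervalIntegral.integral_congr fun t ht => ?_
    rw [uIcc_of_le hT.le] at ht
    have := hpos t ht.1
    simp only [runningRate]
    field_simp
    ring
  rw [hA, hD] at hlim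
  rw [hcongr, hfin]
  linarith

/-- The jump costs `Δ²/(2λ)` are absorbed into the Stieltjes integral, since `Δ` is the mass of an
atom. On `[0, T)` summation by parts leaves `e_T²/(2λ_T)`, and the final trade `-g T` completes it
to `(g T - e T)²/(2λ_T)`, where `g T - e T = x + ∫ρe`. -/
theorem cost_eq_add_impactCost (hT : 0 < T) (hpos : ∀ t, 0 ≤ t → 0 < lam t)
    (hlam : ContDiffOn ℝ 2 lam (Ici 0)) (hg : BoundedVariationOn g univ)
    (hl : ∀ t, ContinuousWithinAt g (Iic t) t) (hend : ∀ t, T < t → g t = 0)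
    (hint : IntegrableOn (fun s => rho s * e s) (Icc 0 T))
    (he : ∀ t ∈ Icc 0 T, e t = g t - g 0 - ∫ s in (0 : ℝ)..t, rho s * e s)
    (hrint : IntegrableOn (fun s => rho s) (Icc 0 T))
    (S : ℝ → ℝ) (hS : (stieltjes g).IntegrableOn S (Icc 0 T)) :
    ((stieltjes g).restrict (Icc 0 T)).integral (fun t => S t + e t / lam t)
        (ContinuousLinearMap.lsmul ℝ ℝ)
      + ∑' t : Icc (0 : ℝ) T, (2 * lam t)⁻¹ * jump g t * jump g t
      = ((stieltjes g).restrict (Ico 0 T)).integral S (ContinuousLinearMap.lsmul ℝ ℝ)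
        - S T * g T + impactCost lam rho T (g 0) e := by
  obtain ⟨ee, hee, ⟨C, hC⟩, hleft, hmeas, hright⟩ := exists_extension_volumeImpact hT hg hl hint he
  have hlc : ContinuousOn lam (Icc 0 T) := hlam.continuousOn.mono Icc_subset_Ici_self
  have hθ : ContinuousOn (fun t => (2 * lam t)⁻¹) (Icc 0 T) :=
    (continuousOn_const.mul hlc).inv₀ fun t ht => (mul_pos two_pos (hpos t ht.1)).ne'
  obtain ⟨K, hK⟩ := isCompact_Icc.exists_bound_of_continuousOn hθ
  have hK0 : 0 ≤ K := (norm_nonneg _).trans (hK 0 ⟨le_rfl, hT.le⟩)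
  obtain ⟨Cg, hCg⟩ := exists_abs_le_of_boundedVariationOn hg.rightLim
  obtain ⟨Cg', hCg'⟩ := exists_abs_le_of_boundedVariationOn hg
  have hjb : ∀ t, |jump g t| ≤ Cg + Cg' := fun t =>
    (abs_sub _ _).trans (add_le_add (hCg t) (hCg' t))
  have hfb : ∀ t ∈ Icc 0 T, |(2 * lam t)⁻¹ * jump g t| ≤ K * (Cg + Cg') := fun t ht => by
    rw [abs_mul]
    exact mul_le_mul (hK t ht) (hjb t) (abs_nonneg _) hK0
  have hsum := integral_stieltjes_eq_tsum hg hl measurableSet_Icc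
    (fun t => (2 * lam t)⁻¹ * jump g t) (fun t _ h => by simp [h]) _ hfb
  have hjm : Measurable (jump g) := by
    refine (measurable_const (a := (0 : ℝ))).measurable_of_countable_ne
      ((countable_jump_ne_zero hg hl).mono fun t ht => ?_)
    simpa [eq_comm] using ht
  have hvar : ((stieltjes g).restrict (Icc 0 T)).variation
      = (stieltjes g).variation.restrict (Icc 0 T) :=
    VectorMeasure.variation_restrict measurableSet_Icc
  have hi_jump : (stieltjes g).IntegrableOn (fun t => (2 * lam t)⁻¹ * jump g t) (Icc 0 T) := by
    rw [VectorMeasure.IntegrableOn, VectorMeasure.Integrable, hvar]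
    refine (integrable_const (K * (Cg + Cg'))).mono'
      ((hθ.aestronglyMeasurable measurableSet_Icc).mul hjm.aestronglyMeasurable) ?_
    filter_upwards [ae_restrict_mem measurableSet_Icc] with t ht using hfb t ht
  have hi_e : (stieltjes g).IntegrableOn (fun t => e t / lam t) (Icc 0 T) := by
    rw [VectorMeasure.IntegrableOn, VectorMeasure.Integrable, hvar]
    have h1 : IntegrableOn (fun t => (2 * lam t)⁻¹ * (2 * ee t)) (Icc 0 T)
        (stieltjes g).variation := by
      refine (integrable_const (K * (2 * C))).mono'
        ((hθ.aestronglyMeasurable measurableSet_Icc).mul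
          (hmeas.const_mul 2).aestronglyMeasurable) ?_
      filter_upwards [ae_restrict_mem measurableSet_Icc] with t ht
      rw [norm_mul]
      refine mul_le_mul (hK t ht) ?_ (norm_nonneg _) hK0
      rw [norm_mul, Real.norm_ofNat]
      exact mul_le_mul_of_nonneg_left (hC t) (by norm_num)
    refine h1.congr_fun (fun t ht => ?_) measurableSet_Icc
    have := hpos t ht.1
    simp only [hee t ht]
    field_simp
  have hi_imp : (stieltjes g).IntegrableOn (fun t => e t / lam t + (2 * lam t)⁻¹ * jump g t)
      (Icc 0 T) := hi_e.add hi_jump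
  have hIco : Ico 0 T ∪ {T} = Icc 0 T := Ico_union_right hT.le
  have hdisj : Disjoint (Ico 0 T) {T} := by simp
  rw [← hsum, ← VectorMeasure.integral_fun_add
    (show ((stieltjes g).restrict (Icc 0 T)).Integrable fun t => S t + e t / lam t from
      hS.add hi_e) hi_jump, ← hIco]
  have hsubs : Ico 0 T ⊆ Icc 0 T := Ico_subset_Icc_self
  have hsubT : {T} ⊆ Icc 0 T := by simp [hT.le]
  have hi_all := (hS.add hi_e).add hi_jump
  have hi_all' : (stieltjes g).IntegrableOn
      (fun t => S t + e t / lam t + (2 * lam t)⁻¹ * jump g t) (Icc 0 T) := hi_all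
  rw [VectorMeasure.setIntegral_union hdisj measurableSet_Ico (measurableSet_singleton T)
    (hi_all'.mono measurableSet_Icc hsubs) (hi_all'.mono measurableSet_Icc hsubT),
    VectorMeasure.integral_singleton, stieltjes_singleton hg hl]
  have hcore := integral_stieltjes_Ico_impact hT hpos hlam hg hl hint he hrint
  have hsplit : ((stieltjes g).restrict (Ico 0 T)).integral
        (fun t => S t + e t / lam t + (2 * lam t)⁻¹ * jump g t) (ContinuousLinearMap.lsmul ℝ ℝ)
      = ((stieltjes g).restrict (Ico 0 T)).integral S (ContinuousLinearMap.lsmul ℝ ℝ)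
        + ((stieltjes g).restrict (Ico 0 T)).integral
          (fun t => (2 * lam t)⁻¹ * (2 * e t + jump g t)) (ContinuousLinearMap.lsmul ℝ ℝ) := by
    rw [← VectorMeasure.integral_fun_add (hS.mono measurableSet_Icc hsubs)]
    · refine VectorMeasure.setIntegral_congr_fun fun t ht => ?_
      have := hpos t ht.1
      field_simp
      ring
    · have h2 : (stieltjes g).IntegrableOn (fun t => e t / lam t + (2 * lam t)⁻¹ * jump g t)
          (Ico 0 T) := hi_imp.mono measurableSet_Icc hsubs
      have hvar' : ((stieltjes g).restrict (Ico 0 T)).variation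
        = (stieltjes g).variation.restrict (Ico 0 T) :=
        VectorMeasure.variation_restrict measurableSet_Ico
      rw [VectorMeasure.IntegrableOn, VectorMeasure.Integrable, hvar'] at h2
      rw [VectorMeasure.Integrable, hvar']
      refine IntegrableOn.congr_fun h2 (fun t ht => ?_) measurableSet_Ico
      have := hpos t ht.1
      field_simp
  -- The path vanishes after `T`, so the last trade sells whatever is left.
  have hjT : jump g T = - g T := by
    have h1 : Tendsto g (𝓝[>] T) (𝓝 0) := by
      refine tendsto_const_nhds.congr' ?_
      filter_upwards [self_mem_nhdsWithin] with t ht using (hend t ht).symm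
    have := tendsto_nhds_unique (tendsto_jump hg T) h1
    linarith
  have heT := he T ⟨hT.le, le_rfl⟩
  rw [hsplit, hcore, hjT, impactCost]
  have hlT := hpos T hT.le
  have hx : g 0 + ∫ s in (0 : ℝ)..T, rho s * e s = g T - e T := by linarith
  rw [hx]
  simp only [ContinuousLinearMap.lsmul_apply, smul_eq_mul]
  field_simp
  ring

end Path

end LimitOrderBook

end

noncomputable section

namespace LimitOrderBook

open Filter Topology

/-! ### The unaffected price along a strategy -/

/-- Dyadic grids are nested, so the exceedance events along them increase. -/
lemma grid_double (T : ℝ) (k i : ℕ) : grid T (2 ^ k) i = grid T (2 ^ (k + 1)) (2 * i) := by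
  unfold grid
  push_cast
  rw [pow_succ]
  have : (2 : ℝ) ^ k ≠ 0 := by positivity
  field_simp

lemma tendsto_toNNReal_right (t : ℝ) :
    Tendsto (fun s : ℝ => s.toNNReal) (𝓝[>] t) (𝓝[≥] t.toNNReal) :=
  tendsto_nhdsWithin_iff.2 ⟨(continuous_real_toNNReal.tendsto t).mono_left inf_le_left, by
    filter_upwards [self_mem_nhdsWithin] with s hs using Real.toNNReal_mono (le_of_lt hs)⟩

/-- A right-continuous path is the limit of step functions taking the value at the right end of each
cell, hence measurable for any measure on `[0, T)`; the point `T` is treated as an atom. -/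
lemma integrableOn_stieltjes_price (hT : 0 < T) (μ : SignedMeasure ℝ) {s : ℝ → ℝ}
    (hs : ∀ t, Tendsto s (𝓝[>] t) (𝓝 (s t))) {C : ℝ} (hC : ∀ t ∈ Icc 0 T, |s t| ≤ C) :
    μ.IntegrableOn s (Icc 0 T) := by
  have hvar : (μ.restrict (Icc 0 T)).variation = μ.variation.restrict (Icc 0 T) :=
    VectorMeasure.variation_restrict measurableSet_Icc
  rw [VectorMeasure.IntegrableOn, VectorMeasure.Integrable, hvar]
  refine (integrable_const C).mono' ?_ ?_
  · rw [← Ico_union_right hT.le, aestronglyMeasurable_union_iff]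
    refine ⟨?_, ?_⟩
    · refine aestronglyMeasurable_of_tendsto_ae atTop
        (f := fun n => gridStep T n fun i => s (grid T n (i + 1)))
        (fun n => (measurable_gridStep _).aestronglyMeasurable) ?_
      filter_upwards [ae_restrict_mem measurableSet_Ico] with t ht
      refine ((hs t).comp (tendsto_grid_right hT ht.1)).congr' ?_
      filter_upwards [eventually_gt_atTop 0] with n hn
      rw [gridStep_eq hT hn ht]
      rfl
    · rw [Measure.restrict_singleton]
      exact aestronglyMeasurable_dirac.smul_measure _
  · filter_upwards [ae_restrict_mem measurableSet_Icc] with t ht using hC t ht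

/-! ### Pathwise bounds and conditional expectations -/

section Martingale

variable {Ω : Type*} [mΩ : MeasurableSpace Ω] {P : Measure Ω}
  {ℱ : Filtration ℝ≥0 mΩ} {S : ℝ≥0 → Ω → ℝ} {T : ℝ}

/-- The filtration along a grid. -/
def gridFiltration (ℱ : Filtration ℝ≥0 mΩ) (hT : 0 < T) (n : ℕ) : Filtration ℕ mΩ where
  seq i := ℱ (grid T n i).toNNReal
  mono' _ _ hij := ℱ.mono (Real.toNNReal_mono (monotone_grid hT hij))
  le' _ := ℱ.le _

/-- Doob's maximal inequality for the discrete submartingale `|S|` on the grid. The bound does not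
depend on `n`. -/
lemma measure_le_max_grid [IsProbabilityMeasure P] (hS : Martingale S ℱ P) (hT : 0 < T) (n : ℕ)
    (hn : n ≠ 0) (c : ℝ≥0) :
    c * P {ω | ∃ i ≤ n, (c : ℝ) ≤ |S (grid T n i).toNNReal ω|}
      ≤ ENNReal.ofReal (∫ ω, |S T.toNNReal ω| ∂P) := by
  have hM : Martingale (fun i => S (grid T n i).toNNReal) (gridFiltration ℱ hT n) P :=
    ⟨fun i => hS.stronglyAdapted _, fun i j hij =>
      hS.condExp_ae_eq (Real.toNNReal_mono (monotone_grid hT hij))⟩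
  have hsub : Submartingale (fun i ω => |S (grid T n i).toNNReal ω|)
      (gridFiltration ℱ hT n) P := hM.submartingale.sup hM.neg.submartingale
  have h := maximal_ineq hsub (fun i ω => abs_nonneg _) (ε := c) n
  have hset : {ω | (c : ℝ) ≤ (Finset.range (n + 1)).sup' Finset.nonempty_range_add_one
      fun k => |S (grid T n k).toNNReal ω|}
      = {ω | ∃ i ≤ n, (c : ℝ) ≤ |S (grid T n i).toNNReal ω|} := by
    ext ω
    simp [Finset.le_sup'_iff]
  rw [hset] at h
  refine h.trans (ENNReal.ofReal_le_ofReal ?_)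
  simp only [grid_self hn]
  exact setIntegral_le_integral (hS.integrable _).abs (ae_of_all _ fun ω => abs_nonneg _)

/-- Almost every path of a right-continuous martingale is bounded on `[0, T]`. -/
theorem ae_bounded_of_martingale [IsProbabilityMeasure P] (hS : Martingale S ℱ P)
    (hSr : ∀ ω t, ContinuousWithinAt (fun s => S s ω) (Ici t) t) (hT : 0 < T) :
    ∀ᵐ ω ∂P, ∃ C, ∀ t ∈ Icc 0 T, |S t.toNNReal ω| ≤ C := by
  set A : ℝ≥0 → ℕ → Set Ω := fun c k =>
    {ω | ∃ i ≤ 2 ^ k, (c : ℝ) ≤ |S (grid T (2 ^ k) i).toNNReal ω|} with hA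
  set K := ∫ ω, |S T.toNNReal ω| ∂P
  have hmono : ∀ c, Monotone (A c) := by
    intro c
    refine monotone_nat_of_le_succ fun k ω => ?_
    rintro ⟨i, hi, h⟩
    refine ⟨2 * i, ?_, ?_⟩
    · rw [pow_succ]; omega
    · rwa [← grid_double]
  have hbound : ∀ c : ℝ≥0, c * P (⋃ k, A c k) ≤ ENNReal.ofReal K := by
    intro c
    rw [(hmono c).measure_iUnion, ENNReal.mul_iSup]
    exact iSup_le fun k => measure_le_max_grid hS hT _ (by positivity) c
  -- On this event the path is unbounded on dyadic points. Its probability times any `c` is at most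
  -- `E|S_T|`, so it is null.
  have hnull : P (⋂ c : ℕ, ⋃ k, A (c : ℝ≥0) k) = 0 := by
    by_contra hne
    obtain ⟨c, hc⟩ := ENNReal.exists_nat_mul_gt hne (ENNReal.ofReal_ne_top (r := K))
    have h1 := hbound (c : ℝ≥0)
    have h2 : P (⋂ c : ℕ, ⋃ k, A (c : ℝ≥0) k) ≤ P (⋃ k, A (c : ℝ≥0) k) :=
      measure_mono (iInter_subset _ c)
    have h3 : (c : ENNReal) * P (⋂ c : ℕ, ⋃ k, A (c : ℝ≥0) k) ≤ ENNReal.ofReal K := by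
      refine le_trans ?_ h1
      push_cast
      gcongr
    exact absurd hc (not_lt.2 h3)
  have hae : ∀ᵐ ω ∂P, ω ∉ ⋂ c : ℕ, ⋃ k, A (c : ℝ≥0) k := measure_eq_zero_iff_ae_notMem.1 hnull
  filter_upwards [hae] with ω hω
  simp only [mem_iInter, mem_iUnion, not_forall, not_exists] at hω
  obtain ⟨c, hc⟩ := hω
  have hlt : ∀ k i, i ≤ 2 ^ k → |S (grid T (2 ^ k) i).toNNReal ω| ≤ c := by
    intro k i hi
    by_contra h
    exact hc k ⟨i, hi, by simpa using (not_le.1 h).le⟩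
  refine ⟨c, fun t ht => ?_⟩
  -- Right continuity extends the bound from dyadic points to `t < T`; the end `T` is itself a grid
  -- point.
  rcases ht.2.eq_or_lt with rfl | htT
  · simpa [grid_self] using hlt 0 1 le_rfl
  · have hpow : Tendsto (fun k : ℕ => 2 ^ k) atTop atTop :=
      tendsto_pow_atTop_atTop_of_one_lt (by norm_num)
    have h1 := (tendsto_grid_right hT ht.1).comp hpow
    have h3 := ((hSr ω t.toNNReal).tendsto.comp ((tendsto_toNNReal_right t).comp h1)).abs
    refine le_of_tendsto h3 (Eventually.of_forall fun k => ?_)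
    exact hlt k _ (gridIndex_lt hT (by positivity) ⟨ht.1, htT⟩)

lemma integral_condExp_mul [IsProbabilityMeasure P] {m : MeasurableSpace Ω} (hm : m ≤ mΩ)
    {Z Y : Ω → ℝ} (hZ : Integrable Z P) (hY : StronglyMeasurable[m] Y)
    (hZY : Integrable (fun ω => Z ω * Y ω) P) :
    ∫ ω, (P[Z|m]) ω * Y ω ∂P = ∫ ω, Z ω * Y ω ∂P := by
  have h := condExp_mul_of_stronglyMeasurable_right (μ := P) hY hZY hZ
  rw [← integral_condExp hm (f := fun ω => Z ω * Y ω)]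
  exact integral_congr_ae h.symm

lemma integrable_condExp_mul [IsProbabilityMeasure P] {m : MeasurableSpace Ω}
    {Z Y : Ω → ℝ} (hZ : Integrable Z P) (hY : StronglyMeasurable[m] Y)
    (hZY : Integrable (fun ω => Z ω * Y ω) P) :
    Integrable (fun ω => (P[Z|m]) ω * Y ω) P := by
  have h := condExp_mul_of_stronglyMeasurable_right (μ := P) hY hZY hZ
  exact (integrable_condExp (μ := P) (m := m) (f := Z * Y)).congr h

end Martingale

/-! ### The martingale price integrated along an admissible strategy -/

section Strategy

variable {Ω : Type*} [mΩ : MeasurableSpace Ω] {P : Measure Ω}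
  {ℱ : Filtration ℝ≥0 mΩ} {S : ℝ≥0 → Ω → ℝ} {T x : ℝ} {X : ℝ → Ω → ℝ}

/-- The increment of `X` over the `i`-th cell of the grid. -/
def gridIncrement (T : ℝ) (n : ℕ) (X : ℝ → Ω → ℝ) (i : ℕ) (ω : Ω) : ℝ :=
  X (grid T n (i + 1)) ω - X (grid T n i) ω

lemma IsAdmissible.measurable_filtration (hX : IsAdmissible ℱ P T x X) {t : ℝ} (ht : 0 ≤ t) :
    Measurable[ℱ t.toNNReal] (X t) := by
  have := hX.adapted t.toNNReal
  rwa [Real.coe_toNNReal t ht] at this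

lemma IsAdmissible.measurable (hX : IsAdmissible ℱ P T x X) (t : ℝ) : Measurable (X t) := by
  rcases le_total 0 t with ht | ht
  · exact (hX.measurable_filtration ht).mono (ℱ.le _) le_rfl
  · have : X t = fun _ => x := funext (hX.initial t ht)
    rw [this]
    exact measurable_const

lemma IsAdmissible.stronglyMeasurable_gridIncrement (hX : IsAdmissible ℱ P T x X) (hT : 0 < T)
    (n i : ℕ) : StronglyMeasurable[ℱ (grid T n (i + 1)).toNNReal] (gridIncrement T n X i) := by
  refine Measurable.stronglyMeasurable ?_
  refine Measurable.sub (hX.measurable_filtration (grid_nonneg hT _)) ?_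
  exact (hX.measurable_filtration (grid_nonneg hT _)).mono
    (ℱ.mono (Real.toNNReal_mono (monotone_grid hT i.le_succ))) le_rfl

lemma IsAdmissible.measurable_gridIncrement (hX : IsAdmissible ℱ P T x X)
    (n i : ℕ) : Measurable (gridIncrement T n X i) :=
  (hX.measurable _).sub (hX.measurable _)

lemma IsAdmissible.exists_sum_gridIncrement_le (hX : IsAdmissible ℱ P T x X) (hT : 0 < T) :
    ∃ M : ℝ, 0 ≤ M ∧ (∀ᵐ ω ∂P, ∀ s t, |X s ω - X t ω| ≤ M) ∧
      ∀ᵐ ω ∂P, ∀ n, ∑ i ∈ Finset.range n, |gridIncrement T n X i ω| ≤ M := by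
  obtain ⟨M, hM⟩ := hX.bounded_variation
  refine ⟨M, M.2, ?_, ?_⟩
  · filter_upwards [hM] with ω hω s t
    have h := (eVariationOn.edist_le (fun s => X s ω) (mem_univ s) (mem_univ t)).trans hω
    rw [edist_dist, Real.dist_eq] at h
    exact (ENNReal.ofReal_le_iff_le_toReal ENNReal.coe_ne_top).1 h
  · filter_upwards [hM] with ω hω n
    have h := (eVariationOn.sum_le (f := fun s => X s ω) (s := univ) (n := n)
      (monotone_grid (n := n) hT) (fun _ => mem_univ _)).trans hω
    simp_rw [edist_dist, Real.dist_eq] at h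
    rw [← ENNReal.ofReal_sum_of_nonneg fun _ _ => abs_nonneg _] at h
    exact (ENNReal.ofReal_le_iff_le_toReal ENNReal.coe_ne_top).1 h

lemma IsAdmissible.integrable_mul_gridIncrement (hX : IsAdmissible ℱ P T x X) (hT : 0 < T)
    {Z : Ω → ℝ} (hZ : Integrable Z P) (n i : ℕ) :
    Integrable (fun ω => Z ω * gridIncrement T n X i ω) P := by
  obtain ⟨M, hM0, hM, -⟩ := hX.exists_sum_gridIncrement_le hT
  refine hZ.mul_bdd (c := M) (hX.measurable_gridIncrement n i).aestronglyMeasurable ?_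
  filter_upwards [hM] with ω hω using hω _ _

/-- The Riemann sum `∑ S_{t_{i+1}} (X_{t_{i+1}} - X_{t_i})` along the grid. -/
def priceSum (T : ℝ) (S : ℝ≥0 → Ω → ℝ) (X : ℝ → Ω → ℝ) (n : ℕ) (ω : Ω) : ℝ :=
  ∑ i ∈ Finset.range n, S (grid T n (i + 1)).toNNReal ω * gridIncrement T n X i ω

/-- By the martingale property the sum depends on the price only through `S_T`, and linearly. This
allows `S_T` to be replaced by an approximating variable below. -/
lemma priceSum_ae_eq (hS : Martingale S ℱ P) (hT : 0 < T) (n : ℕ) :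
    priceSum T S X n =ᵐ[P] fun ω => ∑ i ∈ Finset.range n,
      (P[S T.toNNReal|ℱ (grid T n (i + 1)).toNNReal]) ω * gridIncrement T n X i ω := by
  have h : ∀ i, ∀ᵐ ω ∂P, i < n → (P[S T.toNNReal|ℱ (grid T n (i + 1)).toNNReal]) ω
      = S (grid T n (i + 1)).toNNReal ω := by
    intro i
    by_cases hi : i < n
    · filter_upwards [hS.condExp_ae_eq (Real.toNNReal_mono (grid_le hT hi))] with ω hω _ using hω
    · exact ae_of_all _ fun ω h => absurd h hi
  filter_upwards [ae_all_iff.2 h] with ω hω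
  exact Finset.sum_congr rfl fun i hi => by rw [hω i (Finset.mem_range.1 hi)]

lemma IsAdmissible.integrable_priceSum (hX : IsAdmissible ℱ P T x X) (hS : Martingale S ℱ P)
    (hT : 0 < T) (n : ℕ) : Integrable (priceSum T S X n) P :=
  integrable_finsetSum _ fun _ _ => hX.integrable_mul_gridIncrement hT (hS.integrable _) _ _

section

variable [IsProbabilityMeasure P]

/-- The map from `Z` to the sum is bounded in `L¹` with norm at most `M`, uniformly in `n`: the
measurable increments move inside the conditional expectations of `|Z|`, and their absolute values
add up to at most `M`. -/
lemma IsAdmissible.integral_abs_sum_condExp_le (hX : IsAdmissible ℱ P T x X) (hT : 0 < T)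
    {M : ℝ} (hM : ∀ᵐ ω ∂P, ∀ n, ∑ i ∈ Finset.range n, |gridIncrement T n X i ω| ≤ M)
    {Z : Ω → ℝ} (hZ : Integrable Z P) (n : ℕ) :
    ∫ ω, |∑ i ∈ Finset.range n,
      (P[Z|ℱ (grid T n (i + 1)).toNNReal]) ω * gridIncrement T n X i ω| ∂P
      ≤ M * ∫ ω, |Z ω| ∂P := by
  have hi1 : ∀ i, Integrable (fun ω => |Z ω| * |gridIncrement T n X i ω|) P := fun i =>
    (hX.integrable_mul_gridIncrement hT hZ n i).abs.congr (ae_of_all _ fun ω => abs_mul _ _)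
  have hsm : ∀ i, StronglyMeasurable[ℱ (grid T n (i + 1)).toNNReal]
      (fun ω => |gridIncrement T n X i ω|) := fun i => by
    have := (hX.stronglyMeasurable_gridIncrement hT n i).norm
    simpa only [Real.norm_eq_abs] using this
  have hi2 : ∀ i, Integrable (fun ω => (P[fun ω => |Z ω| | ℱ (grid T n (i + 1)).toNNReal]) ω
      * |gridIncrement T n X i ω|) P := fun i =>
    integrable_condExp_mul hZ.abs (hsm i) (hi1 i)
  have hi3 : ∀ i, Integrable (fun ω => (P[Z|ℱ (grid T n (i + 1)).toNNReal]) ω *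
      gridIncrement T n X i ω) P := fun i =>
    integrable_condExp_mul hZ (hX.stronglyMeasurable_gridIncrement hT n i)
      (hX.integrable_mul_gridIncrement hT hZ n i)
  have habs : ∀ i, ∀ᵐ ω ∂P, |(P[Z|ℱ (grid T n (i + 1)).toNNReal]) ω|
      ≤ (P[fun ω => |Z ω| | ℱ (grid T n (i + 1)).toNNReal]) ω := by
    intro i
    have h1 := condExp_mono (μ := P) (m := ℱ (grid T n (i + 1)).toNNReal) hZ hZ.abs
      (ae_of_all _ fun ω => le_abs_self _)
    have h2 := condExp_mono (μ := P) (m := ℱ (grid T n (i + 1)).toNNReal) hZ.neg hZ.abs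
      (ae_of_all _ fun ω => neg_le_abs _)
    have h3 := condExp_neg (μ := P) Z (ℱ (grid T n (i + 1)).toNNReal)
    filter_upwards [h1, h2, h3] with ω h1 h2 h3
    rw [h3, Pi.neg_apply] at h2
    exact abs_le'.2 ⟨h1, h2⟩
  calc ∫ ω, |∑ i ∈ Finset.range n,
      (P[Z|ℱ (grid T n (i + 1)).toNNReal]) ω * gridIncrement T n X i ω| ∂P
      ≤ ∫ ω, ∑ i ∈ Finset.range n, (P[fun ω => |Z ω| | ℱ (grid T n (i + 1)).toNNReal]) ω
          * |gridIncrement T n X i ω| ∂P := by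
        refine integral_mono_ae (integrable_finsetSum _ fun i _ => hi3 i).abs
          (integrable_finsetSum _ fun i _ => hi2 i) ?_
        filter_upwards [ae_all_iff.2 habs] with ω hω
        refine (Finset.abs_sum_le_sum_abs _ _).trans (Finset.sum_le_sum fun i _ => ?_)
        rw [abs_mul]
        exact mul_le_mul_of_nonneg_right (hω i) (abs_nonneg _)
    _ = ∫ ω, ∑ i ∈ Finset.range n, |Z ω| * |gridIncrement T n X i ω| ∂P := by
        rw [integral_finsetSum _ fun i _ => hi2 i, integral_finsetSum _ fun i _ => hi1 i]
        exact Finset.sum_congr rfl fun i _ =>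
          integral_condExp_mul (ℱ.le _) hZ.abs (hsm i) (hi1 i)
    _ ≤ ∫ ω, M * |Z ω| ∂P := by
        refine integral_mono_ae (integrable_finsetSum _ fun i _ => hi1 i) (hZ.abs.const_mul M) ?_
        filter_upwards [hM] with ω hω
        rw [← Finset.mul_sum, mul_comm]
        exact mul_le_mul_of_nonneg_right (hω n) (abs_nonneg _)
    _ = M * ∫ ω, |Z ω| ∂P := integral_const_mul _ _

/-- Each `S_{t_{i+1}}` may be replaced by `S_T` under the expectation because the increment is known
at `t_{i+1}`; the increments then telescope. -/
lemma IsAdmissible.integral_priceSum (hX : IsAdmissible ℱ P T x X) (hS : Martingale S ℱ P)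
    (hT : 0 < T) {n : ℕ} (hn : n ≠ 0) :
    ∫ ω, priceSum T S X n ω ∂P = ∫ ω, S T.toNNReal ω * (X T ω - x) ∂P := by
  rw [integral_congr_ae (priceSum_ae_eq hS hT n), integral_finsetSum]
  · have hZ := hS.integrable T.toNNReal
    have h : ∀ i ∈ Finset.range n,
        ∫ ω, (P[S T.toNNReal|ℱ (grid T n (i + 1)).toNNReal]) ω * gridIncrement T n X i ω ∂P
          = ∫ ω, S T.toNNReal ω * gridIncrement T n X i ω ∂P := fun i _ =>
      integral_condExp_mul (ℱ.le _) hZ (hX.stronglyMeasurable_gridIncrement hT n i)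
        (hX.integrable_mul_gridIncrement hT hZ n i)
    rw [Finset.sum_congr rfl h, ← integral_finsetSum _ fun i _ =>
      hX.integrable_mul_gridIncrement hT hZ n i]
    refine integral_congr_ae (ae_of_all _ fun ω => ?_)
    simp only [gridIncrement]
    rw [← Finset.mul_sum, Finset.sum_range_sub fun i => X (grid T n i) ω, grid_self hn, grid_zero,
      hX.initial 0 le_rfl]
  · intro i _
    exact integrable_condExp_mul (hS.integrable _)
      (hX.stronglyMeasurable_gridIncrement hT n i)
      (hX.integrable_mul_gridIncrement hT (hS.integrable _) n i)

/-- Approximate `S_T` in `L¹` by a simple `Y`, bounded by `K`. The part from `Y` is bounded by `K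
M`, and the part from `S_T - Y` is small in `L¹`, both uniformly in `n`. -/
lemma IsAdmissible.unifIntegrable_priceSum (hX : IsAdmissible ℱ P T x X) (hS : Martingale S ℱ P)
    (hT : 0 < T) : UnifIntegrable (priceSum T S X) 1 P := by
  intro ε hε
  obtain ⟨M, hM0, -, hM⟩ := hX.exists_sum_gridIncrement_le hT
  have hZi := hS.integrable T.toNNReal
  obtain ⟨Y, hYlt, hY⟩ := (memLp_one_iff_integrable.2 hZi).exists_simpleFunc_eLpNorm_sub_lt
    ENNReal.one_ne_top (ε := ENNReal.ofReal (ε / (2 * (M + 1))))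
    (by simp only [ne_eq, ENNReal.ofReal_eq_zero, not_le]; positivity)
  have hYi := memLp_one_iff_integrable.1 hY
  obtain ⟨K, hK⟩ := Y.exists_forall_norm_le
  have hK0 : 0 ≤ K := by
    obtain ⟨ω⟩ : Nonempty Ω := nonempty_of_isProbabilityMeasure P
    exact (norm_nonneg _).trans (hK ω)
  have hW : ∫ ω, |S T.toNNReal ω - Y ω| ∂P ≤ ε / (2 * (M + 1)) := by
    have h1 := hYlt.le
    rw [eLpNorm_one_eq_lintegral_enorm] at h1
    have h2 := integral_norm_eq_lintegral_enorm (μ := P) (hZi.sub hYi).aestronglyMeasurable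
    simp only [Pi.sub_apply, Real.norm_eq_abs] at h2
    rw [h2]
    exact ENNReal.toReal_le_of_le_ofReal (by positivity) h1
  -- Then `K M P(s) ≤ ε/2`, and the error in `L¹` was chosen so that `M` times it is at most `ε/2`.
  -- Adding `1` guards against zero denominators.
  refine ⟨ε / (2 * (K * M + 1)), by positivity, fun n s hs hsδ => ?_⟩
  set B : (Ω → ℝ) → Ω → ℝ := fun Z ω => ∑ i ∈ Finset.range n,
      (P[Z|ℱ (grid T n (i + 1)).toNNReal]) ω * gridIncrement T n X i ω with hB
  have hBi : ∀ {Z}, Integrable Z P → Integrable (B Z) P := fun hZ =>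
    integrable_finsetSum _ fun i _ => integrable_condExp_mul hZ
      (hX.stronglyMeasurable_gridIncrement hT n i) (hX.integrable_mul_gridIncrement hT hZ n i)
  have hsplit : priceSum T S X n =ᵐ[P] fun ω => B Y ω + B (fun ω => S T.toNNReal ω - Y ω) ω := by
    have h1 : ∀ i, ∀ᵐ ω ∂P, (P[fun ω => S T.toNNReal ω - Y ω|ℱ (grid T n (i + 1)).toNNReal]) ω
        = (P[S T.toNNReal|ℱ (grid T n (i + 1)).toNNReal]) ω
          - (P[Y|ℱ (grid T n (i + 1)).toNNReal]) ω := fun i =>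
      condExp_sub hZi hYi _
    filter_upwards [priceSum_ae_eq (X := X) hS hT n, ae_all_iff.2 h1] with ω h2 h3
    rw [h2, hB, ← Finset.sum_add_distrib]
    refine Finset.sum_congr rfl fun i _ => ?_
    rw [h3]
    ring
  have hBY : ∀ᵐ ω ∂P, |B Y ω| ≤ K * M := by
    have h1 : ∀ i, ∀ᵐ ω ∂P, |(P[Y|ℱ (grid T n (i + 1)).toNNReal]) ω| ≤ K := fun i => by
      have := ae_bdd_abs_condExp_of_ae_bdd_abs (μ := P) (m := ℱ (grid T n (i + 1)).toNNReal)
        (R := K) (f := Y) (ae_of_all _ fun ω => hK ω)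
      exact this
    filter_upwards [ae_all_iff.2 h1, hM] with ω h1 h2
    calc |B Y ω| ≤ ∑ i ∈ Finset.range n, K * |gridIncrement T n X i ω| := by
          refine (Finset.abs_sum_le_sum_abs _ _).trans (Finset.sum_le_sum fun i _ => ?_)
          rw [abs_mul]
          exact mul_le_mul_of_nonneg_right (h1 i) (abs_nonneg _)
      _ ≤ K * M := by
          rw [← Finset.mul_sum]
          exact mul_le_mul_of_nonneg_left (h2 n) hK0
  have hBW := hX.integral_abs_sum_condExp_le hT hM (hZi.sub hYi) n
  rw [eLpNorm_one_eq_lintegral_enorm]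
  simp_rw [enorm_indicator_eq_indicator_enorm]
  rw [lintegral_indicator hs]
  have hint : Integrable (priceSum T S X n) P := hX.integrable_priceSum hS hT n
  rw [← ofReal_integral_norm_eq_lintegral_enorm hint.integrableOn]
  refine ENNReal.ofReal_le_ofReal ?_
  have hsreal : P.real s ≤ ε / (2 * (K * M + 1)) :=
    ENNReal.toReal_le_of_le_ofReal (by positivity) hsδ
  calc ∫ ω in s, ‖priceSum T S X n ω‖ ∂P
      ≤ ∫ ω in s, (K * M + |B (fun ω => S T.toNNReal ω - Y ω) ω|) ∂P := by
        refine integral_mono_ae hint.norm.integrableOn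
          ((integrable_const _).add (hBi (hZi.sub hYi)).abs).integrableOn ?_
        filter_upwards [ae_restrict_of_ae hsplit, ae_restrict_of_ae hBY] with ω h1 h2
        rw [h1]
        exact (norm_add_le _ _).trans (add_le_add h2 le_rfl)
    _ = P.real s * (K * M) + ∫ ω in s, |B (fun ω => S T.toNNReal ω - Y ω) ω| ∂P := by
        have hi : IntegrableOn (fun ω => |B (fun ω => S T.toNNReal ω - Y ω) ω|) s P :=
          (hBi (hZi.sub hYi)).abs.integrableOn
        rw [integral_add (integrable_const _) hi]
        simp
    _ ≤ ε / (2 * (K * M + 1)) * (K * M) + M * (ε / (2 * (M + 1))) := by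
        refine add_le_add (mul_le_mul_of_nonneg_right hsreal (by positivity)) ?_
        refine (setIntegral_le_integral (hBi (hZi.sub hYi)).abs
          (ae_of_all _ fun ω => abs_nonneg _)).trans (hBW.trans ?_)
        exact mul_le_mul_of_nonneg_left hW hM0
    _ ≤ ε / 2 + ε / 2 := by
        have hKM : 0 ≤ K * M := by positivity
        refine add_le_add ?_ ?_
        · rw [div_mul_eq_mul_div, div_le_div_iff₀ (by positivity) two_pos]
          nlinarith
        · rw [mul_div_assoc', div_le_div_iff₀ (by positivity) two_pos]
          nlinarith
    _ = ε := by ring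

/-- The expected cost of trading at the unaffected price does not depend on the strategy. -/
theorem IsAdmissible.integral_price (hX : IsAdmissible ℱ P T x X) (hS : Martingale S ℱ P)
    (hSr : ∀ ω t, ContinuousWithinAt (fun s => S s ω) (Ici t) t) (hT : 0 < T) :
    Integrable (fun ω => ((stieltjes fun s => X s ω).restrict (Ico 0 T)).integral
        (fun t => S t.toNNReal ω) (ContinuousLinearMap.lsmul ℝ ℝ) - S T.toNNReal ω * X T ω) P ∧
      ∫ ω, (((stieltjes fun s => X s ω).restrict (Ico 0 T)).integral
        (fun t => S t.toNNReal ω) (ContinuousLinearMap.lsmul ℝ ℝ) - S T.toNNReal ω * X T ω) ∂P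
        = - x * ∫ ω, S T.toNNReal ω ∂P := by
  set I : Ω → ℝ := fun ω => ((stieltjes fun s => X s ω).restrict (Ico 0 T)).integral
        (fun t => S t.toNNReal ω) (ContinuousLinearMap.lsmul ℝ ℝ) with hI
  have hlim : ∀ᵐ ω ∂P, Tendsto (fun n => priceSum T S X n ω) atTop (𝓝 (I ω)) := by
    filter_upwards [ae_bounded_of_martingale hS hSr hT] with ω hω
    obtain ⟨C, hC⟩ := hω
    have h := tendsto_sum_grid_signedMeasure hT (stieltjes fun s => X s ω)
      (fun n i => S (grid T n (i + 1)).toNNReal ω) C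
      (fun n i hi => hC _ ⟨grid_nonneg hT _, grid_le hT hi⟩) (fun t => S t.toNNReal ω)
      (fun t ht => (hSr ω t.toNNReal).tendsto.comp
        ((tendsto_toNNReal_right t).comp (tendsto_grid_right hT ht.1)))
    refine h.congr fun n => ?_
    unfold priceSum gridIncrement
    refine Finset.sum_congr rfl fun i _ => ?_
    rw [stieltjes_Ico (hX.finite_variation ω) (hX.left_continuous ω)
      (monotone_grid hT i.le_succ)]
  have hmeas : ∀ n, AEStronglyMeasurable (priceSum T S X n) P := fun n =>
    (hX.integrable_priceSum hS hT n).aestronglyMeasurable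
  have hui := hX.unifIntegrable_priceSum hS hT
  have hImeas : AEStronglyMeasurable I P := aestronglyMeasurable_of_tendsto_ae atTop hmeas hlim
  obtain ⟨M, hM0, hMX, hM⟩ := hX.exists_sum_gridIncrement_le hT
  have hZi := hS.integrable T.toNNReal
  have hIint : Integrable I P := by
    refine ⟨hImeas, ?_⟩
    -- Fatou's lemma makes the limit integrable; Vitali's theorem then upgrades the convergence to
    -- `L¹`.
    have hF : ∫⁻ ω, ‖I ω‖ₑ ∂P ≤ liminf (fun n => ∫⁻ ω, ‖priceSum T S X n ω‖ₑ ∂P) atTop := by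
      refine le_trans (lintegral_mono_ae ?_) (lintegral_liminf_le' fun n => (hmeas n).enorm)
      filter_upwards [hlim] with ω hω
      exact hω.enorm.liminf_eq.ge
    refine lt_of_le_of_lt (hF.trans (liminf_le_of_le (by isBoundedDefault)
      (a := ENNReal.ofReal (M * ∫ ω, |S T.toNNReal ω| ∂P)) fun b hb => ?_)) ENNReal.ofReal_lt_top
    obtain ⟨n, hn⟩ := hb.exists
    refine hn.trans ?_
    rw [← ofReal_integral_norm_eq_lintegral_enorm (hX.integrable_priceSum hS hT n)]
    refine ENNReal.ofReal_le_ofReal ?_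
    refine le_trans (le_of_eq (integral_congr_ae ?_)) (hX.integral_abs_sum_condExp_le hT hM hZi n)
    filter_upwards [priceSum_ae_eq (X := X) hS hT n] with ω h
    rw [h, Real.norm_eq_abs]
  have hL1 := tendsto_Lp_finite_of_tendsto_ae le_rfl ENNReal.one_ne_top hmeas
    (memLp_one_iff_integrable.2 hIint) hui hlim
  have hint := tendsto_integral_of_L1' I hImeas
    (Eventually.of_forall fun n => hX.integrable_priceSum hS hT n) hL1
  have hval : ∫ ω, I ω ∂P = ∫ ω, S T.toNNReal ω * (X T ω - x) ∂P := by
    refine tendsto_nhds_unique hint (tendsto_const_nhds.congr' ?_)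
    filter_upwards [eventually_ne_atTop 0] with n hn using (hX.integral_priceSum hS hT hn).symm
  have hSX : Integrable (fun ω => S T.toNNReal ω * (X T ω - x)) P := by
    refine hZi.mul_bdd (c := M) ((hX.measurable T).sub_const x).aestronglyMeasurable ?_
    filter_upwards [hMX] with ω hω
    have := hω T 0
    rwa [hX.initial 0 le_rfl] at this
  have hSX' : Integrable (fun ω => S T.toNNReal ω * X T ω) P := by
    refine (hSX.add (hZi.mul_const x)).congr (ae_of_all _ fun ω => ?_)
    simp only [Pi.add_apply]
    ring
  refine ⟨hIint.sub hSX', ?_⟩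
  rw [integral_sub hIint hSX', hval, ← integral_sub hSX hSX', ← integral_const_mul]
  refine integral_congr_ae (ae_of_all _ fun ω => ?_)
  simp only
  ring

end

end Strategy

end LimitOrderBook

end

noncomputable section

namespace LimitOrderBook

open Filter Topology

/-! ### The volume impact of a path -/

/-- The accumulated resilience `∫_0^t ρ`. -/
def cumulativeResilience (rho : ℝ → ℝ) (t : ℝ) : ℝ := ∫ s in (0 : ℝ)..t, rho s

section Resilience

variable {rho : ℝ → ℝ} (hrho : ContinuousOn rho (Ici 0))
include hrho

lemma intervalIntegrable_of_continuousOn_Ici {a b : ℝ} (ha : 0 ≤ a) (hb : 0 ≤ b) :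
    IntervalIntegrable rho volume a b := by
  refine ContinuousOn.intervalIntegrable (hrho.mono fun t ht => ?_)
  exact (le_min ha hb).trans ht.1

lemma hasDerivAt_cumulativeResilience {t : ℝ} (ht : 0 < t) :
    HasDerivAt (cumulativeResilience rho) (rho t) t := by
  have hm : Ioi (0 : ℝ) ∈ 𝓝 t := Ioi_mem_nhds ht
  refine intervalIntegral.integral_hasDerivAt_right
    (intervalIntegrable_of_continuousOn_Ici hrho le_rfl ht.le) ?_
    ((hrho t ht.le).continuousAt (Ici_mem_nhds ht))
  exact ⟨_, hm, (hrho.mono Ioi_subset_Ici_self).aestronglyMeasurable measurableSet_Ioi⟩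

lemma continuousOn_cumulativeResilience : ContinuousOn (cumulativeResilience rho) (Ici 0) := by
  intro t ht
  have hT : (0 : ℝ) ≤ t + 1 := by have : (0 : ℝ) ≤ t := ht; linarith
  have h := intervalIntegral.continuousOn_primitive_interval (f := rho) (μ := volume)
    (a := 0) (b := t + 1) (by
      rw [uIcc_of_le hT]
      exact (hrho.mono Icc_subset_Ici_self).integrableOn_Icc)
  rw [uIcc_of_le hT] at h
  have h2 := h t ⟨ht, by linarith⟩
  refine h2.mono_of_mem_nhdsWithin ?_
  filter_upwards [self_mem_nhdsWithin, mem_nhdsWithin_of_mem_nhds (Iio_mem_nhds (by linarith :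
    t < t + 1))] with s hs1 hs2 using ⟨hs1, le_of_lt hs2⟩

lemma continuousOn_exp_cumulativeResilience :
    ContinuousOn (fun t => Real.exp (cumulativeResilience rho t)) (Ici 0) :=
  (continuousOn_cumulativeResilience hrho).rexp

lemma hasDerivAt_exp_cumulativeResilience {t : ℝ} (ht : 0 < t) :
    HasDerivAt (fun t => Real.exp (cumulativeResilience rho t))
      (rho t * Real.exp (cumulativeResilience rho t)) t := by
  simpa [mul_comm] using (hasDerivAt_cumulativeResilience hrho ht).exp

lemma continuousOn_mul_exp_cumulativeResilience :
    ContinuousOn (fun t => rho t * Real.exp (cumulativeResilience rho t)) (Ici 0) :=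
  hrho.mul (continuousOn_exp_cumulativeResilience hrho)

lemma integral_mul_exp_cumulativeResilience {a b : ℝ} (ha : 0 ≤ a) (hab : a ≤ b) :
    ∫ s in a..b, rho s * Real.exp (cumulativeResilience rho s)
      = Real.exp (cumulativeResilience rho b) - Real.exp (cumulativeResilience rho a) :=
  intervalIntegral.integral_eq_sub_of_hasDerivAt_of_le hab
    ((continuousOn_exp_cumulativeResilience hrho).mono fun _ ht => ha.trans ht.1)
    (fun _ ht => hasDerivAt_exp_cumulativeResilience hrho (ha.trans_lt ht.1))
    (intervalIntegrable_of_continuousOn_Ici (continuousOn_mul_exp_cumulativeResilience hrho) ha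
      (ha.trans hab))

end Resilience

/-- The path `g` liquidates `x` shares over `[0, T]` with volume impact `e`. -/
structure IsImpactPath (rho : ℝ → ℝ) (T x : ℝ) (g e : ℝ → ℝ) : Prop where
  bounded_variation : BoundedVariationOn g univ
  left_continuous : ∀ t, ContinuousWithinAt g (Iic t) t
  initial : g 0 = x
  terminal : ∀ t, T < t → g t = 0
  integrable : IntegrableOn (fun s => rho s * e s) (Icc 0 T)
  dynamics : ∀ t ∈ Icc 0 T, e t = g t - g 0 - ∫ s in (0 : ℝ)..t, rho s * e s

/-! ### Bounds on the impact of a path, by variation of constants -/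

namespace IsImpactPath

variable {rho : ℝ → ℝ} {T x : ℝ} {g e : ℝ → ℝ}

lemma measurable (h : IsImpactPath rho T x g e) : Measurable g :=
  measurable_of_boundedVariationOn h.bounded_variation h.left_continuous

lemma intervalIntegrable_mul (h : IsImpactPath rho T x g e) {k : ℝ → ℝ} {a b : ℝ}
    (hk : IntervalIntegrable k volume a b) :
    IntervalIntegrable (fun s => k s * (g s - x)) volume a b := by
  obtain ⟨C, hC⟩ := exists_abs_le_of_boundedVariationOn h.bounded_variation
  rw [intervalIntegrable_iff] at hk ⊢
  refine hk.mul_bdd (c := C + |x|) (h.measurable.sub_const x).aestronglyMeasurable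
    (ae_of_all _ fun t => ?_)
  exact (abs_sub _ _).trans (add_le_add (hC t) le_rfl)

/-- Variation of constants. -/
theorem exp_mul_integral (h : IsImpactPath rho T x g e) (hT : 0 < T)
    (hrho : ContinuousOn rho (Ici 0)) {t : ℝ} (ht : t ∈ Icc 0 T) :
    Real.exp (cumulativeResilience rho t) * ∫ s in (0 : ℝ)..t, rho s * e s
      = ∫ s in (0 : ℝ)..t, rho s * Real.exp (cumulativeResilience rho s) * (g s - x) := by
  obtain ⟨ee, hee, -, hleft, -, hright⟩ := exists_extension_volumeImpact hT h.bounded_variation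
    h.left_continuous h.integrable h.dynamics
  set p : ℝ → ℝ := fun t => ∫ s in (0 : ℝ)..t, rho s * e s with hp
  have hpc : ContinuousOn p (Icc 0 T) := by
    have := intervalIntegral.continuousOn_primitive_interval (f := fun s => rho s * e s)
      (μ := volume) (a := 0) (b := T) (by rw [uIcc_of_le hT.le]; exact h.integrable)
    rwa [uIcc_of_le hT.le] at this
  have hD := countable_jump_ne_zero h.bounded_variation h.left_continuous
  -- Away from the countably many jumps, `p' = ρe` and `e + p = g - x`. The fundamental theorem of
  -- calculus tolerates a countable exceptional set for a continuous function.
  have hd : ∀ s ∈ Ioo 0 t \ {s | jump g s ≠ 0},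
      HasDerivAt (fun s => Real.exp (cumulativeResilience rho s) * p s)
        (rho s * Real.exp (cumulativeResilience rho s) * (g s - x)) s := by
    rintro s ⟨hs, hjs⟩
    have hj : jump g s = 0 := by simpa using hjs
    have hsT : s ∈ Ioo 0 T := ⟨hs.1, hs.2.trans_le ht.2⟩
    have hnhds : Icc 0 T ∈ 𝓝 s := Icc_mem_nhds hsT.1 hsT.2
    have hcee : ContinuousAt ee s := by
      have h1 := hright s
      rw [hj, add_zero] at h1
      exact continuousAt_iff_continuous_left'_right'.2
        ⟨(hleft s).mono Iio_subset_Iic_self, h1⟩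
    have hce : ContinuousAt e s :=
      hcee.congr (by filter_upwards [hnhds] with r hr using (hee r hr).symm)
    have hpd : HasDerivAt p (rho s * e s) s := by
      refine intervalIntegral.integral_hasDerivAt_right ?_ ?_
        (((hrho s hsT.1.le).continuousAt (Ici_mem_nhds hsT.1)).mul hce)
      · exact (intervalIntegrable_iff_integrableOn_Icc_of_le hsT.1.le).2
          (h.integrable.mono_set (Icc_subset_Icc_right hsT.2.le))
      · exact ⟨_, hnhds, h.integrable.aestronglyMeasurable⟩
    refine ((hasDerivAt_exp_cumulativeResilience hrho hsT.1).mul hpd).congr_deriv ?_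
    have := h.dynamics s (Ioo_subset_Icc_self hsT)
    rw [this, h.initial, hp]
    ring
  have hi := h.intervalIntegrable_mul (intervalIntegrable_of_continuousOn_Ici
    (continuousOn_mul_exp_cumulativeResilience hrho) le_rfl ht.1)
  have := integral_eq_of_hasDerivAt_off_countable_of_le
    (fun s => Real.exp (cumulativeResilience rho s) * p s) _ ht.1 hD
    (((continuousOn_exp_cumulativeResilience hrho).mono Icc_subset_Ici_self).mul
      (hpc.mono (Icc_subset_Icc_right ht.2))) hd hi
  rw [this]
  simp [hp]

/-- An explicit formula for the impact in terms of `g`: it gives uniqueness on `[0, T]`, and also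
measurability and bounds for random strategies. -/
theorem exp_mul_eq (h : IsImpactPath rho T x g e) (hT : 0 < T)
    (hrho : ContinuousOn rho (Ici 0)) {t : ℝ} (ht : t ∈ Icc 0 T) :
    Real.exp (cumulativeResilience rho t) * e t
      = Real.exp (cumulativeResilience rho t) * (g t - x)
        - ∫ s in (0 : ℝ)..t, rho s * Real.exp (cumulativeResilience rho s) * (g s - x) := by
  rw [← h.exp_mul_integral hT hrho ht, h.dynamics t ht, h.initial]
  ring

/-- If `g` is nonincreasing then so is the volume impact, up to the factor `exp ∫ ρ`. -/
theorem antitoneOn_exp_mul (h : IsImpactPath rho T x g e) (hT : 0 < T)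
    (hrho : ContinuousOn rho (Ici 0)) (hpos : ∀ t, 0 ≤ t → 0 < rho t) (hg : Antitone g) :
    AntitoneOn (fun t => Real.exp (cumulativeResilience rho t) * e t) (Icc 0 T) := by
  intro s hs t ht hst
  simp only
  rw [h.exp_mul_eq hT hrho hs, h.exp_mul_eq hT hrho ht]
  have hk := continuousOn_mul_exp_cumulativeResilience hrho
  have hi : ∀ {a b : ℝ}, 0 ≤ a → 0 ≤ b → IntervalIntegrable
      (fun s => rho s * Real.exp (cumulativeResilience rho s) * (g s - x)) volume a b :=
    fun ha hb => h.intervalIntegrable_mul (intervalIntegrable_of_continuousOn_Ici hk ha hb)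
  have hadd := intervalIntegral.integral_add_adjacent_intervals (hi le_rfl hs.1) (hi hs.1 ht.1)
  -- On `[s, t]` the path stays above `g t`, and `∫ ρ exp(∫ρ)` is the difference of exponentials.
  have hlow : (Real.exp (cumulativeResilience rho t) - Real.exp (cumulativeResilience rho s))
      * (g t - x) ≤
      ∫ r in s..t, rho r * Real.exp (cumulativeResilience rho r) * (g r - x) := by
    rw [← integral_mul_exp_cumulativeResilience hrho hs.1 hst,
      ← intervalIntegral.integral_mul_const]
    refine intervalIntegral.integral_mono_on hst
      ((intervalIntegrable_of_continuousOn_Ici hk hs.1 ht.1).mul_const _) (hi hs.1 ht.1)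
      fun r hr => ?_
    have h1 : 0 < rho r := hpos r (hs.1.trans hr.1)
    exact mul_le_mul_of_nonneg_left (sub_le_sub_right (hg hr.2) x) (by positivity)
  have h2 : Real.exp (cumulativeResilience rho s) * (g t - g s) ≤ 0 :=
    mul_nonpos_of_nonneg_of_nonpos (Real.exp_pos _).le (sub_nonpos.2 (hg hst))
  rw [← hadd]
  nlinarith

/-- The final trade is `-g T`, so both sides equal minus the impact just after `T`. -/
lemma add_integral_eq (h : IsImpactPath rho T x g e) (hT : 0 < T) :
    x + ∫ s in (0 : ℝ)..T, rho s * e s = g T - e T := by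
  rw [h.dynamics T ⟨hT.le, le_rfl⟩, h.initial]
  ring

/-- After a nonincreasing liquidation the volume impact is at most `-x exp (-∫ ρ)`. -/
theorem le_exp_mul_add_integral (h : IsImpactPath rho T x g e) (hT : 0 < T)
    (hrho : ContinuousOn rho (Ici 0)) (hpos : ∀ t, 0 ≤ t → 0 < rho t) (hg : Antitone g) :
    x ≤ Real.exp (cumulativeResilience rho T) * (x + ∫ s in (0 : ℝ)..T, rho s * e s) := by
  have hk := continuousOn_mul_exp_cumulativeResilience hrho
  rw [mul_add, h.exp_mul_integral hT hrho ⟨hT.le, le_rfl⟩]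
  -- A nonincreasing path ending at `0` is nonnegative, so replacing `g` by `0` in the
  -- variation-of-constants integral gives the bound.
  have hg0 : ∀ t, 0 ≤ g t := by
    intro t
    have h1 : g (max t T + 1) = 0 := h.terminal _ (by have := le_max_right t T; linarith)
    have h2 := hg (show t ≤ max t T + 1 by have := le_max_left t T; linarith)
    linarith
  have hlow : (Real.exp (cumulativeResilience rho T) - Real.exp (cumulativeResilience rho 0))
      * (-x) ≤
      ∫ r in (0 : ℝ)..T, rho r * Real.exp (cumulativeResilience rho r) * (g r - x) := by
    rw [← integral_mul_exp_cumulativeResilience hrho le_rfl hT.le,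
      ← intervalIntegral.integral_mul_const]
    refine intervalIntegral.integral_mono_on hT.le
      ((intervalIntegrable_of_continuousOn_Ici hk le_rfl hT.le).mul_const _)
      (h.intervalIntegrable_mul (intervalIntegrable_of_continuousOn_Ici hk le_rfl hT.le))
      fun r hr => ?_
    have h1 : 0 < rho r := hpos r hr.1
    have := hg0 r
    exact mul_le_mul_of_nonneg_left (by linarith) (by positivity)
  have h0 : cumulativeResilience rho 0 = 0 := by simp [cumulativeResilience]
  rw [h0, Real.exp_zero] at hlow
  linarith

/-- After a nonincreasing liquidation the volume impact does not exceed that before. -/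
theorem neg_exp_mul_le (h : IsImpactPath rho T x g e) (hT : 0 < T)
    (hrho : ContinuousOn rho (Ici 0)) (hpos : ∀ t, 0 ≤ t → 0 < rho t) (hg : Antitone g)
    {t : ℝ} (ht : t ∈ Icc 0 T) :
    0 ≤ Real.exp (cumulativeResilience rho t) * e t
      + Real.exp (cumulativeResilience rho T) * (x + ∫ s in (0 : ℝ)..T, rho s * e s) := by
  have h1 := h.antitoneOn_exp_mul hT hrho hpos hg ht ⟨hT.le, le_rfl⟩ ht.2
  simp only at h1
  have hg0 : 0 ≤ g T := by
    have h2 := hg (show T ≤ T + 1 by linarith)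
    rwa [h.terminal (T + 1) (by linarith)] at h2
  rw [h.add_integral_eq hT]
  have := mul_nonneg (Real.exp_pos (cumulativeResilience rho T)).le hg0
  linarith

theorem exists_measurable_bounded (h : IsImpactPath rho T x g e) (hT : 0 < T) :
    ∃ ee : ℝ → ℝ, (∀ t ∈ Icc 0 T, e t = ee t) ∧ (∃ C, ∀ t, |ee t| ≤ C) ∧ Measurable ee := by
  obtain ⟨ee, h1, h2, -, h3, -⟩ := exists_extension_volumeImpact hT h.bounded_variation
    h.left_continuous h.integrable h.dynamics
  exact ⟨ee, h1, h2, h3⟩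

/-- The volume impact may be multiplied with any integrable function. -/
theorem integrable_mul (h : IsImpactPath rho T x g e) (hT : 0 < T) {k : ℝ → ℝ}
    (hk : IntegrableOn k (Icc 0 T)) (n : ℕ) :
    IntervalIntegrable (fun s => k s * e s ^ n) volume 0 T := by
  obtain ⟨ee, h1, ⟨C, hC⟩, h3⟩ := h.exists_measurable_bounded hT
  rw [intervalIntegrable_iff_integrableOn_Icc_of_le hT.le]
  have h2 : IntegrableOn (fun s => k s * ee s ^ n) (Icc 0 T) := by
    refine hk.mul_bdd (c := C ^ n) (h3.pow_const n).aestronglyMeasurable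
      (ae_of_all _ fun t => ?_)
    rw [norm_pow]
    exact pow_le_pow_left₀ (norm_nonneg _) (hC t) n
  exact h2.congr_fun (fun t ht => by simp only [h1 t ht]) measurableSet_Icc

end IsImpactPath

/-! ### The expected cost -/

section Expected

variable {Ω : Type*} [mΩ : MeasurableSpace Ω] {P : Measure Ω}
  {ℱ : Filtration ℝ≥0 mΩ} {S : ℝ≥0 → Ω → ℝ} {lam rho : ℝ → ℝ} {T x : ℝ} {X E : ℝ → Ω → ℝ}

lemma IsAdmissible.isImpactPath (hX : IsAdmissible ℱ P T x X) (hE : IsVolumeImpact rho T X E)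
    (ω : Ω) : IsImpactPath rho T x (fun t => X t ω) (fun t => E t ω) where
  bounded_variation := hX.finite_variation ω
  left_continuous := hX.left_continuous ω
  initial := hX.initial 0 le_rfl ω
  terminal t ht := hX.terminal t ht ω
  integrable := hE.integrable ω
  dynamics := hE.dynamics ω

/-- A process with left-continuous paths is jointly measurable. -/
lemma measurable_uncurry_of_left_continuous (hm : ∀ t, Measurable (X t))
    (hl : ∀ ω t, ContinuousWithinAt (fun s => X s ω) (Iic t) t) :
    Measurable (Function.uncurry X) := by
  -- A point of the mesh `ℤ/n` in `[t - 1/n, t)`. It depends on `t` through an integer only, which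
  -- makes the approximation jointly measurable; left continuity gives the limit.
  set a : ℕ → ℝ → ℝ := fun n t => ((⌈(n : ℝ) * t⌉ : ℝ) - 1) / n with ha
  have hmeas : ∀ n, Measurable fun p : ℝ × Ω => X (a n p.1) p.2 := by
    intro n
    have h1 : Measurable fun q : ℤ × Ω => X (((q.1 : ℝ) - 1) / n) q.2 :=
      measurable_from_prod_countable_right fun k => by simpa using hm _
    have h2 : Measurable fun p : ℝ × Ω => ((⌈(n : ℝ) * p.1⌉, p.2) : ℤ × Ω) :=
      (Int.measurable_ceil.comp (measurable_fst.const_mul (n : ℝ))).prodMk measurable_snd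
    exact h1.comp h2
  refine measurable_of_tendsto_metrizable hmeas (tendsto_pi_nhds.2 fun p => ?_)
  have hlow : Tendsto (fun n : ℕ => p.1 - 1 / n) atTop (𝓝 (p.1 - 0)) :=
    tendsto_const_nhds.sub (tendsto_const_div_atTop_nhds_zero_nat 1)
  rw [sub_zero] at hlow
  have hle : ∀ᶠ n : ℕ in atTop, a n p.1 ≤ p.1 := by
    filter_upwards [eventually_gt_atTop 0] with n hn
    have hn' : (0 : ℝ) < n := by exact_mod_cast hn
    simp only [ha]
    rw [div_le_iff₀ hn']
    have := Int.ceil_lt_add_one ((n : ℝ) * p.1)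
    linarith
  have hta : Tendsto (fun n => a n p.1) atTop (𝓝[≤] p.1) := by
    refine tendsto_nhdsWithin_iff.2 ⟨?_, hle⟩
    refine tendsto_of_tendsto_of_tendsto_of_le_of_le' hlow tendsto_const_nhds ?_ hle
    filter_upwards [eventually_gt_atTop 0] with n hn
    have hn' : (0 : ℝ) < n := by exact_mod_cast hn
    simp only [ha]
    rw [sub_div, sub_le_sub_iff_right, le_div_iff₀ hn', mul_comm]
    exact Int.le_ceil _
  exact (hl p.2 p.1).tendsto.comp hta

/-- `IsVolumeImpact` demands no measurability in `ω`. Variation of constants expresses `E` through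
the jointly measurable `X` and gives `|E| ≤ 2M` almost surely, so the cost is measurable and
essentially bounded. -/
theorem IsAdmissible.integrable_impactCost [IsProbabilityMeasure P]
    (hX : IsAdmissible ℱ P T x X) (hE : IsVolumeImpact rho T X E) (hT : 0 < T)
    (hpos : ∀ t, 0 ≤ t → 0 < lam t) (hlam : ContDiffOn ℝ 2 lam (Ici 0))
    (hrho : ContinuousOn rho (Ici 0)) (hrho_pos : ∀ t, 0 ≤ t → 0 < rho t) :
    Integrable (fun ω => impactCost lam rho T x fun t => E t ω) P := by
  obtain ⟨M, hM0, hM, -⟩ := hX.exists_sum_gridIncrement_le hT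
  have hXm : Measurable (Function.uncurry X) :=
    measurable_uncurry_of_left_continuous hX.measurable hX.left_continuous
  have hext : ∀ {f : ℝ → ℝ}, ContinuousOn f (Ici 0) → Continuous fun t => f (max t 0) := fun hf =>
    hf.comp_continuous (continuous_id.max continuous_const) fun t => le_max_right t 0
  have hk := continuousOn_mul_exp_cumulativeResilience hrho
  have ha : ContinuousOn (runningRate lam rho) (Ici 0) :=
    ((continuousOn_const.mul hrho).add (continuousOn_depthGrowth hpos hlam)).div
      (continuousOn_const.mul hlam.continuousOn) fun t ht => (mul_pos two_pos (hpos t ht)).ne'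
  -- Data given on `[0, ∞)` are extended by `max t 0` to be continuous on the whole line.
  set k : ℝ → ℝ := fun t => rho (max t 0) * Real.exp (cumulativeResilience rho (max t 0)) with hkdef
  have hkc : Continuous k := hext hk
  have hki : ∀ (ω : Ω) (a b : ℝ), IntervalIntegrable (fun s => k s * (X s ω - x)) volume a b :=
    fun ω a b => (hX.isImpactPath hE ω).intervalIntegrable_mul (hkc.intervalIntegrable a b)
  have hW : Measurable (Function.uncurry fun (t : ℝ) (ω : Ω) =>
      ∫ s in (0 : ℝ)..t, k s * (X s ω - x)) := by
    refine measurable_uncurry_of_continuous_of_measurable (fun ω => ?_) fun t => ?_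
    · exact intervalIntegral.continuous_primitive (hki ω) 0
    · have hm : StronglyMeasurable fun p : Ω × ℝ => k p.2 * (X p.2 p.1 - x) :=
        ((hkc.measurable.comp measurable_snd).mul
          ((hXm.comp measurable_swap).sub_const x)).stronglyMeasurable
      simp only [intervalIntegral]
      exact (hm.integral_prod_right' (ν := volume.restrict (Ioc 0 t))).measurable.sub
        (hm.integral_prod_right' (ν := volume.restrict (Ioc t 0))).measurable
  set F : ℝ → Ω → ℝ := fun t ω => (X t ω - x)
    - (Real.exp (cumulativeResilience rho (max t 0)))⁻¹
      * ∫ s in (0 : ℝ)..t, k s * (X s ω - x) with hF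
  have hFm : Measurable (Function.uncurry F) :=
    (hXm.sub_const x).sub ((((hext (continuousOn_exp_cumulativeResilience hrho)).measurable.comp
      measurable_fst).inv).mul hW)
  have hEF : ∀ t ∈ Icc 0 T, ∀ ω, E t ω = F t ω := by
    intro t ht ω
    have h := (hX.isImpactPath hE ω).exp_mul_eq hT hrho ht
    have hc : (∫ s in (0 : ℝ)..t, rho s * Real.exp (cumulativeResilience rho s) * (X s ω - x))
        = ∫ s in (0 : ℝ)..t, k s * (X s ω - x) := by
      refine intervalIntegral.integral_congr fun s hs => ?_
      rw [uIcc_of_le ht.1] at hs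
      simp only [hkdef, max_eq_left hs.1]
    rw [hc] at h
    have h0 := Real.exp_pos (cumulativeResilience rho t)
    simp only [hF, max_eq_left ht.1]
    field_simp
    linarith
  have hmeas : ∀ {c : ℝ → ℝ}, ContinuousOn c (Ici 0) → ∀ n : ℕ,
      Measurable fun ω => ∫ s in (0 : ℝ)..T, c s * E s ω ^ n := by
    intro c hc n
    have hm : StronglyMeasurable fun p : Ω × ℝ => c (max p.2 0) * F p.2 p.1 ^ n :=
      (((hext hc).measurable.comp measurable_snd).mul
        ((hFm.comp measurable_swap).pow_const n)).stronglyMeasurable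
    have h1 := (hm.integral_prod_right' (ν := volume.restrict (Ioc 0 T))).measurable
    convert h1 using 2 with ω
    rw [intervalIntegral.integral_of_le hT.le]
    refine setIntegral_congr_fun measurableSet_Ioc fun s hs => ?_
    simp only [max_eq_left hs.1.le, hEF s ⟨hs.1.le, hs.2⟩ ω]
  have hbound : ∀ᵐ ω ∂P, ∀ t ∈ Icc 0 T, |E t ω| ≤ M + M := by
    filter_upwards [hM] with ω hω t ht
    have hp := hX.isImpactPath hE ω
    have hXx : ∀ s, |X s ω - x| ≤ M := fun s => by
      have := hω s 0
      rwa [hX.initial 0 le_rfl] at this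
    have h := hp.exp_mul_eq hT hrho ht
    set R := Real.exp (cumulativeResilience rho t)
    have hR : 0 < R := Real.exp_pos _
    have hint : |∫ s in (0 : ℝ)..t, rho s * Real.exp (cumulativeResilience rho s) * (X s ω - x)|
        ≤ R * M := by
      have h1 : |∫ s in (0 : ℝ)..t, rho s * Real.exp (cumulativeResilience rho s) * (X s ω - x)|
          ≤ ∫ s in (0 : ℝ)..t, rho s * Real.exp (cumulativeResilience rho s) * M := by
        refine (intervalIntegral.abs_integral_le_integral_abs ht.1).trans
          (intervalIntegral.integral_mono_on ht.1 ?_ ?_ fun s hs => ?_)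
        · exact (hp.intervalIntegrable_mul
            (intervalIntegrable_of_continuousOn_Ici hk le_rfl ht.1)).abs
        · exact (intervalIntegrable_of_continuousOn_Ici hk le_rfl ht.1).mul_const M
        · have := hrho_pos s hs.1
          rw [abs_mul, abs_of_pos (by positivity)]
          exact mul_le_mul_of_nonneg_left (hXx s) (by positivity)
      rw [intervalIntegral.integral_mul_const,
        integral_mul_exp_cumulativeResilience hrho le_rfl ht.1] at h1
      refine h1.trans (mul_le_mul_of_nonneg_right ?_ hM0)
      have := Real.exp_pos (cumulativeResilience rho 0)
      simp only [R]
      linarith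
    have h2 : R * |E t ω| ≤ R * (M + M) := by
      rw [← abs_of_pos hR, ← abs_mul, abs_of_pos hR, h]
      refine (abs_sub _ _).trans ?_
      rw [mul_add]
      refine add_le_add ?_ hint
      rw [abs_mul, abs_of_pos hR]
      exact mul_le_mul_of_nonneg_left (hXx t) hR.le
    exact le_of_mul_le_mul_left h2 hR
  have hint : ∀ {c : ℝ → ℝ}, ContinuousOn c (Ici 0) → ∀ n : ℕ, ∃ B, ∀ᵐ ω ∂P,
      |∫ s in (0 : ℝ)..T, c s * E s ω ^ n| ≤ B := by
    intro c hc n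
    obtain ⟨C, hC⟩ := isCompact_Icc.exists_bound_of_continuousOn
      (hc.mono (fun t (ht : t ∈ Icc 0 T) => ht.1))
    refine ⟨C * (M + M) ^ n * |T - 0|, ?_⟩
    filter_upwards [hbound] with ω hω
    rw [← Real.norm_eq_abs]
    refine intervalIntegral.norm_integral_le_of_norm_le_const fun s hs => ?_
    rw [uIoc_of_le hT.le] at hs
    have hs' : s ∈ Icc 0 T := Ioc_subset_Icc_self hs
    rw [norm_mul, norm_pow]
    exact mul_le_mul (hC s hs') (pow_le_pow_left₀ (norm_nonneg _) (hω s hs') n) (by positivity)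
      ((norm_nonneg _).trans (hC s hs'))
  obtain ⟨B₁, hB₁⟩ := hint hrho 1
  obtain ⟨B₂, hB₂⟩ := hint ha 2
  have hm1 := hmeas hrho 1
  have hm2 := hmeas ha 2
  simp only [pow_one] at hm1 hB₁
  have hlT := hpos T hT.le
  refine (integrable_const ((|x| + B₁) ^ 2 / (2 * lam T) + B₂)).mono'
    (((((hm1.const_add x).pow_const 2).div_const (2 * lam T)).add hm2).aestronglyMeasurable) ?_
  filter_upwards [hB₁, hB₂] with ω h1 h2
  refine (norm_add_le _ _).trans (add_le_add ?_ h2)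
  rw [norm_div, norm_pow, Real.norm_eq_abs, Real.norm_eq_abs, abs_of_pos (by positivity :
    0 < 2 * lam T)]
  gcongr
  exact (abs_add_le _ _).trans (add_le_add le_rfl h1)

/-- The pathwise identity needs `S` integrable against `dX`, which holds almost surely because the
paths of `S` are bounded on `[0, T]`. Both summands are integrable, so no Bochner integral takes its
default value. -/
theorem IsAdmissible.expectedCost_eq [IsProbabilityMeasure P]
    (hX : IsAdmissible ℱ P T x X) (hE : IsVolumeImpact rho T X E) (hS : Martingale S ℱ P)
    (hSr : ∀ ω t, ContinuousWithinAt (fun s => S s ω) (Ici t) t) (hT : 0 < T)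
    (hpos : ∀ t, 0 ≤ t → 0 < lam t) (hlam : ContDiffOn ℝ 2 lam (Ici 0))
    (hrho : ContinuousOn rho (Ici 0)) (hrho_pos : ∀ t, 0 ≤ t → 0 < rho t) :
    expectedCost P S blockShape lam T X E
      = - x * ∫ ω, S T.toNNReal ω ∂P + ∫ ω, impactCost lam rho T x (fun t => E t ω) ∂P := by
  have hp := hX.integral_price hS hSr hT
  rw [← hp.2, ← integral_add hp.1
    (hX.integrable_impactCost hE hT hpos hlam hrho hrho_pos), expectedCost]
  refine integral_congr_ae ?_
  filter_upwards [ae_bounded_of_martingale hS hSr hT] with ω hω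
  obtain ⟨C, hC⟩ := hω
  have hpath := hX.isImpactPath hE ω
  have hSt : ∀ t : ℝ, Tendsto (fun s : ℝ => S s.toNNReal ω) (𝓝[>] t) (𝓝 (S t.toNNReal ω)) :=
    fun t => (hSr ω t.toNNReal).tendsto.comp (tendsto_toNNReal_right t)
  have h := cost_eq_add_impactCost hT hpos hlam hpath.bounded_variation hpath.left_continuous
    hpath.terminal hpath.integrable hpath.dynamics
    (hrho.mono Icc_subset_Ici_self).integrableOn_Icc (fun t => S t.toNNReal ω)
    (integrableOn_stieltjes_price hT _ hSt hC)
  rw [pathCost_blockShape S X E ω hpos, h, hX.initial 0 le_rfl]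

end Expected

end LimitOrderBook

end

noncomputable section

namespace LimitOrderBook

open Filter Topology

/-! ### Functions of bounded variation -/

lemma BoundedVariationOn.add {f g : ℝ → ℝ} {s : Set ℝ} (hf : BoundedVariationOn f s)
    (hg : BoundedVariationOn g s) : BoundedVariationOn (fun t => f t + g t) s := by
  refine ne_top_of_le_ne_top (ENNReal.add_ne_top.2 ⟨hf, hg⟩) (iSup_le ?_)
  rintro ⟨n, u, hu, us⟩
  calc ∑ i ∈ Finset.range n, edist (f (u (i + 1)) + g (u (i + 1))) (f (u i) + g (u i))
      ≤ ∑ i ∈ Finset.range n, (edist (f (u (i + 1))) (f (u i))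
          + edist (g (u (i + 1))) (g (u i))) :=
        Finset.sum_le_sum fun i _ => edist_add_add_le _ _ _ _
    _ ≤ eVariationOn f s + eVariationOn g s := by
        rw [Finset.sum_add_distrib]
        exact add_le_add (eVariationOn.sum_le hu us) (eVariationOn.sum_le hu us)

lemma boundedVariationOn_const (c : ℝ) (s : Set ℝ) : BoundedVariationOn (fun _ : ℝ => c) s := by
  rw [BoundedVariationOn, eVariationOn.constant_on]
  · exact ENNReal.zero_ne_top
  · rintro _ ⟨_, _, rfl⟩ _ ⟨_, _, rfl⟩
    rfl

lemma boundedVariationOn_indicator_Ioi (a c : ℝ) :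
    BoundedVariationOn ((Ioi a).indicator fun _ => c) univ := by
  have h1 : BoundedVariationOn ((Ioi a).indicator fun _ => (1 : ℝ)) univ := by
    refine MonotoneOn.boundedVariationOn (C := 1) (fun s _ t _ hst => ?_) fun t _ => ?_
    · by_cases hs : a < s
      · simp [hs, hs.trans_le hst]
      · rw [indicator_of_notMem (by simpa using hs)]
        exact indicator_nonneg (fun _ _ => zero_le_one) t
    · by_cases ht : a < t <;> simp [ht]
  have hlip : LipschitzWith ‖c‖₊ fun t : ℝ => c * t := lipschitzWith_smul c
  have h2 := hlip.comp_boundedVariationOn h1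
  convert h2 using 1
  funext t
  by_cases ht : a < t <;> simp [ht]

/-- Write the function as the extension of `h` constant outside `[a, b]`, shifted by `-h a`, plus a
jump of `h a` at `a` and one of `-h b` at `b`. -/
lemma boundedVariationOn_indicator_Ioc {a b : ℝ} (hab : a ≤ b) {h : ℝ → ℝ}
    (hh : BoundedVariationOn h (Icc a b)) : BoundedVariationOn ((Ioc a b).indicator h) univ := by
  have hH : BoundedVariationOn (fun t => h (projIcc a b hab t)) univ := by
    refine ne_top_of_le_ne_top hh (eVariationOn.comp_le_of_monotoneOn h
      (fun t => (projIcc a b hab t : ℝ)) (fun s _ t _ hst => ?_) fun t _ => ?_)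
    · exact monotone_projIcc hab hst
    · exact (projIcc a b hab t).2
  have h1 := BoundedVariationOn.add (BoundedVariationOn.add (BoundedVariationOn.add hH
    (boundedVariationOn_const (-h a) univ))
    (boundedVariationOn_indicator_Ioi a (h a))) (boundedVariationOn_indicator_Ioi b (-h b))
  convert h1 using 1
  funext t
  rcases le_or_gt t a with hta | hta
  · simp [projIcc_of_le_left hab hta, not_lt.2 hta, not_lt.2 (hta.trans hab)]
  · rcases le_or_gt t b with htb | htb
    · simp [projIcc_of_mem hab ⟨hta.le, htb⟩, hta, htb, not_lt.2 htb]
    · simp [projIcc_of_right_le hab htb.le, hta, htb, not_le.2 htb]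

lemma boundedVariationOn_Icc_of_contDiffOn {h : ℝ → ℝ} {a b : ℝ}
    (hh : ContDiffOn ℝ 1 h (Icc a b)) : BoundedVariationOn h (Icc a b) := by
  rcases le_or_gt b a with hab | hab
  · exact BoundedVariationOn.of_subsingleton (subsingleton_Icc_of_ge hab)
  obtain ⟨C, hC⟩ := isCompact_Icc.exists_bound_of_continuousOn
    (hh.continuousOn_derivWithin (uniqueDiffOn_Icc hab) le_rfl)
  have hlip := (convex_Icc a b).lipschitzOnWith_of_nnnorm_derivWithin_le (C := C.toNNReal)
    (hh.differentiableOn one_ne_zero) fun x hx => by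
      rw [← NNReal.coe_le_coe, coe_nnnorm]
      exact (hC x hx).trans (Real.le_coe_toNNReal C)
  have := hlip.locallyBoundedVariationOn a b ⟨le_rfl, hab.le⟩ ⟨hab.le, le_rfl⟩
  rwa [inter_self] at this

/-! ### Deterministic strategies -/

/-- The path that liquidates `x` shares over `[0, T]` and has volume impact `e` on `(0, T]`. -/
def impactPath (rho : ℝ → ℝ) (T x : ℝ) (e : ℝ → ℝ) (t : ℝ) : ℝ :=
  if t ≤ 0 then x else if t ≤ T then x + e t + ∫ s in (0 : ℝ)..t, rho s * e s else 0

section Deterministic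

variable {rho : ℝ → ℝ} {T x : ℝ} {e : ℝ → ℝ}

lemma impactPath_of_nonpos {t : ℝ} (ht : t ≤ 0) : impactPath rho T x e t = x := if_pos ht

lemma impactPath_of_mem {t : ℝ} (ht : t ∈ Ioc 0 T) :
    impactPath rho T x e t = x + e t + ∫ s in (0 : ℝ)..t, rho s * e s := by
  rw [impactPath, if_neg (not_le.2 ht.1), if_pos ht.2]

lemma impactPath_of_lt (hT : 0 < T) {t : ℝ} (ht : T < t) : impactPath rho T x e t = 0 := by
  rw [impactPath, if_neg (not_le.2 (hT.trans ht)), if_neg (not_le.2 ht)]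

lemma impactPath_mul (c : ℝ) (t : ℝ) :
    impactPath rho T (c * x) (fun s => c * e s) t = c * impactPath rho T x e t := by
  have : (∫ s in (0 : ℝ)..t, rho s * (c * e s)) = c * ∫ s in (0 : ℝ)..t, rho s * e s := by
    rw [← intervalIntegral.integral_const_mul]
    congr 1
    funext s
    ring
  unfold impactPath
  rw [this]
  split_ifs <;> ring

/-- Three sources of monotonicity: the initial trade is `e 0`, the last trade is minus the value at
`T`, and in between the path is the given function. -/
lemma antitone_impactPath (hT : 0 < T) (h0 : e 0 ≤ 0)
    (hTe : 0 ≤ x + e T + ∫ s in (0 : ℝ)..T, rho s * e s)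
    (ha : AntitoneOn (fun t => x + e t + ∫ s in (0 : ℝ)..t, rho s * e s) (Icc 0 T)) :
    Antitone (impactPath rho T x e) := by
  have hle : ∀ t ∈ Icc 0 T, x + e t + (∫ s in (0 : ℝ)..t, rho s * e s) ≤ x := fun t ht => by
    have := ha ⟨le_rfl, hT.le⟩ ht ht.1
    simp only [intervalIntegral.integral_same] at this
    linarith
  have hge : ∀ t ∈ Icc 0 T, 0 ≤ x + e t + (∫ s in (0 : ℝ)..t, rho s * e s) := fun t ht =>
    hTe.trans (ha ht ⟨hT.le, le_rfl⟩ ht.2)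
  intro s t hst
  have hx : 0 ≤ x := (hge T ⟨hT.le, le_rfl⟩).trans (hle T ⟨hT.le, le_rfl⟩)
  rcases le_or_gt s 0 with hs0 | hs0
  · rw [impactPath_of_nonpos hs0]
    rcases le_or_gt t 0 with ht0 | ht0
    · rw [impactPath_of_nonpos ht0]
    · rcases le_or_gt t T with htT | htT
      · rw [impactPath_of_mem ⟨ht0, htT⟩]
        exact hle t ⟨ht0.le, htT⟩
      · rwa [impactPath_of_lt hT htT]
  · rcases le_or_gt t T with htT | htT
    · rw [impactPath_of_mem ⟨hs0, hst.trans htT⟩, impactPath_of_mem ⟨hs0.trans_le hst, htT⟩]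
      exact ha ⟨hs0.le, hst.trans htT⟩ ⟨(hs0.trans_le hst).le, htT⟩ hst
    · rw [impactPath_of_lt hT htT]
      rcases le_or_gt s T with hsT | hsT
      · rw [impactPath_of_mem ⟨hs0, hsT⟩]
        exact hge s ⟨hs0.le, hsT⟩
      · rw [impactPath_of_lt hT hsT]

/-- Any left-continuous `e` of bounded variation is realized as an impact on `(0, T]`. At `0` it is
reset to `0`, which a block trade at time `0` makes possible; the integrals do not see this point.
-/
theorem isImpactPath_impactPath (hT : 0 < T) (hrho : ContinuousOn rho (Ici 0))
    (he : BoundedVariationOn e univ) (hl : ∀ t, ContinuousWithinAt e (Iic t) t) (x : ℝ) :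
    IsImpactPath rho T x (impactPath rho T x e) (fun t => if t ≤ 0 then 0 else e t) := by
  have hem : Measurable e := measurable_of_boundedVariationOn he hl
  obtain ⟨C, hC⟩ := exists_abs_le_of_boundedVariationOn he
  have hrhoc : ContinuousOn rho (Icc 0 T) := hrho.mono Icc_subset_Ici_self
  have hint : IntegrableOn (fun s => rho s * e s) (Icc 0 T) :=
    hrhoc.integrableOn_Icc.mul_bdd (c := C) hem.aestronglyMeasurable (ae_of_all _ hC)
  set p : ℝ → ℝ := fun t => ∫ s in (0 : ℝ)..t, rho s * e s with hp
  have hii : ∀ {a b : ℝ}, a ∈ Icc 0 T → b ∈ Icc 0 T →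
      IntervalIntegrable (fun s => rho s * e s) volume a b := fun ha hb => by
    refine intervalIntegrable_iff.2 (hint.mono_set fun s hs => ?_)
    exact ⟨(le_min ha.1 hb.1).trans hs.1.le, hs.2.trans (max_le ha.2 hb.2)⟩
  have hpc : ContinuousOn p (Icc 0 T) := by
    have := intervalIntegral.continuousOn_primitive_interval (f := fun s => rho s * e s)
      (μ := volume) (a := 0) (b := T) (by rwa [uIcc_of_le hT.le])
    rwa [uIcc_of_le hT.le] at this
  have hT0 : (0 : ℝ) ∈ Icc 0 T := ⟨le_rfl, hT.le⟩
  have hpbv : BoundedVariationOn p (Icc 0 T) := by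
    obtain ⟨K, hK⟩ := isCompact_Icc.exists_bound_of_continuousOn hrhoc
    have hlip : LipschitzOnWith (K * C).toNNReal p (Icc 0 T) := by
      refine LipschitzOnWith.of_dist_le_mul fun a ha b hb => ?_
      rw [Real.dist_eq, Real.dist_eq, hp]
      simp only
      rw [intervalIntegral.integral_interval_sub_left (hii hT0 ha) (hii hT0 hb),
        ← Real.norm_eq_abs]
      refine (intervalIntegral.norm_integral_le_of_norm_le_const (C := K * C)
        fun s hs => ?_).trans (mul_le_mul_of_nonneg_right (Real.le_coe_toNNReal _)
          (abs_nonneg _))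
      have hs' : s ∈ Icc 0 T :=
        ⟨(le_min hb.1 ha.1).trans hs.1.le, hs.2.trans (max_le hb.2 ha.2)⟩
      rw [norm_mul]
      exact mul_le_mul (hK s hs') (hC s) (norm_nonneg _) ((norm_nonneg _).trans (hK s hs'))
    have := hlip.locallyBoundedVariationOn 0 T hT0 ⟨hT.le, le_rfl⟩
    rwa [inter_self] at this
  have hprim : ∀ t, 0 ≤ t → (∫ s in (0 : ℝ)..t, rho s * if s ≤ 0 then 0 else e s) = p t := by
    intro t ht
    rw [intervalIntegral.integral_of_le ht, hp]
    simp only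
    rw [intervalIntegral.integral_of_le ht]
    exact setIntegral_congr_fun measurableSet_Ioc fun s hs => by simp [not_le.2 hs.1]
  refine ⟨?_, fun t => ?_, by simp [impactPath], fun t ht => ?_, ?_, fun t ht => ?_⟩
  · have h1 := BoundedVariationOn.add (BoundedVariationOn.add (boundedVariationOn_const x univ)
      (boundedVariationOn_indicator_Ioi 0 (-x)))
      (boundedVariationOn_indicator_Ioc hT.le (BoundedVariationOn.add
        (BoundedVariationOn.add (boundedVariationOn_const x _) (he.mono (subset_univ _))) hpbv))
    convert h1 using 1
    funext t
    unfold impactPath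
    split_ifs with h1 h2
    · simp [not_lt.2 h1]
    · simp [not_le.1 h1, h2, hp]
    · simp [not_le.1 h1, h2]
  · rcases le_or_gt t 0 with ht | ht
    · refine (continuousWithinAt_const (b := x)).congr (fun s hs => ?_) ?_
      · rw [impactPath, if_pos (le_trans hs ht)]
      · rw [impactPath, if_pos ht]
    · rcases le_or_gt t T with htT | htT
      · have h1 : ContinuousWithinAt (fun s => x + e s + p s) (Iic t) t := by
          refine ((hl t).const_add x).add ?_
          refine (hpc t ⟨ht.le, htT⟩).mono_of_mem_nhdsWithin ?_
          filter_upwards [self_mem_nhdsWithin, mem_nhdsWithin_of_mem_nhds (Ioi_mem_nhds ht)]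
            with s hs1 hs2 using ⟨le_of_lt hs2, le_trans hs1 htT⟩
        refine h1.congr_of_eventuallyEq ?_ ?_
        · filter_upwards [self_mem_nhdsWithin, mem_nhdsWithin_of_mem_nhds (Ioi_mem_nhds ht)]
            with s hs1 hs2
          rw [impactPath, if_neg (not_le.2 hs2), if_pos (le_trans hs1 htT)]
        · rw [impactPath, if_neg (not_le.2 ht), if_pos htT]
      · refine (continuousWithinAt_const (b := (0 : ℝ))).congr_of_eventuallyEq ?_ ?_
        · filter_upwards [mem_nhdsWithin_of_mem_nhds (Ioi_mem_nhds htT)] with s hs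
          rw [impactPath, if_neg (not_le.2 (hT.trans hs)), if_neg (not_le.2 hs)]
        · rw [impactPath, if_neg (not_le.2 ht), if_neg (not_le.2 htT)]
  · rw [impactPath, if_neg (not_le.2 (hT.trans ht)), if_neg (not_le.2 ht)]
  · refine hrhoc.integrableOn_Icc.mul_bdd (c := C) ?_ (ae_of_all _ fun t => ?_)
    · exact (Measurable.ite measurableSet_Iic measurable_const hem).aestronglyMeasurable
    · split_ifs
      · simpa using (abs_nonneg _).trans (hC 0)
      · exact hC t
  · rw [hprim t ht.1]
    rcases ht.1.eq_or_lt with rfl | h0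
    · simp [impactPath, hp]
    · simp only [impactPath, not_le.2 h0, if_false, ht.2, if_true, le_refl]
      simp only [hp]
      ring

lemma impactCost_congr {lam : ℝ → ℝ} {e' : ℝ → ℝ} (hT : 0 < T) (h : ∀ t ∈ Ioc 0 T, e t = e' t) :
    impactCost lam rho T x e = impactCost lam rho T x e' := by
  have hc : ∀ k : ℝ → ℝ, ∀ n : ℕ, (∫ s in (0 : ℝ)..T, k s * e s ^ n)
      = ∫ s in (0 : ℝ)..T, k s * e' s ^ n := by
    intro k n
    rw [intervalIntegral.integral_of_le hT.le, intervalIntegral.integral_of_le hT.le]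
    exact setIntegral_congr_fun measurableSet_Ioc fun s hs => by simp only [h s hs]
  have h1 := hc rho 1
  simp only [pow_one] at h1
  rw [impactCost, impactCost, h1, hc]

end Deterministic

/-! ### Price manipulation in terms of the impact cost -/

section Reduction

lemma IsImpactPath.isVolumeImpact {Ω : Type*} {rho : ℝ → ℝ} {T x : ℝ} {g e : ℝ → ℝ}
    (h : IsImpactPath rho T x g e) :
    IsVolumeImpact rho T (fun t (_ : Ω) => g t) fun t _ => e t where
  integrable _ := h.integrable
  dynamics _ := h.dynamics

variable {Ω : Type*} [mΩ : MeasurableSpace Ω] {P : Measure Ω}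
  {ℱ : Filtration ℝ≥0 mΩ} {S : ℝ≥0 → Ω → ℝ} {lam rho : ℝ → ℝ} {T x : ℝ} {e : ℝ → ℝ}

lemma IsImpactPath.isAdmissible {g e : ℝ → ℝ} (h : IsImpactPath rho T x g e)
    (h0 : ∀ t ≤ 0, g t = x) : IsAdmissible ℱ P T x fun t _ => g t where
  initial t ht _ := h0 t ht
  terminal t ht _ := h.terminal t ht
  adapted _ := measurable_const
  left_continuous _ := h.left_continuous
  finite_variation _ := h.bounded_variation
  bounded_variation := ⟨(eVariationOn g univ).toNNReal, ae_of_all _ fun _ => by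
    rw [ENNReal.coe_toNNReal h.bounded_variation]⟩

variable [IsProbabilityMeasure P]

/-- The uniform margin `δ` survives both the expectation and the infimum over monotone strategies,
and the price term is common to all strategies. -/
theorem admitsTTPM_of_impactCost_lt (hS : Martingale S ℱ P)
    (hSr : ∀ ω t, ContinuousWithinAt (fun s => S s ω) (Ici t) t) (hT : 0 < T)
    (hpos : ∀ t, 0 ≤ t → 0 < lam t) (hlam : ContDiffOn ℝ 2 lam (Ici 0))
    (hrho : ContinuousOn rho (Ici 0)) (hrho_pos : ∀ t, 0 ≤ t → 0 < rho t)
    (he : BoundedVariationOn e univ) (hl : ∀ t, ContinuousWithinAt e (Iic t) t)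
    {δ : ℝ} (hδ : 0 < δ)
    (h : ∀ g' e', IsImpactPath rho T x g' e' → (Antitone g' ∨ Monotone g') →
      impactCost lam rho T x e + δ ≤ impactCost lam rho T x e') :
    AdmitsTTPM ℱ P S blockShape lam rho T := by
  have hp := isImpactPath_impactPath hT hrho he hl x
  have hX : IsAdmissible ℱ P T x fun t _ => impactPath rho T x e t :=
    hp.isAdmissible fun t ht => if_pos ht
  have hE := hp.isVolumeImpact (Ω := Ω)
  refine ⟨x, _, _, hX, hE, ?_⟩
  rw [hX.expectedCost_eq hE hS hSr hT hpos hlam hrho hrho_pos]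
  have hc : impactCost lam rho T x (fun t => if t ≤ 0 then 0 else e t)
      = impactCost lam rho T x e :=
    impactCost_congr hT fun t ht => by simp [not_le.2 ht.1]
  simp only [hc, integral_const, probReal_univ, one_smul]
  refine lt_of_lt_of_le (b := ((-x * ∫ ω, S T.toNNReal ω ∂P
    + (impactCost lam rho T x e + δ) : ℝ) : EReal)) (by exact_mod_cast by linarith) ?_
  refine le_iInf fun Y => le_iInf fun EY => le_iInf fun hY => le_iInf fun hEY => le_iInf fun hm => ?_
  rw [hY.expectedCost_eq hEY hS hSr hT hpos hlam hrho hrho_pos]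
  rw [EReal.coe_le_coe_iff]
  refine add_le_add le_rfl ?_
  have hi := hY.integrable_impactCost hEY hT hpos hlam hrho hrho_pos
  calc impactCost lam rho T x e + δ
      = ∫ _, (impactCost lam rho T x e + δ) ∂P := by simp
    _ ≤ _ := integral_mono (integrable_const _) hi fun ω =>
        h _ _ (hY.isImpactPath hEY ω) (hm.imp (fun h => h ω) fun h => h ω)

/-- A monotone deterministic path that is optimal pathwise is itself a competitor in the infimum and
is no dearer than any random strategy. -/
theorem not_admitsTTPM_of_le_impactCost (hS : Martingale S ℱ P)
    (hSr : ∀ ω t, ContinuousWithinAt (fun s => S s ω) (Ici t) t) (hT : 0 < T)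
    (hpos : ∀ t, 0 ≤ t → 0 < lam t) (hlam : ContDiffOn ℝ 2 lam (Ici 0))
    (hrho : ContinuousOn rho (Ici 0)) (hrho_pos : ∀ t, 0 ≤ t → 0 < rho t)
    (h : ∀ x, ∃ e, BoundedVariationOn e univ ∧ (∀ t, ContinuousWithinAt e (Iic t) t) ∧
      (Antitone (impactPath rho T x e) ∨ Monotone (impactPath rho T x e)) ∧
      ∀ g' e', IsImpactPath rho T x g' e' →
        impactCost lam rho T x e ≤ impactCost lam rho T x e') :
    ¬ AdmitsTTPM ℱ P S blockShape lam rho T := by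
  rintro ⟨x, X, E, hX, hE, hlt⟩
  obtain ⟨e, he, hl, hm, hmin⟩ := h x
  have hp := isImpactPath_impactPath hT hrho he hl x
  have hY : IsAdmissible ℱ P T x fun t _ => impactPath rho T x e t :=
    hp.isAdmissible fun t ht => if_pos ht
  have hEY := hp.isVolumeImpact (Ω := Ω)
  have hc : impactCost lam rho T x (fun t => if t ≤ 0 then 0 else e t)
      = impactCost lam rho T x e :=
    impactCost_congr hT fun t ht => by simp [not_le.2 ht.1]
  have hle : expectedCost P S blockShape lam T (fun t _ => impactPath rho T x e t)
      (fun t _ => if t ≤ 0 then 0 else e t) ≤ expectedCost P S blockShape lam T X E := by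
    rw [hX.expectedCost_eq hE hS hSr hT hpos hlam hrho hrho_pos,
      hY.expectedCost_eq hEY hS hSr hT hpos hlam hrho hrho_pos]
    refine add_le_add le_rfl ?_
    simp only [hc]
    exact integral_mono (integrable_const _)
      (hX.integrable_impactCost hE hT hpos hlam hrho hrho_pos) fun ω =>
        hmin _ _ (hX.isImpactPath hE ω)
  have h1 := hlt.trans_le (iInf_le _ fun t _ => impactPath rho T x e t)
  have h2 := h1.trans_le (iInf_le _ fun t _ => if t ≤ 0 then 0 else e t)
  have h3 := (h2.trans_le (iInf_le _ hY)).trans_le (iInf_le _ hEY)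
  have h4 := h3.trans_le (iInf_le _ (hm.imp (fun h _ => h) fun h _ => h))
  exact absurd hle (not_le.2 (EReal.coe_lt_coe_iff.1 h4))

end Reduction

end LimitOrderBook

end

noncomputable section

namespace LimitOrderBook

open Filter Topology

/-! ### Functions on a compact interval -/

lemma exists_Icc_lt_of_continuousOn {f : ℝ → ℝ} {T t₀ c : ℝ} (hT : 0 < T)
    (hf : ContinuousOn f (Icc 0 T)) (ht : t₀ ∈ Icc 0 T) (hc : f t₀ < c) :
    ∃ p r, 0 ≤ p ∧ p < r ∧ r ≤ T ∧ ∀ t ∈ Icc p r, f t < c := by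
  have h := (hf t₀ ht).eventually (gt_mem_nhds hc)
  rw [eventually_nhdsWithin_iff, Metric.eventually_nhds_iff] at h
  obtain ⟨ε, hε, h⟩ := h
  obtain ⟨h0, h1⟩ := ht
  refine ⟨max 0 (t₀ - ε / 2), min T (t₀ + ε / 2), le_max_left _ _, ?_, min_le_left _ _,
    fun t ht => ?_⟩
  · rw [max_lt_iff, lt_min_iff, lt_min_iff]
    refine ⟨⟨hT, by linarith⟩, by linarith, by linarith⟩
  · obtain ⟨h2, h3⟩ := ht
    rw [max_le_iff] at h2
    rw [le_min_iff] at h3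
    refine h ?_ ⟨h2.1, h3.1⟩
    rw [Real.dist_eq, abs_lt]
    constructor <;> linarith

lemma exists_boundedVariation_extension {h : ℝ → ℝ} {T : ℝ} (hT : 0 ≤ T)
    (hh : ContDiffOn ℝ 1 h (Icc 0 T)) :
    ∃ e : ℝ → ℝ, BoundedVariationOn e univ ∧ (∀ t, ContinuousWithinAt e (Iic t) t) ∧
      ∀ t ∈ Icc 0 T, e t = h t := by
  refine ⟨IccExtend hT ((Icc 0 T).domRestrict h), ?_, fun t => ?_, fun t ht => ?_⟩
  · refine ne_top_of_le_ne_top (boundedVariationOn_Icc_of_contDiffOn hh)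
      (eVariationOn.comp_le_of_monotoneOn h (fun t => (projIcc 0 T hT t : ℝ))
        (fun s _ t _ hst => ?_) fun t _ => ?_)
    · exact monotone_projIcc hT hst
    · exact (projIcc 0 T hT t).2
  · exact ((continuousOn_iff_continuous_domRestrict.1 hh.continuousOn).Icc_extend'
      ).continuousWithinAt
  · simp [IccExtend_of_mem hT _ ht, Set.domRestrict_apply]

lemma continuousWithinAt_indicator_Ioc (a b c t : ℝ) :
    ContinuousWithinAt ((Ioc a b).indicator fun _ => c) (Iic t) t := by
  rcases le_or_gt t a with hta | hta
  · refine (continuousWithinAt_const (b := (0 : ℝ))).congr (fun s hs => ?_) ?_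
    · exact indicator_of_notMem (fun h => absurd h.1 (not_lt.2 (le_trans hs hta))) _
    · exact indicator_of_notMem (fun h => absurd h.1 (not_lt.2 hta)) _
  · rcases le_or_gt t b with htb | htb
    · refine (continuousWithinAt_const (b := c)).congr_of_eventuallyEq ?_ ?_
      · filter_upwards [self_mem_nhdsWithin, mem_nhdsWithin_of_mem_nhds (Ioi_mem_nhds hta)]
          with s hs1 hs2 using indicator_of_mem (show s ∈ Ioc a b from ⟨hs2, le_trans hs1 htb⟩) _
      · exact indicator_of_mem (show t ∈ Ioc a b from ⟨hta, htb⟩) _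
    · refine (continuousWithinAt_const (b := (0 : ℝ))).congr_of_eventuallyEq ?_ ?_
      · filter_upwards [mem_nhdsWithin_of_mem_nhds (Ioi_mem_nhds htb)] with s hs
        exact indicator_of_notMem (fun h => absurd h.2 (not_le.2 hs)) _
      · exact indicator_of_notMem (fun h => absurd h.2 (not_le.2 htb)) _

lemma intervalIntegral_indicator_Ioc {f : ℝ → ℝ} {T a b : ℝ} (ha : 0 ≤ a) (hab : a ≤ b)
    (hb : b ≤ T) : ∫ s in (0 : ℝ)..T, (Ioc a b).indicator f s = ∫ s in a..b, f s := by
  rw [intervalIntegral.integral_of_le (ha.trans (hab.trans hb)),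
    intervalIntegral.integral_of_le hab, setIntegral_indicator measurableSet_Ioc,
    inter_eq_self_of_subset_right (Ioc_subset_Ioc ha hb)]

/-- The integral of `1 / (L |t - t₀| + ε)` near `t₀` diverges as `ε` tends to `0`. -/
lemma exists_le_integral_inv_add {L h : ℝ} (hL : 0 < L) (hh : 0 < h) (M : ℝ) :
    ∃ ε > 0, M ≤ ∫ s in (0 : ℝ)..h, (L * s + ε)⁻¹ := by
  -- The integral is `log((L h + ε)/ε) / L`, and this `ε` solves `L h / ε = exp(L M)`.
  refine ⟨L * h / Real.exp (L * M), by positivity, ?_⟩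
  set ε := L * h / Real.exp (L * M) with hε
  have hε0 : 0 < ε := by positivity
  have hint : ∫ s in (0 : ℝ)..h, (L * s + ε)⁻¹
      = Real.log (L * h + ε) / L - Real.log (L * 0 + ε) / L := by
    refine intervalIntegral.integral_eq_sub_of_hasDerivAt (f := fun s => Real.log (L * s + ε) / L)
      (fun s hs => ?_) ?_
    · rw [uIcc_of_le hh.le] at hs
      have hp : 0 < L * s + ε := by have := mul_nonneg hL.le hs.1; linarith
      have h1 : HasDerivAt (fun s => L * s + ε) L s := by
        simpa using ((hasDerivAt_id s).const_mul L).add_const ε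
      refine ((h1.log hp.ne').div_const L).congr_deriv ?_
      field_simp
    · refine ContinuousOn.intervalIntegrable (ContinuousOn.inv₀ (by fun_prop) fun s hs => ?_)
      rw [uIcc_of_le hh.le] at hs
      have := mul_nonneg hL.le hs.1
      linarith
  rw [hint, ← sub_div, le_div_iff₀ hL, mul_zero, zero_add,
    ← Real.log_div (by positivity) hε0.ne', Real.le_log_iff_exp_le (by positivity),
    le_div_iff₀ hε0, mul_comm M, hε]
  have : Real.exp (L * M) * (L * h / Real.exp (L * M)) = L * h := by field_simp
  rw [this]
  have : 0 < L * h / Real.exp (L * M) := hε0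
  linarith

end LimitOrderBook

end

noncomputable section

namespace LimitOrderBook

open Filter Topology

/-! ### The optimal volume impact -/

/-- The ratio `ρ / (2 ρ + η)`. -/
def resilienceRatio (lam rho : ℝ → ℝ) (t : ℝ) : ℝ := rho t / (2 * rho t + depthGrowth lam t)

section Rates

variable {lam rho : ℝ → ℝ} {T : ℝ}

lemma contDiffOn_depthGrowth (hpos : ∀ t, 0 ≤ t → 0 < lam t)
    (hlam : ContDiffOn ℝ 2 lam (Ici 0)) : ContDiffOn ℝ 1 (depthGrowth lam) (Ici 0) :=
  (hlam.derivWithin (uniqueDiffOn_Ici 0) (by norm_num)).div (hlam.of_le (by norm_num))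
    fun t ht => (hpos t ht).ne'

lemma contDiffOn_runningRate (hpos : ∀ t, 0 ≤ t → 0 < lam t)
    (hlam : ContDiffOn ℝ 2 lam (Ici 0)) (hrho : ContDiffOn ℝ 1 rho (Ici 0)) :
    ContDiffOn ℝ 1 (runningRate lam rho) (Ici 0) :=
  ((contDiffOn_const.mul hrho).add (contDiffOn_depthGrowth hpos hlam)).div
    (contDiffOn_const.mul (hlam.of_le (by norm_num)))
    fun t ht => (mul_pos two_pos (hpos t ht)).ne'

lemma contDiffOn_resilienceRatio (hpos : ∀ t, 0 ≤ t → 0 < lam t)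
    (hlam : ContDiffOn ℝ 2 lam (Ici 0)) (hrho : ContDiffOn ℝ 1 rho (Ici 0))
    (hden : ∀ t ∈ Icc 0 T, 0 < 2 * rho t + depthGrowth lam t) :
    ContDiffOn ℝ 1 (resilienceRatio lam rho) (Icc 0 T) :=
  (hrho.mono Icc_subset_Ici_self).div
    (((contDiffOn_const.mul hrho).add (contDiffOn_depthGrowth hpos hlam)).mono Icc_subset_Ici_self)
    fun t ht => (hden t ht).ne'

lemma hasDerivWithinAt_resilienceRatio (hpos : ∀ t, 0 ≤ t → 0 < lam t)
    (hlam : ContDiffOn ℝ 2 lam (Ici 0)) (hrho : ContDiffOn ℝ 1 rho (Ici 0))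
    (hden : ∀ t ∈ Icc 0 T, 0 < 2 * rho t + depthGrowth lam t) {t : ℝ} (ht : t ∈ Icc 0 T) :
    HasDerivWithinAt (resilienceRatio lam rho)
      ((derivWithin rho (Ici 0) t * (2 * rho t + depthGrowth lam t)
        - rho t * (2 * derivWithin rho (Ici 0) t + derivWithin (depthGrowth lam) (Ici 0) t))
          / (2 * rho t + depthGrowth lam t) ^ 2) (Ici 0) t := by
  have h1 := (hrho.differentiableOn one_ne_zero t ht.1).hasDerivWithinAt
  have h2 := ((contDiffOn_depthGrowth hpos hlam).differentiableOn one_ne_zero t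
    ht.1).hasDerivWithinAt
  exact h1.div ((h1.const_mul 2).add h2) (hden t ht).ne'

lemma continuousOn_derivWithin_resilienceRatio (hpos : ∀ t, 0 ≤ t → 0 < lam t)
    (hlam : ContDiffOn ℝ 2 lam (Ici 0)) (hrho : ContDiffOn ℝ 1 rho (Ici 0))
    (hden : ∀ t ∈ Icc 0 T, 0 < 2 * rho t + depthGrowth lam t) :
    ContinuousOn (derivWithin (resilienceRatio lam rho) (Ici 0)) (Icc 0 T) := by
  have hr := hrho.continuousOn.mono (Icc_subset_Ici_self : Icc 0 T ⊆ Ici 0)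
  have hr' := (hrho.continuousOn_derivWithin (uniqueDiffOn_Ici 0) le_rfl).mono
    (Icc_subset_Ici_self : Icc 0 T ⊆ Ici 0)
  have hη := (continuousOn_depthGrowth hpos hlam).mono (Icc_subset_Ici_self : Icc 0 T ⊆ Ici 0)
  have hη' := ((contDiffOn_depthGrowth hpos hlam).continuousOn_derivWithin (uniqueDiffOn_Ici 0)
    le_rfl).mono (Icc_subset_Ici_self : Icc 0 T ⊆ Ici 0)
  have hd : ContinuousOn (fun t => 2 * rho t + depthGrowth lam t) (Icc 0 T) :=
    (continuousOn_const.mul hr).add hη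
  refine ContinuousOn.congr (((hr'.mul hd).sub (hr.mul ((continuousOn_const (c := 2).mul
    hr').add hη'))).div (hd.pow 2) fun t ht => (pow_pos (hden t ht) 2).ne') fun t ht => ?_
  exact (hasDerivWithinAt_resilienceRatio hpos hlam hrho hden ht).derivWithin
    (uniqueDiffOn_Ici 0 t ht.1)

lemma hasDerivAt_resilienceRatio (hpos : ∀ t, 0 ≤ t → 0 < lam t)
    (hlam : ContDiffOn ℝ 2 lam (Ici 0)) (hrho : ContDiffOn ℝ 1 rho (Ici 0))
    (hden : ∀ t ∈ Icc 0 T, 0 < 2 * rho t + depthGrowth lam t) {t : ℝ} (ht : t ∈ Ioo 0 T) :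
    HasDerivAt (resilienceRatio lam rho) (derivWithin (resilienceRatio lam rho) (Ici 0) t) t :=
  (hasDerivWithinAt_resilienceRatio hpos hlam hrho hden
    (Ioo_subset_Icc_self ht)).differentiableWithinAt.hasDerivWithinAt.hasDerivAt
      (Ici_mem_nhds ht.1)

lemma hasDerivAt_mul_resilienceRatio (hpos : ∀ t, 0 ≤ t → 0 < lam t)
    (hlam : ContDiffOn ℝ 2 lam (Ici 0)) (hrho : ContDiffOn ℝ 1 rho (Ici 0))
    (hden : ∀ t ∈ Icc 0 T, 0 < 2 * rho t + depthGrowth lam t) {t : ℝ} (ht : t ∈ Ioo 0 T) :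
    HasDerivAt (fun s => lam s * resilienceRatio lam rho s)
      (lam t * (derivWithin (resilienceRatio lam rho) (Ici 0) t
        + depthGrowth lam t * resilienceRatio lam rho t)) t := by
  refine ((hasDerivAt_of_contDiffOn_Ici (by norm_num) hlam ht.1).mul
    (hasDerivAt_resilienceRatio hpos hlam hrho hden ht)).congr_deriv ?_
  have := (hpos t ht.1.le).ne'
  rw [depthGrowth]
  field_simp
  ring

lemma one_sub_resilienceRatio {t : ℝ} (hden : 2 * rho t + depthGrowth lam t ≠ 0) :
    1 - resilienceRatio lam rho t
      = (rho t + depthGrowth lam t) / (2 * rho t + depthGrowth lam t) := by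
  rw [resilienceRatio, eq_div_iff hden, sub_mul, div_mul_cancel₀ _ hden]
  ring

/-- All of this is `(2ρ+η)/(2λ) · λ r = ρ/2`: the cross term becomes the linear functional `∫ρe` of
the terminal cost. -/
lemma runningRate_mul_sq {t : ℝ} (hpos : 0 < lam t) (hden : 0 < 2 * rho t + depthGrowth lam t)
    (κ y : ℝ) :
    runningRate lam rho t * (y + κ * (lam t * resilienceRatio lam rho t)) ^ 2
      = runningRate lam rho t * y ^ 2 + κ * (rho t * y)
        + κ ^ 2 / 2 * (rho t * (lam t * resilienceRatio lam rho t)) := by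
  simp only [runningRate, resilienceRatio]
  field_simp
  ring

/-- Completing the square in the impact cost. -/
theorem IsImpactPath.impactCost_eq (hT : 0 < T) (hpos : ∀ t, 0 ≤ t → 0 < lam t)
    (hlam : ContDiffOn ℝ 2 lam (Ici 0)) (hrho : ContDiffOn ℝ 1 rho (Ici 0))
    (hden : ∀ t ∈ Icc 0 T, 0 < 2 * rho t + depthGrowth lam t) {x κ : ℝ} {g e : ℝ → ℝ}
    (h : IsImpactPath rho T x g e)
    (hκ : κ * (lam T + ∫ s in (0 : ℝ)..T, rho s * (lam s * resilienceRatio lam rho s)) = x) :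
    impactCost lam rho T x e = κ * x / 2
      + (∫ s in (0 : ℝ)..T, runningRate lam rho s
          * (e s + κ * (lam s * resilienceRatio lam rho s)) ^ 2)
      + (x + (∫ s in (0 : ℝ)..T, rho s * e s) - κ * lam T) ^ 2 / (2 * lam T) := by
  have hlc := hlam.continuousOn.mono (Icc_subset_Ici_self : Icc 0 T ⊆ Ici 0)
  have hrc := hrho.continuousOn.mono (Icc_subset_Ici_self : Icc 0 T ⊆ Ici 0)
  have hgc := (contDiffOn_resilienceRatio hpos hlam hrho hden).continuousOn
  have ha := ((contDiffOn_runningRate hpos hlam hrho).continuousOn).mono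
    (Icc_subset_Ici_self : Icc 0 T ⊆ Ici 0)
  have hi2 := h.integrable_mul hT ha.integrableOn_Icc 2
  have hi1 := h.integrable_mul hT hrc.integrableOn_Icc 1
  simp only [pow_one] at hi1
  have hi0 : IntervalIntegrable (fun s => rho s * (lam s * resilienceRatio lam rho s))
      volume 0 T := (hrc.mul (hlc.mul hgc)).intervalIntegrable_of_Icc hT.le
  have hsq : (∫ s in (0 : ℝ)..T, runningRate lam rho s
        * (e s + κ * (lam s * resilienceRatio lam rho s)) ^ 2)
      = (∫ s in (0 : ℝ)..T, runningRate lam rho s * e s ^ 2)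
        + κ * (∫ s in (0 : ℝ)..T, rho s * e s)
        + κ ^ 2 / 2 * ∫ s in (0 : ℝ)..T, rho s * (lam s * resilienceRatio lam rho s) := by
    rw [← intervalIntegral.integral_const_mul, ← intervalIntegral.integral_const_mul,
      ← intervalIntegral.integral_add hi2 (hi1.const_mul κ),
      ← intervalIntegral.integral_add (hi2.add (hi1.const_mul κ)) (hi0.const_mul _)]
    refine intervalIntegral.integral_congr fun t ht => ?_
    rw [uIcc_of_le hT.le] at ht
    exact runningRate_mul_sq (hpos t ht.1) (hden t ht) κ (e t)
  rw [hsq, impactCost]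
  have hlT := (hpos T hT.le).ne'
  generalize (∫ s in (0 : ℝ)..T, rho s * (lam s * resilienceRatio lam rho s)) = U at *
  generalize (∫ s in (0 : ℝ)..T, rho s * e s) = I at *
  rw [← hκ]
  field_simp
  ring

/-- Both squares in `IsImpactPath.impactCost_eq` vanish here; the choice of `κ` gives `x + ∫ρe = κ
λ_T`. -/
lemma impactCost_optimal (hT : 0 < T) (hpos : ∀ t, 0 ≤ t → 0 < lam t)
    (hden : ∀ t ∈ Icc 0 T, 0 < 2 * rho t + depthGrowth lam t) {x κ : ℝ} {e : ℝ → ℝ}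
    (hκ : κ * (lam T + ∫ s in (0 : ℝ)..T, rho s * (lam s * resilienceRatio lam rho s)) = x)
    (he : ∀ t ∈ Icc 0 T, e t = -(κ * (lam t * resilienceRatio lam rho t))) :
    impactCost lam rho T x e = κ * x / 2 := by
  have h1 : (∫ s in (0 : ℝ)..T, rho s * e s)
      = -κ * ∫ s in (0 : ℝ)..T, rho s * (lam s * resilienceRatio lam rho s) := by
    rw [← intervalIntegral.integral_const_mul]
    refine intervalIntegral.integral_congr fun t ht => ?_
    rw [uIcc_of_le hT.le] at ht
    simp only [he t ht]
    ring
  have h2 : (∫ s in (0 : ℝ)..T, runningRate lam rho s * e s ^ 2)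
      = κ ^ 2 / 2 * ∫ s in (0 : ℝ)..T, rho s * (lam s * resilienceRatio lam rho s) := by
    rw [← intervalIntegral.integral_const_mul]
    refine intervalIntegral.integral_congr fun t ht => ?_
    rw [uIcc_of_le hT.le] at ht
    have h1 := (hpos t ht.1).ne'
    have h2 := (hden t ht).ne'
    simp only [he t ht, runningRate, resilienceRatio]
    field_simp
  rw [impactCost, h1, h2]
  have hlT := (hpos T hT.le).ne'
  generalize (∫ s in (0 : ℝ)..T, rho s * (lam s * resilienceRatio lam rho s)) = U at *
  rw [← hκ]
  field_simp
  ring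

lemma runningRate_pos (hpos : ∀ t, 0 ≤ t → 0 < lam t) {t : ℝ} (ht : 0 ≤ t)
    (hden : 0 < 2 * rho t + depthGrowth lam t) : 0 < runningRate lam rho t :=
  div_pos hden (mul_pos two_pos (hpos t ht))

lemma IsImpactPath.integrable_square (hT : 0 < T) (hpos : ∀ t, 0 ≤ t → 0 < lam t)
    (hlam : ContDiffOn ℝ 2 lam (Ici 0)) (hrho : ContDiffOn ℝ 1 rho (Ici 0))
    (hden : ∀ t ∈ Icc 0 T, 0 < 2 * rho t + depthGrowth lam t) {x κ : ℝ} {g e : ℝ → ℝ}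
    (h : IsImpactPath rho T x g e) :
    IntervalIntegrable (fun s => runningRate lam rho s
      * (e s + κ * (lam s * resilienceRatio lam rho s)) ^ 2) volume 0 T := by
  have hlc := hlam.continuousOn.mono (Icc_subset_Ici_self : Icc 0 T ⊆ Ici 0)
  have hrc := hrho.continuousOn.mono (Icc_subset_Ici_self : Icc 0 T ⊆ Ici 0)
  have hgc := (contDiffOn_resilienceRatio hpos hlam hrho hden).continuousOn
  have ha := ((contDiffOn_runningRate hpos hlam hrho).continuousOn).mono
    (Icc_subset_Ici_self : Icc 0 T ⊆ Ici 0)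
  have hi2 := h.integrable_mul hT ha.integrableOn_Icc 2
  have hi1 := h.integrable_mul hT hrc.integrableOn_Icc 1
  simp only [pow_one] at hi1
  have hi0 : IntervalIntegrable (fun s => rho s * (lam s * resilienceRatio lam rho s))
      volume 0 T := (hrc.mul (hlc.mul hgc)).intervalIntegrable_of_Icc hT.le
  refine ((hi2.add (hi1.const_mul κ)).add (hi0.const_mul (κ ^ 2 / 2))).congr fun t ht => ?_
  rw [uIoc_of_le hT.le] at ht
  exact (runningRate_mul_sq (hpos t ht.1.le) (hden t (Ioc_subset_Icc_self ht)) κ (e t)).symm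

/-- A volume impact that stays away from the optimal one is expensive. -/
theorem IsImpactPath.exists_le_integral_square (hT : 0 < T) (hpos : ∀ t, 0 ≤ t → 0 < lam t)
    (hlam : ContDiffOn ℝ 2 lam (Ici 0)) (hrho : ContDiffOn ℝ 1 rho (Ici 0))
    (hden : ∀ t ∈ Icc 0 T, 0 < 2 * rho t + depthGrowth lam t) {p r c : ℝ} (hp : 0 ≤ p)
    (hpr : p < r) (hr : r ≤ T) (hc : 0 < c) :
    ∃ δ > 0, ∀ x κ g e, IsImpactPath rho T x g e →
      (∀ t ∈ Icc p r, c ≤ |e t + κ * (lam t * resilienceRatio lam rho t)|) →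
      δ ≤ ∫ s in (0 : ℝ)..T, runningRate lam rho s
        * (e s + κ * (lam s * resilienceRatio lam rho s)) ^ 2 := by
  have ha := ((contDiffOn_runningRate hpos hlam hrho).continuousOn).mono
    (Icc_subset_Ici_self : Icc 0 T ⊆ Ici 0)
  have ha0 : ∀ t ∈ Icc 0 T, 0 < runningRate lam rho t := fun t ht =>
    runningRate_pos hpos ht.1 (hden t ht)
  -- The positive minimum of the running rate makes `δ` independent of the path and of `κ`.
  obtain ⟨m, hm, hmin⟩ := isCompact_Icc.exists_isMinOn (nonempty_Icc.2 hT.le) ha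
  refine ⟨(r - p) * (runningRate lam rho m * c ^ 2), mul_pos (sub_pos.2 hpr)
    (mul_pos (ha0 m hm) (pow_pos hc 2)), fun x κ g e h hce => ?_⟩
  have hi := h.integrable_square (κ := κ) hT hpos hlam hrho hden
  have hpr' : Icc p r ⊆ Icc 0 T := Icc_subset_Icc hp hr
  calc (r - p) * (runningRate lam rho m * c ^ 2)
      = ∫ _ in p..r, runningRate lam rho m * c ^ 2 := by
        rw [intervalIntegral.integral_const, smul_eq_mul]
    _ ≤ ∫ s in p..r, runningRate lam rho s
        * (e s + κ * (lam s * resilienceRatio lam rho s)) ^ 2 := by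
      refine intervalIntegral.integral_mono_on hpr.le intervalIntegrable_const
        (hi.mono_set ?_) fun t ht => ?_
      · rwa [uIcc_of_le hpr.le, uIcc_of_le hT.le]
      · refine mul_le_mul (hmin (hpr' ht)) ?_ (sq_nonneg c) (ha0 t (hpr' ht)).le
        rw [← sq_abs (e t + _)]
        exact pow_le_pow_left₀ hc.le (hce t ht) 2
    _ ≤ _ := by
      refine intervalIntegral.integral_mono_interval hp hpr.le hr ?_ hi
      filter_upwards [ae_restrict_mem measurableSet_Ioc] with t ht
      exact mul_nonneg (ha0 t (Ioc_subset_Icc_self ht)).le (sq_nonneg _)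

end Rates

end LimitOrderBook

end

noncomputable section

namespace LimitOrderBook

open Filter Topology

/-! ### Monotonicity of the optimal strategy -/

/-- The second condition `(ρ / (2 ρ + η))' + ρ (ρ + η) / (2 ρ + η)`. -/
def manipulationRate (lam rho : ℝ → ℝ) (t : ℝ) : ℝ :=
  derivWithin (resilienceRatio lam rho) (Ici 0) t
    + rho t * ((rho t + depthGrowth lam t) / (2 * rho t + depthGrowth lam t))

section Deterministic

variable {lam rho : ℝ → ℝ} {T : ℝ}

lemma manipulationRate_eq (t : ℝ) :
    manipulationRate lam rho t = derivWithin (resilienceRatio lam rho) (Ici 0) t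
      + resilienceRatio lam rho t * (rho t + depthGrowth lam t) := by
  rw [manipulationRate, resilienceRatio]
  ring

lemma IsImpactPath.antitone_of_pos {x : ℝ} {g e : ℝ → ℝ} (h : IsImpactPath rho T x g e)
    (hT : 0 < T) (hx : 0 < x) (hg : Antitone g ∨ Monotone g) : Antitone g := by
  refine hg.resolve_right fun hm => ?_
  have h1 := hm (show (0 : ℝ) ≤ T + 1 by linarith)
  rw [h.initial, h.terminal _ (by linarith)] at h1
  linarith

lemma depth_add_integral_pos (hT : 0 < T) (hpos : ∀ t, 0 ≤ t → 0 < lam t)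
    (hrho_pos : ∀ t, 0 ≤ t → 0 < rho t)
    (hden : ∀ t ∈ Icc 0 T, 0 < 2 * rho t + depthGrowth lam t) :
    0 < lam T + ∫ s in (0 : ℝ)..T, rho s * (lam s * resilienceRatio lam rho s) := by
  refine add_pos_of_pos_of_nonneg (hpos T hT.le) (intervalIntegral.integral_nonneg hT.le
    fun t ht => ?_)
  exact (mul_pos (hrho_pos t ht.1) (mul_pos (hpos t ht.1)
    (div_pos (hrho_pos t ht.1) (hden t ht)))).le

/-- Under the two conditions the optimal strategy is nonincreasing. -/
theorem antitone_impactPath_optimal (hT : 0 < T) (hpos : ∀ t, 0 ≤ t → 0 < lam t)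
    (hlam : ContDiffOn ℝ 2 lam (Ici 0)) (hrho : ContDiffOn ℝ 1 rho (Ici 0))
    (hrho_pos : ∀ t, 0 ≤ t → 0 < rho t)
    (hden : ∀ t ∈ Icc 0 T, 0 < 2 * rho t + depthGrowth lam t)
    (h1 : 0 ≤ rho T + depthGrowth lam T) (h2 : ∀ t ∈ Icc 0 T, 0 ≤ manipulationRate lam rho t)
    {e : ℝ → ℝ} (he : ∀ t ∈ Icc 0 T, e t = -(lam t * resilienceRatio lam rho t)) :
    Antitone (impactPath rho T
      (lam T + ∫ s in (0 : ℝ)..T, rho s * (lam s * resilienceRatio lam rho s)) e) := by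
  have hlc := hlam.continuousOn.mono (Icc_subset_Ici_self : Icc 0 T ⊆ Ici 0)
  have hrc := hrho.continuousOn.mono (Icc_subset_Ici_self : Icc 0 T ⊆ Ici 0)
  have hgc := (contDiffOn_resilienceRatio hpos hlam hrho hden).continuousOn
  have hint : ∀ t ∈ Icc 0 T, (∫ s in (0 : ℝ)..t, rho s * e s)
      = -∫ s in (0 : ℝ)..t, rho s * (lam s * resilienceRatio lam rho s) := by
    intro t ht
    rw [← intervalIntegral.integral_neg]
    refine intervalIntegral.integral_congr fun s hs => ?_
    rw [uIcc_of_le ht.1] at hs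
    simp only [he s ⟨hs.1, hs.2.trans ht.2⟩]
    ring
  have hTm : T ∈ Icc 0 T := ⟨hT.le, le_rfl⟩
  have h0m : (0 : ℝ) ∈ Icc 0 T := ⟨le_rfl, hT.le⟩
  refine antitone_impactPath hT ?_ ?_ ?_
  · rw [he 0 h0m, neg_nonpos]
    exact (mul_pos (hpos 0 le_rfl) (div_pos (hrho_pos 0 le_rfl) (hden 0 h0m))).le
  · rw [he T hTm, hint T hTm]
    have h3 : lam T * (1 - resilienceRatio lam rho T) =
        lam T - lam T * resilienceRatio lam rho T := by ring
    rw [one_sub_resilienceRatio (hden T hTm).ne'] at h3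
    have h4 : 0 ≤ lam T * ((rho T + depthGrowth lam T) / (2 * rho T + depthGrowth lam T)) :=
      mul_nonneg (hpos T hT.le).le (div_nonneg h1 (hden T hTm).le)
    linarith
  · set K := lam T + ∫ s in (0 : ℝ)..T, rho s * (lam s * resilienceRatio lam rho s)
    have hk : ContinuousOn (fun s => rho s * (lam s * resilienceRatio lam rho s)) (Icc 0 T) :=
      hrc.mul (hlc.mul hgc)
    refine AntitoneOn.congr (f₁ := fun t => K - lam t * resilienceRatio lam rho t
      - ∫ s in (0 : ℝ)..t, rho s * (lam s * resilienceRatio lam rho s)) ?_ fun t ht => ?_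
    · refine antitoneOn_of_deriv_nonpos (convex_Icc 0 T) ?_ ?_ ?_
      · refine (continuousOn_const.sub (hlc.mul hgc)).sub ?_
        have := intervalIntegral.continuousOn_primitive_interval (μ := volume) (a := 0) (b := T)
          (by rw [uIcc_of_le hT.le]; exact hk.integrableOn_Icc)
        rwa [uIcc_of_le hT.le] at this
      all_goals
        rw [interior_Icc]
        intro t ht
        -- The slope of the optimal path is `-λ (r' + η r + ρ r)`, which is minus `λ` times the
        -- second expression.
        have hd : HasDerivAt (fun t => K - lam t * resilienceRatio lam rho t
            - ∫ s in (0 : ℝ)..t, rho s * (lam s * resilienceRatio lam rho s))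
            (-(lam t * manipulationRate lam rho t)) t := by
          have hu := hasDerivAt_mul_resilienceRatio hpos hlam hrho hden ht
          have hc : ContinuousOn (fun s => rho s * (lam s * resilienceRatio lam rho s))
            (Ioo 0 T) := hk.mono Ioo_subset_Icc_self
          have hi := intervalIntegral.integral_hasDerivAt_right (a := 0) (b := t)
            ((hk.mono (Icc_subset_Icc_right ht.2.le)).intervalIntegrable_of_Icc ht.1.le)
            (hc.stronglyMeasurableAtFilter isOpen_Ioo t ht)
            (hc.continuousAt (Ioo_mem_nhds ht.1 ht.2))
          refine ((hu.const_sub K).sub hi).congr_deriv ?_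
          rw [manipulationRate_eq]
          ring
        first
        | exact hd.differentiableAt.differentiableWithinAt
        | rw [hd.deriv, neg_nonpos]
          exact mul_nonneg (hpos t ht.1.le).le (h2 t (Ioo_subset_Icc_self ht))
    · simp only
      rw [he t ht, hint t ht]
      ring

/-- The factor `exp(∫ρ)` absorbs the resilience: what remains is the trading rate. Its sign can
therefore be compared with `IsImpactPath.antitoneOn_exp_mul`. -/
lemma hasDerivAt_exp_mul_resilienceRatio (hpos : ∀ t, 0 ≤ t → 0 < lam t)
    (hlam : ContDiffOn ℝ 2 lam (Ici 0)) (hrho : ContDiffOn ℝ 1 rho (Ici 0))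
    (hden : ∀ t ∈ Icc 0 T, 0 < 2 * rho t + depthGrowth lam t) {t : ℝ} (ht : t ∈ Ioo 0 T) :
    HasDerivAt (fun s => Real.exp (cumulativeResilience rho s)
        * (lam s * resilienceRatio lam rho s))
      (Real.exp (cumulativeResilience rho t) * (lam t * manipulationRate lam rho t)) t := by
  refine ((hasDerivAt_exp_cumulativeResilience hrho.continuousOn ht.1).mul
    (hasDerivAt_mul_resilienceRatio hpos hlam hrho hden ht)).congr_deriv ?_
  rw [manipulationRate_eq]
  ring

lemma continuousOn_exp_mul_resilienceRatio (hpos : ∀ t, 0 ≤ t → 0 < lam t)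
    (hlam : ContDiffOn ℝ 2 lam (Ici 0)) (hrho : ContDiffOn ℝ 1 rho (Ici 0))
    (hden : ∀ t ∈ Icc 0 T, 0 < 2 * rho t + depthGrowth lam t) :
    ContinuousOn (fun s => Real.exp (cumulativeResilience rho s)
        * (lam s * resilienceRatio lam rho s)) (Icc 0 T) :=
  ((continuousOn_exp_cumulativeResilience hrho.continuousOn).mono Icc_subset_Ici_self).mul
    ((hlam.continuousOn.mono Icc_subset_Ici_self).mul
      (contDiffOn_resilienceRatio hpos hlam hrho hden).continuousOn)

lemma continuousOn_manipulationRate (hpos : ∀ t, 0 ≤ t → 0 < lam t)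
    (hlam : ContDiffOn ℝ 2 lam (Ici 0)) (hrho : ContDiffOn ℝ 1 rho (Ici 0))
    (hden : ∀ t ∈ Icc 0 T, 0 < 2 * rho t + depthGrowth lam t) :
    ContinuousOn (manipulationRate lam rho) (Icc 0 T) := by
  have hr := hrho.continuousOn.mono (Icc_subset_Ici_self : Icc 0 T ⊆ Ici 0)
  have hη := (continuousOn_depthGrowth hpos hlam).mono (Icc_subset_Ici_self : Icc 0 T ⊆ Ici 0)
  exact (continuousOn_derivWithin_resilienceRatio hpos hlam hrho hden).add
    (hr.mul ((hr.add hη).div ((continuousOn_const.mul hr).add hη) fun t ht => (hden t ht).ne'))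

lemma exp_cumulativeResilience_le (hrho : ContinuousOn rho (Ici 0))
    (hrho_pos : ∀ t, 0 ≤ t → 0 < rho t) {t : ℝ} (ht : t ∈ Icc 0 T) :
    Real.exp (cumulativeResilience rho t) ≤ Real.exp (cumulativeResilience rho T) := by
  have h := integral_mul_exp_cumulativeResilience hrho ht.1 ht.2
  have h' : 0 ≤ ∫ s in t..T, rho s * Real.exp (cumulativeResilience rho s) :=
    intervalIntegral.integral_nonneg ht.2 fun s hs =>
      mul_nonneg (hrho_pos s (ht.1.trans hs.1)).le (Real.exp_pos _).le
  linarith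

/-- If the second condition fails then nonincreasing paths stay away from the optimal one. -/
theorem exists_gap_of_manipulationRate_neg (hT : 0 < T) (hpos : ∀ t, 0 ≤ t → 0 < lam t)
    (hlam : ContDiffOn ℝ 2 lam (Ici 0)) (hrho : ContDiffOn ℝ 1 rho (Ici 0))
    (hrho_pos : ∀ t, 0 ≤ t → 0 < rho t)
    (hden : ∀ t ∈ Icc 0 T, 0 < 2 * rho t + depthGrowth lam t)
    {t₀ : ℝ} (ht₀ : t₀ ∈ Icc 0 T) (h2 : manipulationRate lam rho t₀ < 0) {x : ℝ} :
    ∃ δ > 0, ∀ g e, IsImpactPath rho T x g e → Antitone g →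
      δ ≤ ∫ s in (0 : ℝ)..T, runningRate lam rho s
        * (e s + 1 * (lam s * resilienceRatio lam rho s)) ^ 2 := by
  obtain ⟨p, r, hp, hpr, hr, hq⟩ := exists_Icc_lt_of_continuousOn hT
    (continuousOn_manipulationRate hpos hlam hrho hden) ht₀ h2
  set v : ℝ → ℝ := fun s => Real.exp (cumulativeResilience rho s)
    * (lam s * resilienceRatio lam rho s) with hv
  have hsub : Icc p r ⊆ Icc 0 T := Icc_subset_Icc hp hr
  have hanti : StrictAntiOn v (Icc p r) := by
    refine strictAntiOn_of_deriv_neg (convex_Icc p r)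
      ((continuousOn_exp_mul_resilienceRatio hpos hlam hrho hden).mono hsub) fun t ht => ?_
    rw [interior_Icc] at ht
    rw [hv, (hasDerivAt_exp_mul_resilienceRatio hpos hlam hrho hden
      ⟨hp.trans_lt ht.1, ht.2.trans_le hr⟩).deriv]
    exact mul_neg_of_pos_of_neg (Real.exp_pos _) (mul_neg_of_pos_of_neg
      (hpos t (hp.trans ht.1.le)) (hq t (Ioo_subset_Icc_self ht)))
  -- With `φ = exp(∫ρ) e`, the sum `φ + v` is `exp(∫ρ)` times the distance to the optimum with `κ =
  -- 1`, and is strictly decreasing. According to its sign at the midpoint `m`, it is bounded away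
  -- from `0` on `[p, p']` or on `[r', r]`.
  set m := (p + r) / 2 with hm
  set p' := (p + m) / 2 with hp'
  set r' := (m + r) / 2 with hr'
  have hmm : m ∈ Icc p r := ⟨by linarith, by linarith⟩
  have hpm : p' ∈ Icc p r := ⟨by linarith, by linarith⟩
  have hrm : r' ∈ Icc p r := ⟨by linarith, by linarith⟩
  have hc1 : 0 < v p' - v m := sub_pos.2 (hanti hpm hmm (by linarith))
  have hc2 : 0 < v m - v r' := sub_pos.2 (hanti hmm hrm (by linarith))
  set B := Real.exp (cumulativeResilience rho T) with hB
  have hB0 : 0 < B := Real.exp_pos _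
  obtain ⟨δ₁, hδ₁, H₁⟩ := IsImpactPath.exists_le_integral_square (c := (v p' - v m) / B) hT hpos
    hlam hrho hden hp (show p < p' by linarith) (by linarith) (div_pos hc1 hB0)
  obtain ⟨δ₂, hδ₂, H₂⟩ := IsImpactPath.exists_le_integral_square (c := (v m - v r') / B) hT hpos
    hlam hrho hden (show 0 ≤ r' by linarith) (show r' < r by linarith) hr (div_pos hc2 hB0)
  refine ⟨min δ₁ δ₂, lt_min hδ₁ hδ₂, fun g e h hg => ?_⟩
  have hφ := h.antitoneOn_exp_mul hT hrho.continuousOn hrho_pos hg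
  have habs : ∀ t ∈ Icc 0 T, ∀ c, c ≤ |Real.exp (cumulativeResilience rho t) * e t + v t| →
      c / B ≤ |e t + 1 * (lam t * resilienceRatio lam rho t)| := by
    intro t ht c hc
    rw [div_le_iff₀ hB0, one_mul]
    rw [hv, ← mul_add, abs_mul, abs_of_pos (Real.exp_pos _), mul_comm] at hc
    exact hc.trans (mul_le_mul_of_nonneg_left
      (exp_cumulativeResilience_le hrho.continuousOn hrho_pos ht) (abs_nonneg _))
  rcases le_total 0 (Real.exp (cumulativeResilience rho m) * e m + v m) with h0 | h0
  · refine (min_le_left _ _).trans (H₁ x 1 g e h fun t ht => ?_)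
    have ht' : t ∈ Icc p r := ⟨ht.1, ht.2.trans hpm.2⟩
    refine habs t (hsub ht') _ (le_trans ?_ (le_abs_self _))
    have a1 := hφ (hsub ht') (hsub hmm) (by linarith [ht.2])
    have a2 := hanti.antitoneOn ht' hpm ht.2
    simp only at a1
    linarith
  · refine (min_le_right _ _).trans (H₂ x 1 g e h fun t ht => ?_)
    have ht' : t ∈ Icc p r := ⟨hrm.1.trans ht.1, ht.2⟩
    refine habs t (hsub ht') _ (le_trans ?_ (neg_le_abs _))
    have a1 := hφ (hsub hmm) (hsub ht') (by linarith [ht.1])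
    have a2 := hanti.antitoneOn hrm ht' ht.1
    simp only at a1
    linarith

/-- If `ρ + η` is negative at the terminal time then nonincreasing paths stay away from the optimal
one. -/
theorem exists_gap_of_terminal_neg (hT : 0 < T) (hpos : ∀ t, 0 ≤ t → 0 < lam t)
    (hlam : ContDiffOn ℝ 2 lam (Ici 0)) (hrho : ContDiffOn ℝ 1 rho (Ici 0))
    (hrho_pos : ∀ t, 0 ≤ t → 0 < rho t)
    (hden : ∀ t ∈ Icc 0 T, 0 < 2 * rho t + depthGrowth lam t)
    (h1 : rho T + depthGrowth lam T < 0) {x : ℝ} :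
    ∃ δ > 0, ∀ g e, IsImpactPath rho T x g e → Antitone g →
      δ ≤ (∫ s in (0 : ℝ)..T, runningRate lam rho s
        * (e s + 1 * (lam s * resilienceRatio lam rho s)) ^ 2)
        + (x + (∫ s in (0 : ℝ)..T, rho s * e s) - 1 * lam T) ^ 2 / (2 * lam T) := by
  have hTm : T ∈ Icc 0 T := ⟨hT.le, le_rfl⟩
  have hlT := hpos T hT.le
  set B := Real.exp (cumulativeResilience rho T) with hB
  have hB0 : 0 < B := Real.exp_pos _
  set v : ℝ → ℝ := fun s => Real.exp (cumulativeResilience rho s)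
    * (lam s * resilienceRatio lam rho s) with hv
  -- `G` is the size of the purchase with which the optimal strategy for `κ = 1` would end.
  obtain ⟨G, hG⟩ : ∃ G, G = lam T * (resilienceRatio lam rho T - 1) := ⟨_, rfl⟩
  have hG0 : 0 < G := by
    rw [hG]
    refine mul_pos hlT ?_
    have := one_sub_resilienceRatio (hden T hTm).ne'
    have := div_neg_of_neg_of_pos h1 (hden T hTm)
    linarith
  have hvT : v T = B * G + B * lam T := by rw [hv, hG]; ring
  obtain ⟨p, r, hp, hpr, hr, hlt⟩ := exists_Icc_lt_of_continuousOn hT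
    (continuousOn_exp_mul_resilienceRatio hpos hlam hrho hden).neg hTm
    (show -v T < -v T + B * G / 2 by have := mul_pos hB0 hG0; linarith)
  obtain ⟨δ, hδ, H⟩ := IsImpactPath.exists_le_integral_square (c := G / 4) hT hpos
    hlam hrho hden hp hpr hr (by positivity)
  refine ⟨min δ ((G / 4) ^ 2 / (2 * lam T)), lt_min hδ (by positivity), fun g e h hg => ?_⟩
  have hsq : 0 ≤ (x + (∫ s in (0 : ℝ)..T, rho s * e s) - 1 * lam T) ^ 2 / (2 * lam T) := by
    positivity
  have hI : 0 ≤ ∫ s in (0 : ℝ)..T, runningRate lam rho s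
        * (e s + 1 * (lam s * resilienceRatio lam rho s)) ^ 2 :=
    intervalIntegral.integral_nonneg hT.le fun t ht =>
      mul_nonneg (runningRate_pos hpos ht.1 (hden t ht)).le (sq_nonneg _)
  -- If the terminal impact is not far below the optimal one, then, as selling cannot raise it, `e`
  -- lies above the optimal impact by `G/4` on the interval `[p, r]`. Otherwise the terminal square
  -- is at least `(G/4)²`.
  rcases le_total (x + (∫ s in (0 : ℝ)..T, rho s * e s) - 1 * lam T) (G / 4) with hD | hD
  · refine (min_le_left _ _).trans ((H x 1 g e h fun t ht => ?_).trans
      (le_add_of_nonneg_right hsq))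
    have htT : t ∈ Icc 0 T := ⟨hp.trans ht.1, ht.2.trans hr⟩
    have a1 := h.neg_exp_mul_le hT hrho.continuousOn hrho_pos hg htT
    have a2 := hlt t ht
    have a3 := exp_cumulativeResilience_le hrho.continuousOn hrho_pos htT
    have a4 := mul_le_mul_of_nonneg_left hD hB0.le
    have hv' : v t = Real.exp (cumulativeResilience rho t)
      * (lam t * resilienceRatio lam rho t) := rfl
    have hE := Real.exp_pos (cumulativeResilience rho t)
    have a5 : B * (G / 4) ≤ Real.exp (cumulativeResilience rho t)
        * (e t + 1 * (lam t * resilienceRatio lam rho t)) := by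
      rw [one_mul, mul_add, ← hv']
      have a2' : -v t < -v T + B * G / 2 := a2
      rw [hvT] at a2'
      linarith
    have a6 : Real.exp (cumulativeResilience rho t) * (G / 4) ≤ B * (G / 4) :=
      mul_le_mul_of_nonneg_right a3 (by positivity)
    exact (le_of_mul_le_mul_left (a6.trans a5) hE).trans (le_abs_self _)
  · refine (min_le_right _ _).trans (le_trans ?_ (le_add_of_nonneg_left hI))
    gcongr

/-- If the second condition holds on `[0, T]` and the first one fails, then it fails at `T`. -/
theorem terminal_neg_of_manipulationRate_nonneg (hpos : ∀ t, 0 ≤ t → 0 < lam t)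
    (hlam : ContDiffOn ℝ 2 lam (Ici 0)) (hrho : ContDiffOn ℝ 1 rho (Ici 0))
    (hden : ∀ t ∈ Icc 0 T, 0 < 2 * rho t + depthGrowth lam t)
    (h2 : ∀ t ∈ Icc 0 T, 0 ≤ manipulationRate lam rho t)
    {t₀ : ℝ} (ht₀ : t₀ ∈ Icc 0 T) (h1 : rho t₀ + depthGrowth lam t₀ < 0) :
    rho T + depthGrowth lam T < 0 := by
  have hgc := (contDiffOn_resilienceRatio hpos hlam hrho hden).continuousOn
  have hRc := (continuousOn_cumulativeResilience hrho.continuousOn).mono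
    (Icc_subset_Ici_self : Icc 0 T ⊆ Ici 0)
  -- The second expression equals `r' + ρ (1 - r)`, so `exp(-∫ρ)(1 - r)` is nonincreasing and, once
  -- negative, stays negative up to `T`.
  have hd : ∀ t ∈ Ioo 0 T, HasDerivAt (fun t => Real.exp (-cumulativeResilience rho t)
      * (1 - resilienceRatio lam rho t))
      (-(Real.exp (-cumulativeResilience rho t) * manipulationRate lam rho t)) t := by
    intro t ht
    have hne := (hden t (Ioo_subset_Icc_self ht)).ne'
    refine (((hasDerivAt_cumulativeResilience hrho.continuousOn ht.1).neg.exp).mul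
      ((hasDerivAt_resilienceRatio hpos hlam hrho hden ht).const_sub 1)).congr_deriv ?_
    rw [manipulationRate, ← one_sub_resilienceRatio hne, Pi.neg_apply]
    ring
  have hanti : AntitoneOn (fun t => Real.exp (-cumulativeResilience rho t)
      * (1 - resilienceRatio lam rho t)) (Icc 0 T) := by
    refine antitoneOn_of_deriv_nonpos (convex_Icc 0 T)
      (hRc.neg.rexp.mul (continuousOn_const.sub hgc)) ?_ ?_
    · rw [interior_Icc]
      exact fun t ht => (hd t ht).differentiableAt.differentiableWithinAt
    · rw [interior_Icc]
      intro t ht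
      rw [(hd t ht).deriv, neg_nonpos]
      exact mul_nonneg (Real.exp_pos _).le (h2 t (Ioo_subset_Icc_self ht))
  have hTm : T ∈ Icc 0 T := ⟨ht₀.1.trans ht₀.2, le_rfl⟩
  have h3 := hanti ht₀ hTm ht₀.2
  simp only [one_sub_resilienceRatio (hden t₀ ht₀).ne',
    one_sub_resilienceRatio (hden T hTm).ne'] at h3
  have h4 := h3.trans_lt (mul_neg_of_pos_of_neg (Real.exp_pos _)
    (div_neg_of_neg_of_pos h1 (hden t₀ ht₀)))
  by_contra! h5
  exact absurd h4 (not_lt.2 (mul_nonneg (Real.exp_pos _).le (div_nonneg h5 (hden T hTm).le)))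

end Deterministic

end LimitOrderBook

end

noncomputable section

namespace LimitOrderBook

open Filter Topology

/-! ### Price manipulation when the running rate is not positive -/

section Degenerate

variable {lam rho : ℝ → ℝ} {T : ℝ}

/-- A monotone path from `0` to `0` never trades, so by variation of constants it has no impact. -/
lemma IsImpactPath.impactCost_eq_zero {g e : ℝ → ℝ} (h : IsImpactPath rho T 0 g e) (hT : 0 < T)
    (hrho : ContinuousOn rho (Ici 0)) (hg : Antitone g ∨ Monotone g) :
    impactCost lam rho T 0 e = 0 := by
  have hg0 : ∀ t ∈ Icc 0 T, g t = 0 := by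
    intro t ht
    have hT1 : g (T + 1) = 0 := h.terminal _ (by linarith)
    have h0 := h.initial
    have h2 : t ≤ T + 1 := by linarith [ht.2]
    rcases hg with hg | hg
    · have h3 := hg ht.1
      have h4 := hg h2
      linarith
    · have h3 := hg ht.1
      have h4 := hg h2
      linarith
  have he : ∀ t ∈ Ioc 0 T, e t = 0 := by
    intro t ht
    have ht' := Ioc_subset_Icc_self ht
    have h1 := h.exp_mul_eq hT hrho ht'
    have h2 : (∫ s in (0 : ℝ)..t, rho s * Real.exp (cumulativeResilience rho s) * (g s - 0))
        = ∫ _ in (0 : ℝ)..t, (0 : ℝ) := by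
      refine intervalIntegral.integral_congr fun s hs => ?_
      rw [uIcc_of_le ht.1.le] at hs
      simp only [hg0 s ⟨hs.1, hs.2.trans ht.2⟩]
      ring
    rw [h2, hg0 t ht', intervalIntegral.integral_zero, sub_zero, sub_zero, mul_zero] at h1
    exact (mul_eq_zero.1 h1).resolve_left (Real.exp_pos _).ne'
  rw [impactCost_congr hT (e' := fun _ => 0) he]
  simp [impactCost]

/-- If `2 ρ + η` is negative somewhere, then a round trip can be profitable. -/
theorem exists_impactCost_neg (hT : 0 < T) (hpos : ∀ t, 0 ≤ t → 0 < lam t)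
    (hlam : ContDiffOn ℝ 2 lam (Ici 0)) (hrho : ContDiffOn ℝ 1 rho (Ici 0)) {t₀ : ℝ}
    (ht₀ : t₀ ∈ Icc 0 T) (h : 2 * rho t₀ + depthGrowth lam t₀ < 0) :
    ∃ e : ℝ → ℝ, BoundedVariationOn e univ ∧ (∀ t, ContinuousWithinAt e (Iic t) t) ∧
      impactCost lam rho T 0 e < 0 := by
  have hac := ((contDiffOn_runningRate hpos hlam hrho).continuousOn).mono
    (Icc_subset_Ici_self : Icc 0 T ⊆ Ici 0)
  have hrc := hrho.continuousOn.mono (Icc_subset_Ici_self : Icc 0 T ⊆ Ici 0)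
  have hneg : runningRate lam rho t₀ < 0 :=
    div_neg_of_neg_of_pos h (mul_pos two_pos (hpos t₀ ht₀.1))
  obtain ⟨δ, hδ⟩ : ∃ δ, δ = -runningRate lam rho t₀ / 2 := ⟨_, rfl⟩
  have hδ0 : 0 < δ := by linarith
  obtain ⟨p, r, hp, hpr, hr, hlt⟩ := exists_Icc_lt_of_continuousOn hT hac ht₀
    (show runningRate lam rho t₀ < -δ by linarith)
  obtain ⟨M, hM⟩ := isCompact_Icc.exists_bound_of_continuousOn hrc
  have hM0 : 0 ≤ M := (norm_nonneg _).trans (hM 0 ⟨le_rfl, hT.le⟩)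
  have hlT := hpos T hT.le
  -- Unit impact during a time `l` gains at least `δ l`, while its terminal cost is at most `(M
  -- l)²/(2λ_T)`, of second order in `l`.
  obtain ⟨l, hl0, hl1, hl2⟩ : ∃ l > 0, p + l ≤ r ∧ M ^ 2 * l < δ * (2 * lam T) := by
    have hA : 0 < δ * (2 * lam T) / (M ^ 2 + 1) := by positivity
    refine ⟨min (r - p) (δ * (2 * lam T) / (M ^ 2 + 1)), lt_min (sub_pos.2 hpr) hA, ?_, ?_⟩
    · linarith [min_le_left (r - p) (δ * (2 * lam T) / (M ^ 2 + 1))]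
    · calc M ^ 2 * min (r - p) (δ * (2 * lam T) / (M ^ 2 + 1))
          ≤ M ^ 2 * (δ * (2 * lam T) / (M ^ 2 + 1)) :=
            mul_le_mul_of_nonneg_left (min_le_right _ _) (sq_nonneg M)
        _ < (M ^ 2 + 1) * (δ * (2 * lam T) / (M ^ 2 + 1)) :=
            mul_lt_mul_of_pos_right (lt_add_one _) hA
        _ = δ * (2 * lam T) := by field_simp
  have hpl : p ≤ p + l := by linarith
  have hsub : Icc p (p + l) ⊆ Icc 0 T := Icc_subset_Icc hp (hl1.trans hr)
  refine ⟨(Ioc p (p + l)).indicator fun _ => 1,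
    boundedVariationOn_indicator_Ioc hpl (boundedVariationOn_const 1 _),
    continuousWithinAt_indicator_Ioc _ _ _, ?_⟩
  have e1 : (∫ s in (0 : ℝ)..T, rho s * (Ioc p (p + l)).indicator (fun _ => (1 : ℝ)) s)
      = ∫ s in p..(p + l), rho s := by
    rw [← intervalIntegral_indicator_Ioc hp hpl (hl1.trans hr)]
    congr 1
    funext s
    by_cases hs : s ∈ Ioc p (p + l) <;> simp [hs]
  have e2 : (∫ s in (0 : ℝ)..T,
      runningRate lam rho s * (Ioc p (p + l)).indicator (fun _ => (1 : ℝ)) s ^ 2)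
      = ∫ s in p..(p + l), runningRate lam rho s := by
    rw [← intervalIntegral_indicator_Ioc hp hpl (hl1.trans hr)]
    congr 1
    funext s
    by_cases hs : s ∈ Ioc p (p + l) <;> simp [hs]
  have b1 : |∫ s in p..(p + l), rho s| ≤ M * l := by
    have := intervalIntegral.norm_integral_le_of_norm_le_const (f := rho) (a := p) (b := p + l)
      (C := M) fun s hs => hM s (hsub (by
        rw [uIoc_of_le hpl] at hs
        exact Ioc_subset_Icc_self hs))
    rwa [add_sub_cancel_left, abs_of_pos hl0] at this
  have b2 : ∫ s in p..(p + l), runningRate lam rho s ≤ -δ * l := by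
    have := intervalIntegral.integral_mono_on hpl
      ((hac.mono hsub).intervalIntegrable_of_Icc hpl)
      (intervalIntegrable_const (μ := volume) (c := -δ)) fun s hs =>
        (hlt s ⟨hs.1, hs.2.trans hl1⟩).le
    rw [intervalIntegral.integral_const, smul_eq_mul, add_sub_cancel_left] at this
    linarith
  rw [impactCost, e1, e2, zero_add]
  have b3 : (∫ s in p..(p + l), rho s) ^ 2 ≤ (M * l) ^ 2 := sq_le_sq' (abs_le.1 b1).1 (abs_le.1 b1).2
  have b4 : (∫ s in p..(p + l), rho s) ^ 2 / (2 * lam T) < δ * l := by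
    rw [div_lt_iff₀ (by positivity)]
    nlinarith
  linarith

/-- If `2 ρ + η` is nonnegative but has a zero, then liquidation is possible at arbitrarily small
cost. -/
theorem exists_impactCost_le (hT : 0 < T) (hpos : ∀ t, 0 ≤ t → 0 < lam t)
    (hlam : ContDiffOn ℝ 2 lam (Ici 0)) (hrho : ContDiffOn ℝ 1 rho (Ici 0))
    (hrho_pos : ∀ t, 0 ≤ t → 0 < rho t)
    (hden : ∀ t ∈ Icc 0 T, 0 ≤ 2 * rho t + depthGrowth lam t) {t₀ : ℝ}
    (ht₀ : t₀ ∈ Icc 0 T) (h : 2 * rho t₀ + depthGrowth lam t₀ = 0) {c : ℝ} (hc : 0 < c) :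
    ∃ e : ℝ → ℝ, BoundedVariationOn e univ ∧ (∀ t, ContinuousWithinAt e (Iic t) t) ∧
      impactCost lam rho T 1 e ≤ c := by
  have ha1 := (contDiffOn_runningRate hpos hlam hrho).mono (Icc_subset_Ici_self : Icc 0 T ⊆ Ici 0)
  have hr1 := hrho.mono (Icc_subset_Ici_self : Icc 0 T ⊆ Ici 0)
  set a := runningRate lam rho with ha
  have ha0 : ∀ t ∈ Icc 0 T, 0 ≤ a t := fun t ht =>
    div_nonneg (hden t ht) (mul_pos two_pos (hpos t ht.1)).le
  have hat₀ : a t₀ = 0 := by rw [ha, runningRate, h, zero_div]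
  -- The running rate is `C¹` and vanishes at `t₀`, hence is at most linear there; so its inverse is
  -- not integrable.
  obtain ⟨L, hL0, hL⟩ : ∃ L > 0, ∀ t ∈ Icc 0 T, a t ≤ L * |t - t₀| := by
    obtain ⟨C, hC⟩ := isCompact_Icc.exists_bound_of_continuousOn
      (ha1.continuousOn_derivWithin (uniqueDiffOn_Icc hT) le_rfl)
    refine ⟨max C 1, by positivity, fun t ht => ?_⟩
    have h1 := (convex_Icc 0 T).norm_image_sub_le_of_norm_derivWithin_le
      (ha1.differentiableOn one_ne_zero) hC ht₀ ht
    rw [hat₀, sub_zero, Real.norm_eq_abs, Real.norm_eq_abs] at h1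
    exact (le_abs_self _).trans (h1.trans
      (mul_le_mul_of_nonneg_right (le_max_left _ _) (abs_nonneg _)))
  obtain ⟨m, hm, hmin⟩ := isCompact_Icc.exists_isMinOn (nonempty_Icc.2 hT.le) hr1.continuousOn
  have hr0 : 0 < rho m := hrho_pos m hm.1
  -- On at least one side of `t₀` an interval of length `T/2` fits into `[0, T]`. There `ρ²/(a+ε)`
  -- exceeds `ρ(m)²/(L|s-t₀|+ε)`, so this bound makes `I ≥ 1/c`.
  obtain ⟨ε, hε0, hε⟩ := exists_le_integral_inv_add hL0 (half_pos hT) (1 / (c * rho m ^ 2))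
  have hk0 : ∀ t ∈ Icc 0 T, 0 < a t + ε := fun t ht => add_pos_of_nonneg_of_pos (ha0 t ht) hε0
  have hkc : ContDiffOn ℝ 1 (fun t => rho t / (a t + ε)) (Icc 0 T) :=
    hr1.div (ha1.add contDiffOn_const) fun t ht => (hk0 t ht).ne'
  set I := ∫ s in (0 : ℝ)..T, rho s * (rho s / (a s + ε)) with hI
  have hIi : ContinuousOn (fun s => rho s * (rho s / (a s + ε))) (Icc 0 T) :=
    hr1.continuousOn.mul hkc.continuousOn
  have hI0 : 1 / c ≤ I := by
    have hb : ∀ p r, 0 ≤ p → p ≤ r → r ≤ T →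
        rho m ^ 2 * (∫ s in p..r, (L * |s - t₀| + ε)⁻¹) ≤ I := by
      intro p r hp hpr hr
      have hsub : Icc p r ⊆ Icc 0 T := Icc_subset_Icc hp hr
      have hpt : ∀ s ∈ Icc 0 T, 0 < L * |s - t₀| + ε := fun s _ => by positivity
      calc rho m ^ 2 * (∫ s in p..r, (L * |s - t₀| + ε)⁻¹)
          = ∫ s in p..r, rho m ^ 2 * (L * |s - t₀| + ε)⁻¹ := by
            rw [intervalIntegral.integral_const_mul]
        _ ≤ ∫ s in p..r, rho s * (rho s / (a s + ε)) := by
            refine intervalIntegral.integral_mono_on hpr ?_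
              ((hIi.mono hsub).intervalIntegrable_of_Icc hpr) fun s hs => ?_
            · refine ContinuousOn.intervalIntegrable_of_Icc hpr (continuousOn_const.mul
                (ContinuousOn.inv₀ (by fun_prop) fun s hs => (hpt s (hsub hs)).ne'))
            · rw [← mul_div_assoc, ← sq, div_eq_mul_inv]
              refine mul_le_mul (pow_le_pow_left₀ hr0.le (hmin (hsub hs)) 2)
                (inv_anti₀ (hk0 s (hsub hs)) (by linarith [hL s (hsub hs)]))
                (inv_pos.2 (hpt s (hsub hs))).le (sq_nonneg _)
        _ ≤ I := by
            refine intervalIntegral.integral_mono_interval hp hpr hr ?_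
              (hIi.intervalIntegrable_of_Icc hT.le)
            filter_upwards [ae_restrict_mem measurableSet_Ioc] with t ht
            have ht' := Ioc_subset_Icc_self ht
            exact mul_nonneg (hrho_pos t ht'.1).le
              (div_nonneg (hrho_pos t ht'.1).le (hk0 t ht').le)
    have hfin : ∀ J, rho m ^ 2 * J ≤ I → 1 / (c * rho m ^ 2) ≤ J → 1 / c ≤ I := by
      intro J h1 h2
      refine le_trans ?_ h1
      calc 1 / c = rho m ^ 2 * (1 / (c * rho m ^ 2)) := by field_simp
        _ ≤ _ := mul_le_mul_of_nonneg_left h2 (sq_nonneg _)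
    rcases le_total t₀ (T / 2) with h3 | h3
    · refine hfin _ (hb t₀ (t₀ + T / 2) ht₀.1 (by linarith) (by linarith)) (hε.trans_eq ?_)
      have h4 := intervalIntegral.integral_comp_sub_right (a := t₀) (b := t₀ + T / 2)
        (fun s => (L * |s| + ε)⁻¹) t₀
      rw [h4, sub_self, add_sub_cancel_left]
      refine intervalIntegral.integral_congr fun s hs => ?_
      rw [uIcc_of_le (half_pos hT).le] at hs
      simp only [abs_of_nonneg hs.1]
    · refine hfin _ (hb (t₀ - T / 2) t₀ (by linarith) (by linarith) ht₀.2) (hε.trans_eq ?_)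
      have h4 := intervalIntegral.integral_comp_sub_left (a := t₀ - T / 2) (b := t₀)
        (fun s => (L * |s| + ε)⁻¹) t₀
      simp only [abs_sub_comm t₀] at h4
      rw [h4, sub_self, sub_sub_cancel]
      refine intervalIntegral.integral_congr fun s hs => ?_
      rw [uIcc_of_le (half_pos hT).le] at hs
      simp only [abs_of_nonneg hs.1]
  have hIpos : 0 < I := lt_of_lt_of_le (by positivity) hI0
  -- The impact `e = -I⁻¹ ρ/(a+ε)` satisfies `∫ρe = -1`, so nothing is left after the last trade,
  -- and its running cost is at most `1/I ≤ c`.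
  obtain ⟨e, he, hl, hee⟩ := exists_boundedVariation_extension hT.le
    ((contDiffOn_const (c := -I⁻¹)).mul hkc)
  refine ⟨e, he, hl, ?_⟩
  have e1 : (∫ s in (0 : ℝ)..T, rho s * e s) = -1 := by
    calc (∫ s in (0 : ℝ)..T, rho s * e s) = -I⁻¹ * I := by
          rw [hI, ← intervalIntegral.integral_const_mul]
          refine intervalIntegral.integral_congr fun s hs => ?_
          rw [uIcc_of_le hT.le] at hs
          simp only [hee s hs]
          ring
      _ = -1 := by rw [neg_mul, inv_mul_cancel₀ hIpos.ne']
  have e2 : (∫ s in (0 : ℝ)..T, a s * e s ^ 2) ≤ I⁻¹ ^ 2 * I := by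
    rw [hI, ← intervalIntegral.integral_const_mul, ← hI]
    have hec : ContinuousOn e (Icc 0 T) :=
      ((contDiffOn_const (c := -I⁻¹)).mul hkc).continuousOn.congr hee
    refine intervalIntegral.integral_mono_on hT.le
      ((ha1.continuousOn.mul (hec.pow 2)).intervalIntegrable_of_Icc hT.le)
      ((continuousOn_const.mul hIi).intervalIntegrable_of_Icc hT.le) fun s hs => ?_
    rw [hee s hs]
    have hk := hk0 s hs
    have hr := hrho_pos s hs.1
    calc a s * (-I⁻¹ * (rho s / (a s + ε))) ^ 2
        ≤ (a s + ε) * (-I⁻¹ * (rho s / (a s + ε))) ^ 2 :=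
          mul_le_mul_of_nonneg_right (by linarith) (sq_nonneg _)
      _ = I⁻¹ ^ 2 * (rho s * (rho s / (a s + ε))) := by field_simp
  rw [impactCost, e1]
  have e3 : I⁻¹ ^ 2 * I = I⁻¹ := by field_simp
  have e4 : I⁻¹ ≤ c := by
    rw [one_div] at hI0
    exact inv_le_of_inv_le₀ hc hI0
  rw [show (1 : ℝ) + -1 = 0 by norm_num]
  linarith [show (0 : ℝ) ^ 2 / (2 * lam T) = 0 by simp]

end Degenerate

end LimitOrderBook

end

noncomputable section

namespace LimitOrderBook

open Filter Topology

/-! ### Characterization of price manipulation -/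

section Characterization

variable {Ω : Type*} [mΩ : MeasurableSpace Ω] {P : Measure Ω} [IsProbabilityMeasure P]
  {ℱ : Filtration ℝ≥0 mΩ} {S : ℝ≥0 → Ω → ℝ} {lam rho : ℝ → ℝ} {T : ℝ}

/-- The first condition and `ρ > 0` force `2ρ + η > 0`, so the explicit optimum exists. It is linear
in `x`: one nonincreasing path for `x = K` serves every `x` after scaling, with the order reversed
when `x < 0`. -/
theorem not_admitsTTPM_of_nonneg (hS : Martingale S ℱ P)
    (hSr : ∀ ω t, ContinuousWithinAt (fun s => S s ω) (Ici t) t) (hT : 0 < T)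
    (hpos : ∀ t, 0 ≤ t → 0 < lam t) (hlam : ContDiffOn ℝ 2 lam (Ici 0))
    (hrho_pos : ∀ t, 0 ≤ t → 0 < rho t) (hrho : ContDiffOn ℝ 1 rho (Ici 0))
    (h1 : ∀ t ∈ Icc 0 T, 0 ≤ depthGrowth lam t + rho t)
    (h2 : ∀ t ∈ Icc 0 T, 0 ≤ manipulationRate lam rho t) :
    ¬ AdmitsTTPM ℱ P S blockShape lam rho T := by
  have hden : ∀ t ∈ Icc 0 T, 0 < 2 * rho t + depthGrowth lam t := fun t ht => by
    have := h1 t ht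
    have := hrho_pos t ht.1
    linarith
  refine not_admitsTTPM_of_le_impactCost hS hSr hT hpos hlam hrho.continuousOn hrho_pos
    fun x => ?_
  have hgc := contDiffOn_resilienceRatio hpos hlam hrho hden
  obtain ⟨u, hu, hul, hue⟩ := exists_boundedVariation_extension hT.le
    (((hlam.of_le (by norm_num)).mono (Icc_subset_Ici_self : Icc 0 T ⊆ Ici 0)).mul hgc).neg
  set K := lam T + ∫ s in (0 : ℝ)..T, rho s * (lam s * resilienceRatio lam rho s) with hK
  have hK0 : 0 < K := depth_add_integral_pos hT hpos hrho_pos hden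
  have hanti := antitone_impactPath_optimal hT hpos hlam hrho hrho_pos hden
    (by have := h1 T ⟨hT.le, le_rfl⟩; linarith) h2 hue
  have hκ : x / K * K = x := div_mul_cancel₀ x hK0.ne'
  refine ⟨fun s => x / K * u s, (lipschitzWith_smul (x / K)).comp_boundedVariationOn hu,
    fun t => (hul t).const_mul _, ?_, fun g' e' h => ?_⟩
  · have hmul : impactPath rho T x (fun s => x / K * u s)
        = fun t => x / K * impactPath rho T K u t := by
      funext t
      rw [← impactPath_mul, hκ]
    rw [hmul]
    rcases le_total 0 (x / K) with h0 | h0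
    · exact Or.inl fun s t hst => mul_le_mul_of_nonneg_left (hanti hst) h0
    · exact Or.inr fun s t hst => mul_le_mul_of_nonpos_left (hanti hst) h0
  · rw [impactCost_optimal hT hpos hden hκ fun t ht => by rw [hue t ht, mul_neg],
      h.impactCost_eq hT hpos hlam hrho hden hκ]
    have hI : 0 ≤ ∫ s in (0 : ℝ)..T, runningRate lam rho s
        * (e' s + x / K * (lam s * resilienceRatio lam rho s)) ^ 2 :=
      intervalIntegral.integral_nonneg hT.le fun t ht =>
        mul_nonneg (runningRate_pos hpos ht.1 (hden t ht)).le (sq_nonneg _)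
    have hlT := hpos T hT.le
    have hsq : 0 ≤ (x + (∫ s in (0 : ℝ)..T, rho s * e' s) - x / K * lam T) ^ 2 / (2 * lam T) := by
      positivity
    linarith

/-- Taking `x = K` normalizes `κ` to `1`; the two squares are then the excess of a path over the
optimal cost. -/
theorem admitsTTPM_of_gap (hS : Martingale S ℱ P)
    (hSr : ∀ ω t, ContinuousWithinAt (fun s => S s ω) (Ici t) t) (hT : 0 < T)
    (hpos : ∀ t, 0 ≤ t → 0 < lam t) (hlam : ContDiffOn ℝ 2 lam (Ici 0))
    (hrho_pos : ∀ t, 0 ≤ t → 0 < rho t) (hrho : ContDiffOn ℝ 1 rho (Ici 0))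
    (hden : ∀ t ∈ Icc 0 T, 0 < 2 * rho t + depthGrowth lam t)
    (h : ∀ x, ∃ δ > 0, ∀ g e, IsImpactPath rho T x g e → Antitone g →
      δ ≤ (∫ s in (0 : ℝ)..T, runningRate lam rho s
        * (e s + 1 * (lam s * resilienceRatio lam rho s)) ^ 2)
        + (x + (∫ s in (0 : ℝ)..T, rho s * e s) - 1 * lam T) ^ 2 / (2 * lam T)) :
    AdmitsTTPM ℱ P S blockShape lam rho T := by
  have hgc := contDiffOn_resilienceRatio hpos hlam hrho hden
  obtain ⟨u, hu, hul, hue⟩ := exists_boundedVariation_extension hT.le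
    (((hlam.of_le (by norm_num)).mono (Icc_subset_Ici_self : Icc 0 T ⊆ Ici 0)).mul hgc).neg
  set K := lam T + ∫ s in (0 : ℝ)..T, rho s * (lam s * resilienceRatio lam rho s) with hK
  have hK0 : 0 < K := depth_add_integral_pos hT hpos hrho_pos hden
  obtain ⟨δ, hδ, H⟩ := h K
  refine admitsTTPM_of_impactCost_lt (x := K) hS hSr hT hpos hlam hrho.continuousOn hrho_pos hu hul
    hδ fun g' e' h' hm => ?_
  have h1 := H g' e' h' (h'.antitone_of_pos hT hK0 hm)
  rw [impactCost_optimal hT hpos hden (one_mul K) fun t ht => by rw [hue t ht, one_mul],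
    h'.impactCost_eq hT hpos hlam hrho hden (one_mul K)]
  linarith

theorem admitsTTPM_of_den_neg (hS : Martingale S ℱ P)
    (hSr : ∀ ω t, ContinuousWithinAt (fun s => S s ω) (Ici t) t) (hT : 0 < T)
    (hpos : ∀ t, 0 ≤ t → 0 < lam t) (hlam : ContDiffOn ℝ 2 lam (Ici 0))
    (hrho_pos : ∀ t, 0 ≤ t → 0 < rho t) (hrho : ContDiffOn ℝ 1 rho (Ici 0)) {t₀ : ℝ}
    (ht₀ : t₀ ∈ Icc 0 T) (h : 2 * rho t₀ + depthGrowth lam t₀ < 0) :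
    AdmitsTTPM ℱ P S blockShape lam rho T := by
  obtain ⟨e, he, hl, hneg⟩ := exists_impactCost_neg hT hpos hlam hrho ht₀ h
  refine admitsTTPM_of_impactCost_lt (x := 0) hS hSr hT hpos hlam hrho.continuousOn hrho_pos he hl
    (neg_pos.2 hneg) fun g' e' h' hm => ?_
  rw [h'.impactCost_eq_zero hT hrho.continuousOn hm, add_neg_cancel]

theorem admitsTTPM_of_den_eq_zero (hS : Martingale S ℱ P)
    (hSr : ∀ ω t, ContinuousWithinAt (fun s => S s ω) (Ici t) t) (hT : 0 < T)
    (hpos : ∀ t, 0 ≤ t → 0 < lam t) (hlam : ContDiffOn ℝ 2 lam (Ici 0))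
    (hrho_pos : ∀ t, 0 ≤ t → 0 < rho t) (hrho : ContDiffOn ℝ 1 rho (Ici 0))
    (hden : ∀ t ∈ Icc 0 T, 0 ≤ 2 * rho t + depthGrowth lam t) {t₀ : ℝ}
    (ht₀ : t₀ ∈ Icc 0 T) (h : 2 * rho t₀ + depthGrowth lam t₀ = 0) :
    AdmitsTTPM ℱ P S blockShape lam rho T := by
  have hlT := hpos T hT.le
  set B := Real.exp (cumulativeResilience rho T) with hB
  have hB0 : 0 < B := Real.exp_pos _
  -- Selling one share monotonically leaves an impact of at least `1/B` in size, hence costs at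
  -- least `2c`; some other strategy costs at most `c`.
  obtain ⟨c, hc⟩ : ∃ c, c = (1 / B) ^ 2 / (2 * lam T) / 2 := ⟨_, rfl⟩
  have hc0 : 0 < c := by rw [hc]; positivity
  obtain ⟨e, he, hl, hle⟩ := exists_impactCost_le hT hpos hlam hrho hrho_pos hden ht₀ h hc0
  refine admitsTTPM_of_impactCost_lt (x := 1) hS hSr hT hpos hlam hrho.continuousOn hrho_pos he hl
    hc0 fun g' e' h' hm => ?_
  have h1 := h'.le_exp_mul_add_integral hT hrho.continuousOn hrho_pos
    (h'.antitone_of_pos hT one_pos hm)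
  have h2 : 1 / B ≤ 1 + ∫ s in (0 : ℝ)..T, rho s * e' s := by
    rwa [div_le_iff₀ hB0, mul_comm]
  have h3 : (1 / B) ^ 2 / (2 * lam T)
      ≤ (1 + ∫ s in (0 : ℝ)..T, rho s * e' s) ^ 2 / (2 * lam T) := by
    gcongr
  have h4 : 0 ≤ ∫ s in (0 : ℝ)..T, runningRate lam rho s * e' s ^ 2 :=
    intervalIntegral.integral_nonneg hT.le fun t ht =>
      mul_nonneg (div_nonneg (hden t ht) (mul_pos two_pos (hpos t ht.1)).le) (sq_nonneg _)
  have h5 : impactCost lam rho T 1 e' = (1 + ∫ s in (0 : ℝ)..T, rho s * e' s) ^ 2 / (2 * lam T)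
    + ∫ s in (0 : ℝ)..T, runningRate lam rho s * e' s ^ 2 := rfl
  linarith

/-- The order of the cases matters: the gap arguments need `2ρ + η > 0`, and the failure of the
first condition is moved to `T` only once the second is known on `[0, T]`. -/
theorem not_admitsTTPM_iff (hS : Martingale S ℱ P)
    (hSr : ∀ ω t, ContinuousWithinAt (fun s => S s ω) (Ici t) t) (hT : 0 < T)
    (hpos : ∀ t, 0 ≤ t → 0 < lam t) (hlam : ContDiffOn ℝ 2 lam (Ici 0))
    (hrho_pos : ∀ t, 0 ≤ t → 0 < rho t) (hrho : ContDiffOn ℝ 1 rho (Ici 0)) :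
    ¬ AdmitsTTPM ℱ P S blockShape lam rho T ↔
      ∀ t ∈ Icc 0 T, 0 ≤ depthGrowth lam t + rho t ∧ 0 ≤ manipulationRate lam rho t := by
  refine ⟨fun hno => ?_, fun h => not_admitsTTPM_of_nonneg hS hSr hT hpos hlam hrho_pos hrho
    (fun t ht => (h t ht).1) fun t ht => (h t ht).2⟩
  have hden0 : ∀ t ∈ Icc 0 T, 0 ≤ 2 * rho t + depthGrowth lam t := fun t ht => by
    by_contra! hneg
    exact hno (admitsTTPM_of_den_neg hS hSr hT hpos hlam hrho_pos hrho ht hneg)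
  have hden : ∀ t ∈ Icc 0 T, 0 < 2 * rho t + depthGrowth lam t := fun t ht =>
    (hden0 t ht).lt_of_ne fun h0 =>
      hno (admitsTTPM_of_den_eq_zero hS hSr hT hpos hlam hrho_pos hrho hden0 ht h0.symm)
  have h2 : ∀ t ∈ Icc 0 T, 0 ≤ manipulationRate lam rho t := fun t ht => by
    by_contra! hneg
    refine hno (admitsTTPM_of_gap hS hSr hT hpos hlam hrho_pos hrho hden fun x => ?_)
    obtain ⟨δ, hδ, H⟩ := exists_gap_of_manipulationRate_neg hT hpos hlam hrho hrho_pos hden ht hneg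
    have hlT := hpos T hT.le
    exact ⟨δ, hδ, fun g e h hg => (H g e h hg).trans (le_add_of_nonneg_right (by positivity))⟩
  refine fun t ht => ⟨?_, h2 t ht⟩
  by_contra! hneg
  exact hno (admitsTTPM_of_gap hS hSr hT hpos hlam hrho_pos hrho hden fun x =>
    exists_gap_of_terminal_neg hT hpos hlam hrho hrho_pos hden
      (terminal_neg_of_manipulationRate_nonneg hpos hlam hrho hden h2 ht (by linarith)))

end Characterization

end LimitOrderBook

end

theorem mainTheorem9 {Ω : Type*} [mΩ : MeasurableSpace Ω] (P : Measure Ω) [IsProbabilityMeasure P]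
    (ℱ : Filtration ℝ≥0 mΩ) (S : ℝ≥0 → Ω → ℝ) (hS : Martingale S ℱ P)
    (hS_right : ∀ ω t, ContinuousWithinAt (fun s => S s ω) (Ici t) t)
    (lam rho : ℝ → ℝ)
    (hlam_pos : ∀ t, 0 ≤ t → 0 < lam t) (hlam : ContDiffOn ℝ 2 lam (Ici 0))
    (hrho_pos : ∀ t, 0 ≤ t → 0 < rho t) (hrho : ContDiffOn ℝ 1 rho (Ici 0)) :
    ((∀ T : ℝ, 0 < T →
        ¬ LimitOrderBook.AdmitsTTPM ℱ P S LimitOrderBook.blockShape lam rho T) ↔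
      ∀ t : ℝ, 0 ≤ t →
        0 ≤ LimitOrderBook.depthGrowth lam t + rho t ∧
        0 ≤ derivWithin
              (fun s => rho s / (2 * rho s + LimitOrderBook.depthGrowth lam s)) (Ici 0) t
            + rho t * ((rho t + LimitOrderBook.depthGrowth lam t) /
                (2 * rho t + LimitOrderBook.depthGrowth lam t))) ∧
    (∀ T : ℝ, 0 < T →
      (¬ LimitOrderBook.AdmitsTTPM ℱ P S LimitOrderBook.blockShape lam rho T ↔
        ∀ t ∈ Icc (0 : ℝ) T,
          0 ≤ LimitOrderBook.depthGrowth lam t + rho t ∧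
          0 ≤ derivWithin
                (fun s => rho s / (2 * rho s + LimitOrderBook.depthGrowth lam s)) (Ici 0) t
              + rho t * ((rho t + LimitOrderBook.depthGrowth lam t) /
                  (2 * rho t + LimitOrderBook.depthGrowth lam t)))) := by
  have h := fun (T : ℝ) (hT : 0 < T) =>
    LimitOrderBook.not_admitsTTPM_iff hS hS_right hT hlam_pos hlam hrho_pos hrho
  -- The horizon `t + 1` is positive even for `t = 0` and contains `t`.
  exact ⟨⟨fun hno t ht => (h (t + 1) (by linarith)).1 (hno _ (by linarith)) t ⟨ht, by linarith⟩,
    fun hc T hT => (h T hT).2 fun t ht => hc t ht.1⟩, h⟩
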